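/- **The theory.** Let $T$ be the first-order theory of two-sorted structures $(\mathcal M,\Gamma)$ such that: $\mathcal M$ is a nonempty dense meet tree, i.e. a partial order in which any two points $x,y$ have a greatest lower bound $x\wedge y$, the points below any given point are linearly ordered, the order is dense, and no point is minimal; $\Gamma$ is an infinite set; for each $d\in\mathcal M$ there is a bijection $g_d$ from the set of open cones at $d$ (the classes of the equivalence relation $x\wedge y>d$ on $\{x: x>d\}$) onto $\Gamma$, given by the relation $g_d(x)=\gamma$ between $d$, $x>d$ and $\gamma$ ($g_d(x)$ denotes the image of the open cone at $d$ containing $x$); and the labelling is generic: for all $d<x$ in $\mathcal M$ and $\gamma\in\Gamma$ there is $e$ with $d<e<x$ and $g_e(x)=\gamma$. For $c\in \mathcal M$ let $f_c(x)=g_{x\wedge c}(x)\in\Gamma$ for the points $x\not\le c$. **Terminology** (all over the base set $\emptyset$). Let $M$ be a monster model of $T$ ($\kappa$-saturated and strongly $\kappa$-homogeneous for an uncountable $\kappa$, "small" meaning of size $<\kappa$); $\mathrm{dcl}$ and $\mathrm{acl}$ are taken in $M^{eq}$. For a $\emptyset$-definable global type $p$, the germ $[f_c]_p$ is the class of $c$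 for the $\emptyset$-definable equivalence relation "$f_c(x)=f_{c'}(x)\in p(x)$" (an equality of partial functions, true at $x$ if both sides are undefined or both are defined and equal). The germ is *strong* if $f_c(a)\in\mathrm{dcl}([f_c]_p,a)$ for all $a\models p|_c$, and *almost strong* if $f_c(a)\in\mathrm{acl}([f_c]_p,a)$ for all $a\models p|_c$. $\mathrm{St}_B$ is the collection of the elements of all $B$-definable, stable, stably embedded sets of $M^{eq}$. $\mathrm{St}_\emptyset$ has the bounded stabilizing property (BS) if for no small $A\subseteq M^{eq}$ and no finite tuple $a$ in $M^{eq}$ there is a strictly increasing chain of length $|T|^+$ of relatively definably closed subsets of $\mathrm{St}_\emptyset$ between $\mathrm{St}_\emptyset\cap\mathrm{dcl}(A)$ and $\mathrm{St}_\emptyset\cap\mathrm{dcl}(Aa)$. **Statement.** $T$ is complete. In every monster model $M$ of $T$: 1. $\mathrm{St}_\emptyset$ has BS. 2. There is exactly one $\emptyset$-definable global type $p(x)$ in the tree sort such that, for all points $c,d$ of $M$, the formulas $x\not\le c$ and $x\wedge c<d$ are in $p$ (the generic type of the tree). 3. For each point $c$ of $M$, $f_c$ is defined on $p$, and for every $a$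 at which $f_c$ is defined, $f_c(a)\in\Gamma$ and $f_c(a)\in\mathrm{St}_{a}$. 4. All the $f_c$ have the same $p$-germ, and $[f_c]_p\in\mathrm{dcl}(\emptyset)$, i.e. the germ is $\emptyset$-definable. 5. For each point $c$ of $M$, the germ $[f_c]_p$ is not strong, and it is not even almost strong. So $p$ and $f_c$ satisfy the hypotheses, and fail the conclusion, of the assertion of Haskell, Hrushovski and Macpherson (Proposition 6.7, first part): "if $p$ is a global $A$-definable type, $\mathrm{St}_A$ has BS, and $f$ is a definable function on $p$ with $f(a)\in\mathrm{St}_{Aa}$ for all $a\models p|_A$, then the germ of $f$ on $p$ is strong over $A$". -/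

import Mathlib

open FirstOrder FirstOrder.Language

universe u

/-! ## General model theory: imaginaries, closures, global types, germs -/

namespace GermStrength

section General

variable (L : FirstOrder.Language.{0, 0}) (M : Type u) [L.Structure M]

/-- An imaginary sort: the quotient of `M ^ n` by a `∅`-definable equivalence relation. -/
structure ImagSort where
  n : ℕ
  E : Setoid (Fin n → M)
  definable : (∅ : Set M).Definable L
    {v : Fin n ⊕ Fin n → M | E.r (fun i => v (Sum.inl i)) (fun i => v (Sum.inr i))}

/-- The elements of `M^eq`. -/
def Imag : Type u := Σ s : ImagSort L M, Quotient s.E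

variable {M}

/-- The real sort, that is `M` itself as an imaginary sort. -/
def realSort : ImagSort L M where
  n := 1
  E := ⊥
  definable := by
    rw [Set.empty_definable_iff]
    refine ⟨((Term.var (Sum.inl 0) : L.Term (Fin 1 ⊕ Fin 1)).equal (Term.var (Sum.inr 0))), ?_⟩
    ext v
    simp only [Set.mem_ofPred_eq, Formula.realize_equal, Term.realize_var]
    constructor
    · intro h
      exact congrFun h 0
    · intro h
      funext i
      have hi : i = 0 := Subsingleton.elim _ _
      subst hi
      exact h

/-- A real element, seen in `M^eq`. -/
def real (a : M) : Imag L M := ⟨realSort L, Quotient.mk _ (fun _ => a)⟩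

variable {L}

/-- The set `X ⊆ M ^ α` is definable with parameters from the set `A` of imaginaries. An imaginary
parameter is used in a formula through its representatives. -/
def EqDefinable (A : Set (Imag L M)) {α : Type} (X : Set (α → M)) : Prop :=
  ∃ (k : ℕ) (e : Fin k → Imag L M), (∀ i, e i ∈ A) ∧
    ∃ R : L.Formula (α ⊕ (Σ i : Fin k, Fin (e i).1.n)),
      X = {x | ∃ y : ∀ i : Fin k, Fin (e i).1.n → M,
        (∀ i, Quotient.mk (e i).1.E (y i) = (e i).2) ∧
          R.Realize (Sum.elim x (fun j => y j.1 j.2))}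

/-- The set of representatives of the members of a set of imaginaries of one sort. -/
def reps (s : ImagSort L M) (D : Set (Quotient s.E)) : Set (Fin s.n → M) :=
  {y | Quotient.mk s.E y ∈ D}

/-- `dcl^eq(A)`. -/
def dclEq (A : Set (Imag L M)) : Set (Imag L M) :=
  {e | EqDefinable A (reps e.1 {e.2})}

/-- `acl^eq(A)`. -/
def aclEq (A : Set (Imag L M)) : Set (Imag L M) :=
  {e | ∃ D : Set (Quotient e.1.E), D.Finite ∧ e.2 ∈ D ∧ EqDefinable A (reps e.1 D)}

/-- The representatives of the members of a relation on `k`-tuples of imaginaries of one sort. -/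
def tupleReps (s : ImagSort L M) {ι : Type} (Y : Set (ι → Quotient s.E)) :
    Set (ι × Fin s.n → M) :=
  {v | (fun i => Quotient.mk s.E (fun j => v (i, j))) ∈ Y}

/-- The `B`-definable set `D` of imaginaries is stably embedded: every subset of `D ^ k` definable
with arbitrary parameters is definable with parameters from `B ∪ D`. -/
def IsStablyEmbedded (B : Set M) (s : ImagSort L M) (D : Set (Quotient s.E)) : Prop :=
  ∀ (k : ℕ) (Y : Set (Fin k → Quotient s.E)), (∀ y ∈ Y, ∀ i, y i ∈ D) →
    (Set.univ : Set M).Definable L (tupleReps s Y) →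
      EqDefinable (real L '' B ∪ {e | ∃ d ∈ D, e = ⟨s, d⟩}) (tupleReps s Y)

/-- The `B`-definable set `D` of imaginaries, with the structure given by all `B`-definable
relations on it, is stable: no such relation has the order property. -/
def IsStable (B : Set M) (s : ImagSort L M) (D : Set (Quotient s.E)) : Prop :=
  ∀ (k l : ℕ) (R : Set (Fin k ⊕ Fin l → Quotient s.E)), B.Definable L (tupleReps s R) →
    ∃ N : ℕ, ¬ ∃ (a : Fin N → Fin k → Quotient s.E) (b : Fin N → Fin l → Quotient s.E),
      (∀ i j, a i j ∈ D) ∧ (∀ i j, b i j ∈ D) ∧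
        ∀ i j, Sum.elim (a i) (b j) ∈ R ↔ i < j

variable (L) in
/-- `St_B`: the elements of all the `B`-definable, stable, stably embedded sets of imaginaries. -/
def St (B : Set M) : Set (Imag L M) :=
  {e | ∃ D : Set (Quotient e.1.E), e.2 ∈ D ∧ B.Definable L (reps e.1 D) ∧
    IsStablyEmbedded B e.1 D ∧ IsStable B e.1 D}

variable (L) in
/-- The bounded stabilizing property for `St_B`, where a set is small if it has fewer than `κ`
elements: for small `A ⊇ B` and a finite tuple `a`, there is no strictly increasing chain, of
length `|T|⁺`, of definably closed subsets of `St_B` between `St_B ∩ dcl(A)` and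
`St_B ∩ dcl(A a)`. -/
def HasBS (κ : Cardinal.{u}) (B : Set M) : Prop :=
  ∀ A : Set (Imag L M), Cardinal.mk A < κ → real L '' B ⊆ A →
    ∀ (n : ℕ) (a : Fin n → Imag L M),
      ¬ ∃ S : (Order.succ (max Cardinal.aleph0 L.card)).ord.ToType → Set (Imag L M),
        StrictMono S ∧ ∀ i, St L B ∩ dclEq A ⊆ S i ∧ S i ⊆ St L B ∩ dclEq (A ∪ Set.range a) ∧
          St L B ∩ dclEq (S i) ⊆ S i

variable (L M) in
/-- `M` is a monster model, where a set is small if it has fewer than `κ` elements: `M` is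
`κ`-saturated and strongly `κ`-homogeneous, and `κ` is uncountable. -/
structure IsMonster (κ : Cardinal.{u}) : Prop where
  aleph0_lt : Cardinal.aleph0 < κ
  saturated : ∀ A : Set M, Cardinal.mk A < κ → ∀ 𝒳 : Set (Set M),
    (∀ X ∈ 𝒳, A.Definable₁ L X) →
    (∀ 𝓕 : Finset (Set M), (𝓕 : Set (Set M)) ⊆ 𝒳 → (⋂₀ (𝓕 : Set (Set M))).Nonempty) →
    (⋂₀ 𝒳).Nonempty
  homogeneous : ∀ A : Set M, Cardinal.mk A < κ → ∀ h : A → M,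
    (∀ φ : L.Formula A, φ.Realize (fun a : A => (a : M)) ↔ φ.Realize h) →
    ∃ σ : M ≃[L] M, ∀ a : A, σ a = h a

variable (L M) in
/-- Global types: the complete types over `M` in one variable. -/
abbrev GlobalType := (L.elementaryDiagram M).CompleteType (Fin 1)

/-- The definable set `X` belongs to the global type `p`: some formula of `p`, with parameters
in `M`, implies `X`. For `X` defined by a formula over `M` this says that this formula is in `p`. -/
def Holds (p : GlobalType L M) (X : Set M) : Prop :=
  ∃ φ : L[[M]].Formula (Fin 1), Formula.equivSentence φ ∈ p ∧
    ∀ x : M, φ.Realize (fun _ => x) → x ∈ X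

/-- The global type `p` is `A`-definable: for each formula `φ(x, y)` the set of the `b` with
`φ(x, b) ∈ p` is `A`-definable. -/
def IsDefinableOver (A : Set M) (p : GlobalType L M) : Prop :=
  ∀ (n : ℕ) (Y : Set (Fin (n + 1) → M)), (∅ : Set M).Definable L Y →
    A.Definable L {b : Fin n → M | Holds p {x | (Fin.cons x b : Fin (n + 1) → M) ∈ Y}}

/-- `a` realizes the restriction of `p` to `A`. -/
def Realizes (p : GlobalType L M) (A : Set M) (a : M) : Prop :=
  ∀ X : Set M, A.Definable₁ L X → Holds p X → a ∈ X

variable (L M) in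
/-- A `∅`-definable family `(f_c)` of partial functions, given by their graphs: `graph c x y` means
that `f_c` is defined at `x` and `f_c(x) = y`. -/
structure DefFamily where
  graph : M → M → M → Prop
  functional : ∀ c x y y', graph c x y → graph c x y' → y = y'
  definable : (∅ : Set M).Definable L {v : Fin 3 → M | graph (v 0) (v 1) (v 2)}

theorem Holds.mono {p : GlobalType L M} {X Y : Set M} (h : Holds p X) (hXY : X ⊆ Y) :
    Holds p Y := by
  obtain ⟨φ, hφ, h⟩ := h
  exact ⟨φ, hφ, fun x hx => hXY (h x hx)⟩

theorem holds_univ (p : GlobalType L M) : Holds p Set.univ := by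
  refine ⟨⊤, ?_, fun _ _ => trivial⟩
  rcases p.mem_or_not_mem (Formula.equivSentence (⊤ : L[[M]].Formula (Fin 1))) with h | h
  · exact h
  · refine p.isMaximal.mem_of_models fun N v xs => ?_
    exact fun h' => h'

theorem Holds.inter {p : GlobalType L M} {X Y : Set M} (hX : Holds p X) (hY : Holds p Y) :
    Holds p (X ∩ Y) := by
  obtain ⟨φ, hφ, hX⟩ := hX
  obtain ⟨ψ, hψ, hY⟩ := hY
  refine ⟨φ ⊓ ψ, ?_, fun x hx => ?_⟩
  · rw [Formula.equivSentence_inf]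
    refine p.isMaximal.mem_of_models fun N v xs => ?_
    have h1 := Theory.models_sentence_of_mem hφ N v xs
    have h2 := Theory.models_sentence_of_mem hψ N v xs
    exact BoundedFormula.realize_inf.2 ⟨h1, h2⟩
  · rw [Formula.realize_inf] at hx
    exact ⟨hX x hx.1, hY x hx.2⟩

/-- `f_c` and `f_{c'}` have the same germ on `p`: the formula `f_c(x) = f_{c'}(x)` is in `p`. -/
def SameGerm (p : GlobalType L M) (f : DefFamily L M) (c c' : M) : Prop :=
  Holds p {x | ∀ y, f.graph c x y ↔ f.graph c' x y}

theorem sameGerm_definable (p : GlobalType L M) (hp : IsDefinableOver ∅ p) (f : DefFamily L M) :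
    (∅ : Set M).Definable L {v : Fin 1 ⊕ Fin 1 → M |
      SameGerm p f (v (Sum.inl 0)) (v (Sum.inr 0))} := by
  obtain ⟨φ, hφ⟩ := Set.empty_definable_iff.1 f.definable
  have hφ' : ∀ c x y, f.graph c x y ↔ φ.Realize ![c, x, y] := by
    intro c x y
    have := Set.ext_iff.1 hφ ![c, x, y]
    simpa using this
  let Y : Set (Fin 3 → M) := {w | ∀ y, f.graph (w 1) (w 0) y ↔ f.graph (w 2) (w 0) y}
  have hY : (∅ : Set M).Definable L Y := by
    rw [Set.empty_definable_iff]
    let φ₁ : L.Formula (Fin 3 ⊕ Fin 1) :=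
      φ.relabel ![Sum.inl 1, Sum.inl 0, Sum.inr 0]
    let φ₂ : L.Formula (Fin 3 ⊕ Fin 1) :=
      φ.relabel ![Sum.inl 2, Sum.inl 0, Sum.inr 0]
    refine ⟨Formula.iAlls (Fin 1) (φ₁.iff φ₂), ?_⟩
    ext w
    have e1 : ∀ z : Fin 1 → M, (Sum.elim w z) ∘ (![Sum.inl 1, Sum.inl 0, Sum.inr 0] :
        Fin 3 → Fin 3 ⊕ Fin 1) = ![w 1, w 0, z 0] := by
      intro z; funext i; fin_cases i <;> rfl
    have e2 : ∀ z : Fin 1 → M, (Sum.elim w z) ∘ (![Sum.inl 2, Sum.inl 0, Sum.inr 0] :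
        Fin 3 → Fin 3 ⊕ Fin 1) = ![w 2, w 0, z 0] := by
      intro z; funext i; fin_cases i <;> rfl
    have key : (Formula.iAlls (Fin 1) (φ₁.iff φ₂)).Realize w ↔
        ∀ z : Fin 1 → M, (φ.Realize ![w 1, w 0, z 0] ↔ φ.Realize ![w 2, w 0, z 0]) := by
      simp only [Formula.realize_iAlls, Formula.realize_iff, φ₁, φ₂, Formula.realize_relabel,
        e1, e2]
    change w ∈ Y ↔ (Formula.iAlls (Fin 1) (φ₁.iff φ₂)).Realize w
    rw [key]
    constructor
    · intro h z
      rw [← hφ', ← hφ']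
      exact h (z 0)
    · intro h y
      rw [hφ', hφ']
      exact h (fun _ => y)
  exact (hp 2 Y hY).preimage_comp (![Sum.inl 0, Sum.inr 0] : Fin 2 → Fin 1 ⊕ Fin 1)

/-- The imaginary sort of the `p`-germs of the functions `f_c`. -/
def germSort (p : GlobalType L M) (hp : IsDefinableOver ∅ p) (f : DefFamily L M) :
    ImagSort L M where
  n := 1
  E :=
    { r := fun c c' => SameGerm p f (c 0) (c' 0)
      iseqv :=
        { refl := fun _ => (holds_univ p).mono fun _ _ _ => Iff.rfl
          symm := fun h => h.mono fun _ hx y => (hx y).symm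
          trans := fun h h' => (h.inter h').mono fun _ hx y => (hx.1 y).trans (hx.2 y) } }
  definable := sameGerm_definable p hp f

/-- The germ of `f_c` on the `∅`-definable global type `p`, an element of `M^eq`. -/
def germ (p : GlobalType L M) (hp : IsDefinableOver ∅ p) (f : DefFamily L M) (c : M) : Imag L M :=
  ⟨germSort p hp f, Quotient.mk _ (fun _ => c)⟩

/-- The germ of `f_c` on `p` is strong over `∅`: `f_c(a) ∈ dcl([f_c]_p, a)` for all `a`
realizing `p` over `c`. -/
def IsStrong (p : GlobalType L M) (hp : IsDefinableOver ∅ p) (f : DefFamily L M) (c : M) : Prop :=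
  ∀ a y, Realizes p {c} a → f.graph c a y → real L y ∈ dclEq {germ p hp f c, real L a}

/-- The germ of `f_c` on `p` is almost strong over `∅`: `f_c(a) ∈ acl([f_c]_p, a)` for all `a`
realizing `p` over `c`. -/
def IsAlmostStrong (p : GlobalType L M) (hp : IsDefinableOver ∅ p) (f : DefFamily L M) (c : M) :
    Prop :=
  ∀ a y, Realizes p {c} a → f.graph c a y → real L y ∈ aclEq {germ p hp f c, real L a}

end General

/-! ## Dense meet trees with labelled open cones -/

/-- The relation symbols: `point x` (`x` is in the tree), `le x y` (the order of the tree), and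
`lab d x γ` (`x` is above `d`, and `g_d` maps the open cone at `d` containing `x` to `γ`). -/
inductive ConeRel : ℕ → Type
  | point : ConeRel 1
  | le : ConeRel 2
  | lab : ConeRel 3

/-- The language of trees with labelled cones. The two sorts, tree and labels, are given by the
predicate `point` and its complement. -/
def coneLang : FirstOrder.Language.{0, 0} := ⟨fun _ => Empty, ConeRel⟩

def pointR : coneLang.Relations 1 := ConeRel.point

def leR : coneLang.Relations 2 := ConeRel.le

def labR : coneLang.Relations 3 := ConeRel.lab

section Semantic

variable {M : Type u} [coneLang.Structure M]

def IsPoint (x : M) : Prop := Structure.RelMap pointR ![x]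

/-- The label set `Γ`. -/
def IsLabel (x : M) : Prop := ¬ IsPoint x

def Le (x y : M) : Prop := Structure.RelMap leR ![x, y]

def Lt (x y : M) : Prop := Le x y ∧ x ≠ y

/-- `d < x` and `g_d(x) = γ`. -/
def Lab (d x γ : M) : Prop := Structure.RelMap labR ![d, x, γ]

/-- `e = x ∧ y`. -/
def IsMeet (e x y : M) : Prop := Le e x ∧ Le e y ∧ ∀ w, Le w x → Le w y → Le w e

variable (M) in
/-- `M` consists of a dense meet tree (with no least point), an infinite set `Γ` of labels, and for each point `d` of the
tree a bijection `g_d` from the set of open cones at `d` to `Γ`; and the labelling is generic: on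
each interval `(d, x)`, each label is the label of the cone containing `x` at some point. -/
structure IsConeTree : Prop where
  exists_point : ∃ x : M, IsPoint x
  le_point : ∀ x y : M, Le x y → IsPoint x ∧ IsPoint y
  refl : ∀ x : M, IsPoint x → Le x x
  antisymm : ∀ x y : M, Le x y → Le y x → x = y
  trans : ∀ x y z : M, Le x y → Le y z → Le x z
  tree : ∀ x y z : M, Le x z → Le y z → Le x y ∨ Le y x
  meet : ∀ x y : M, IsPoint x → IsPoint y → ∃ e, IsMeet e x y
  dense : ∀ x y : M, Lt x y → ∃ z, Lt x z ∧ Lt z y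
  no_min : ∀ x : M, IsPoint x → ∃ y, Lt y x
  infinite : {γ : M | IsLabel γ}.Infinite
  lab_sort : ∀ d x γ : M, Lab d x γ → Lt d x ∧ IsLabel γ
  lab_total : ∀ d x : M, Lt d x → ∃ γ, Lab d x γ
  lab_unique : ∀ d x γ γ' : M, Lab d x γ → Lab d x γ' → γ = γ'
  lab_cone : ∀ d x y γ : M, Lab d x γ → Lt d y →
    (Lab d y γ ↔ ∃ z, Lt d z ∧ Le z x ∧ Le z y)
  lab_surj : ∀ d γ : M, IsPoint d → IsLabel γ → ∃ x, Lab d x γ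
  generic : ∀ d x γ : M, Lt d x → IsLabel γ → ∃ e, Lt d e ∧ Lt e x ∧ Lab e x γ

end Semantic

section Theory

variable {α : Type} {n : ℕ}

def pointF (s : coneLang.Term (α ⊕ Fin n)) : coneLang.BoundedFormula α n :=
  Relations.boundedFormula₁ pointR s

def leF (s t : coneLang.Term (α ⊕ Fin n)) : coneLang.BoundedFormula α n :=
  Relations.boundedFormula₂ leR s t

def ltF (s t : coneLang.Term (α ⊕ Fin n)) : coneLang.BoundedFormula α n :=
  leF s t ⊓ ∼(s =' t)

def labF (r s t : coneLang.Term (α ⊕ Fin n)) : coneLang.BoundedFormula α n :=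
  Relations.boundedFormula labR ![r, s, t]

/-- There are at least `k` labels. -/
noncomputable def manyLabels (k : ℕ) : coneLang.Sentence :=
  Formula.iExs (Fin k)
    ((Formula.iInf fun i : Fin k => ∼(pointF (Term.var (Sum.inl (Sum.inr i))))) ⊓
      Formula.iInf fun q : {q : Fin k × Fin k // q.1 ≠ q.2} =>
        ∼(Term.equal (Term.var (Sum.inr q.1.1)) (Term.var (Sum.inr q.1.2))))

/-- The theory of the generic dense meet tree with labelled cones, written out. -/
noncomputable def coneTheory : coneLang.Theory :=
  {∃' pointF &0,
   ∀' ∀' (leF &0 &1 ⟹ (pointF &0 ⊓ pointF &1)),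
   ∀' (pointF &0 ⟹ leF &0 &0),
   ∀' ∀' (leF &0 &1 ⟹ leF &1 &0 ⟹ (&0 =' &1)),
   ∀' ∀' ∀' (leF &0 &1 ⟹ leF &1 &2 ⟹ leF &0 &2),
   ∀' ∀' ∀' (leF &0 &2 ⟹ leF &1 &2 ⟹ (leF &0 &1 ⊔ leF &1 &0)),
   ∀' ∀' (pointF &0 ⟹ pointF &1 ⟹
     ∃' (leF &2 &0 ⊓ (leF &2 &1 ⊓ ∀' (leF &3 &0 ⟹ leF &3 &1 ⟹ leF &3 &2)))),
   ∀' ∀' (ltF &0 &1 ⟹ ∃' (ltF &0 &2 ⊓ ltF &2 &1)),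
   ∀' (pointF &0 ⟹ ∃' ltF &1 &0),
   ∀' ∀' ∀' (labF &0 &1 &2 ⟹ (ltF &0 &1 ⊓ ∼(pointF &2))),
   ∀' ∀' (ltF &0 &1 ⟹ ∃' labF &0 &1 &2),
   ∀' ∀' ∀' ∀' (labF &0 &1 &2 ⟹ labF &0 &1 &3 ⟹ (&2 =' &3)),
   ∀' ∀' ∀' ∀' (labF &0 &1 &3 ⟹ ltF &0 &2 ⟹
     (labF &0 &2 &3 ⇔ ∃' (ltF &0 &4 ⊓ (leF &4 &1 ⊓ leF &4 &2)))),
   ∀' ∀' (pointF &0 ⟹ ∼(pointF &1) ⟹ ∃' labF &0 &2 &1),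
   ∀' ∀' ∀' (ltF &0 &1 ⟹ ∼(pointF &2) ⟹
     ∃' (ltF &0 &3 ⊓ (ltF &3 &1 ⊓ labF &3 &1 &2)))} ∪
  Set.range manyLabels

variable {M : Type u} [coneLang.Structure M] {v : α → M} {xs : Fin n → M}

@[simp] theorem realize_pointF {s : coneLang.Term (α ⊕ Fin n)} :
    (pointF s).Realize v xs ↔ IsPoint (s.realize (Sum.elim v xs)) := by
  rw [pointF, BoundedFormula.realize_rel₁]
  rfl

@[simp] theorem realize_leF {s t : coneLang.Term (α ⊕ Fin n)} :
    (leF s t).Realize v xs ↔ Le (s.realize (Sum.elim v xs)) (t.realize (Sum.elim v xs)) := by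
  rw [leF, BoundedFormula.realize_rel₂]
  rfl

@[simp] theorem realize_ltF {s t : coneLang.Term (α ⊕ Fin n)} :
    (ltF s t).Realize v xs ↔ Lt (s.realize (Sum.elim v xs)) (t.realize (Sum.elim v xs)) := by
  simp [ltF, Lt]

@[simp] theorem realize_labF {r s t : coneLang.Term (α ⊕ Fin n)} :
    (labF r s t).Realize v xs ↔ Lab (r.realize (Sum.elim v xs)) (s.realize (Sum.elim v xs))
      (t.realize (Sum.elim v xs)) := by
  rw [labF, BoundedFormula.realize_rel, Lab]
  apply iff_of_eq
  congr 1
  funext i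
  fin_cases i <;> rfl

end Theory

section Theory2

variable {M : Type u} [coneLang.Structure M]

theorem realize_manyLabels {k : ℕ} :
    M ⊨ manyLabels k ↔ ∃ x : Fin k → M, (∀ i, IsLabel (x i)) ∧ Function.Injective x := by
  simp only [manyLabels, Sentence.Realize, Formula.realize_iExs, Formula.realize_inf,
    Formula.realize_iInf, Formula.realize_not, Formula.realize_equal, Term.realize_var,
    Sum.elim_inr]
  refine exists_congr fun x => and_congr (forall_congr' fun i => ?_) ?_
  · simp only [Formula.Realize, realize_pointF, IsLabel, Term.realize_var, Sum.elim_inl,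
      Sum.elim_inr]
  · constructor
    · intro h i j hij
      by_contra hne
      exact h ⟨(i, j), hne⟩ hij
    · intro h q hq
      exact q.2 (h hq)

theorem infinite_labels_iff :
    (∀ k, M ⊨ manyLabels k) ↔ {γ : M | IsLabel γ}.Infinite := by
  simp only [realize_manyLabels]
  constructor
  · intro h hfin
    obtain ⟨x, hx, hinj⟩ := h (hfin.toFinset.card + 1)
    have := Finset.card_le_card_of_injOn (s := Finset.univ) (t := hfin.toFinset) x
      (by intro i _; simpa using hx i) hinj.injOn
    simp at this
  · intro h k
    let e := h.natEmbedding
    exact ⟨fun i => e i, fun i => (e i).2, fun i j hij => Fin.ext (e.injective (Subtype.ext hij))⟩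

/-- The models of `coneTheory` are the structures described by `IsConeTree`. -/
theorem model_coneTheory_iff : M ⊨ coneTheory ↔ IsConeTree M := by
  rw [coneTheory, Theory.model_union_iff, Theory.model_iff (Set.range manyLabels)]
  simp only [Set.forall_mem_range, infinite_labels_iff]
  simp only [Theory.model_iff, Set.mem_insert_iff, Set.mem_singleton_iff, forall_eq_or_imp,
    forall_eq, Sentence.Realize, Formula.Realize, BoundedFormula.realize_all,
    BoundedFormula.realize_ex, BoundedFormula.realize_imp, BoundedFormula.realize_inf,
    BoundedFormula.realize_sup, BoundedFormula.realize_not, BoundedFormula.realize_iff,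
    BoundedFormula.realize_bdEqual, realize_pointF, realize_leF, realize_ltF, realize_labF,
    Term.realize_var, Sum.elim_inr, Function.comp_apply]
  constructor
  · rintro ⟨⟨h1, h2, h3, h4, h5, h6, h7, h8, h9, h10, h11, h12, h13, h14, h15⟩, h16⟩
    exact ⟨h1, h2, h3, h4, h5, h6, h7, h8, h9, h16, h10, h11, h12, h13, h14, h15⟩
  · rintro ⟨h1, h2, h3, h4, h5, h6, h7, h8, h9, h16, h10, h11, h12, h13, h14, h15⟩
    exact ⟨⟨h1, h2, h3, h4, h5, h6, h7, h8, h9, h10, h11, h12, h13, h14, h15⟩, h16⟩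

/-- The family `f_c(x) = g_{x ∧ c}(x)`, defined for the points `x` with `x ≰ c`. -/
def coneMap (h : IsConeTree M) : DefFamily coneLang M where
  graph c x y := ¬ Le x c ∧ ∃ e, IsMeet e x c ∧ Lab e x y
  functional := by
    rintro c x y y' ⟨-, e, he, hy⟩ ⟨-, e', he', hy'⟩
    have : e = e' := h.antisymm _ _ (he'.2.2 _ he.1 he.2.1) (he.2.2 _ he'.1 he'.2.1)
    subst this
    exact h.lab_unique _ _ _ _ hy hy'
  definable := by
    rw [Set.empty_definable_iff]
    let V : ∀ n, Fin 3 → coneLang.Term (Fin 3 ⊕ Fin n) := fun n i => Term.var (Sum.inl i)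
    refine ⟨∼(leF (V 0 1) (V 0 0)) ⊓ ∃' (leF &0 (V 1 1) ⊓ (leF &0 (V 1 0) ⊓
      (∀' (leF &1 (V 2 1) ⟹ leF &1 (V 2 0) ⟹ leF &1 &0))) ⊓ labF &0 (V 1 1) (V 1 2)), ?_⟩
    ext v
    simp [V, Formula.Realize, IsMeet, Fin.snoc]

end Theory2

/-- `p` is the type of a generic point `x` of the tree: `x` is not below any point of `M`, and its
meets with the points of `M` are below all points of `M`. -/
def IsGenericType {M : Type u} [coneLang.Structure M] (p : GlobalType coneLang M) : Prop :=
  Holds p {x | IsPoint x} ∧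
    ∀ c d : M, IsPoint c → IsPoint d → Holds p {x | ¬ Le x c ∧ ∃ e, IsMeet e x c ∧ Lt e d}

end GermStrength

open GermStrength

-- Everything rests on finite partial isomorphisms `S` that follow a bijection `σ` of the label
-- sets, prescribed in advance, on the labels they contain (`Good σ S`). For a fixed `σ` they form a
-- back-and-forth system (`Good.extend`, `Good.extend_symm`): the path to a new point leaves the
-- tree spanned by the domain at one point, so four simple extensions reach it (`exists_steps`), and
-- genericity of the labelling realizes each of them on the other side. Hence formulas are preserved
-- (`Good.realize_iff`). As `σ` is arbitrary, Γ is a pure set: completeness follows, and Γ is stable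
-- and stably embedded over any single point.
--
-- The failure of strength is then quick. For generic `x` the meets of `x` with `c` and with `c'`
-- coincide, so all `f_c` have one germ, and every point represents it, in particular `a` itself. So
-- algebraicity over the germ and `a` is algebraicity over `a` alone. Any permutation of Γ together
-- with `a ↦ a` preserves formulas, so no label is algebraic over a point (`real_notMem_aclEq`),
-- while `f_c(a)` is a label. The generic type is complete because two generic points over a closed
-- set are conjugate up to a permutation of labels (`exists_good_of_mem_genericSet`); it is unique
-- because an ∅-definable type cannot single out a label (`holds_not_of_functional`).
--
-- The bulk of the proof is the bounded stabilizing property, in three steps.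
--
-- Elements of `St_∅` depend on labels only (`mk_eq_of_mem_St`). Copies of one configuration with
-- the same labels can be arranged in an infinite comb, ordered by the transitive relation `Branch`.
-- Stable embeddedness turns this order into a relation on the stable set, and stability forces two
-- copies that branch from each other to represent the same element. All branching pairs are
-- conjugate, and any two copies branch from a common third one, so all copies represent the same
-- element.
--
-- Consequently the information that a parameter set `A` carries about `St_∅` is a family of
-- definable sets of label tuples. These have codes in `St_∅` (`exists_code`), and over a subset of
-- `St_∅` the set `A` can be replaced by `St_∅ ∩ dcl(A)` (`mem_dclEq_of_mem_St`).
--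
-- Finally, from an uncountable chain one extracts elements `e_k ∈ dcl(A a)`, none of them in
-- `dcl(A, e_i : i < k)`, given by families `W_k` over `A` which are evaluated at representatives of
-- `a` and supported on boundedly many elements. Then `a` is a leaf of arbitrarily high binary trees
-- whose level `k` branching is witnessed by `W_k` (`exists_mem_dclEq`). But `n` levels involve a
-- closed set of size linear in `n`, over which a leaf has only polynomially many codes, and the
-- code and the equality pattern of a pair of leaves determine the level at which they separate. So
-- `2 ^ n` is bounded by a polynomial (`exists_notMem_treeSet`), a contradiction.

universe v

namespace GermStrength

/-! ### Order, meets and labels in cone trees -/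

section Basics

variable {M : Type u} [coneLang.Structure M]

theorem exists_greatest_of_directed {α : Type u} {r : α → α → Prop}
    (htrans : ∀ x y z, r x y → r y z → r x z) {T : Set α} (hT : T.Finite) (hne : T.Nonempty)
    (hdir : ∀ x ∈ T, ∀ y ∈ T, ∃ z ∈ T, r x z ∧ r y z) : ∃ m ∈ T, ∀ x ∈ T, r x m := by
  have key : ∀ U : Set α, U.Finite → U ⊆ T → ∃ m ∈ T, ∀ x ∈ U, r x m := by
    intro U hU
    induction U, hU using Set.Finite.induction_on with
    | empty =>
      intro _
      obtain ⟨m, hm⟩ := hne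
      exact ⟨m, hm, fun x hx => hx.elim⟩
    | insert _ _ ih =>
      intro hs
      obtain ⟨m, hm, hmax⟩ := ih (fun x hx => hs (Set.mem_insert_of_mem _ hx))
      obtain ⟨z, hz, h1, h2⟩ := hdir _ (hs (Set.mem_insert _ _)) m hm
      refine ⟨z, hz, ?_⟩
      rintro x (rfl | hx)
      · exact h1
      · exact htrans _ _ _ (hmax x hx) h2
  exact key T hT subset_rfl

theorem Lt.irrefl {x : M} (h : Lt x x) : False := h.2 rfl

theorem IsMeet.symm {e x y : M} (h : IsMeet e x y) : IsMeet e y x :=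
  ⟨h.2.1, h.1, fun w h1 h2 => h.2.2 w h2 h1⟩

namespace IsConeTree

variable (h : IsConeTree M)
include h

theorem lt_of_lt_of_le {x y z : M} (h1 : Lt x y) (h2 : Le y z) : Lt x z :=
  ⟨h.trans _ _ _ h1.1 h2, fun e => h1.2 (h.antisymm _ _ h1.1 (e ▸ h2))⟩

theorem lt_of_le_of_lt {x y z : M} (h1 : Le x y) (h2 : Lt y z) : Lt x z :=
  ⟨h.trans _ _ _ h1 h2.1, fun e => h2.2 (h.antisymm _ _ h2.1 (e ▸ h1))⟩

theorem not_le_of_lt {x y : M} (h1 : Lt x y) : ¬ Le y x := fun h2 =>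
  h1.2 (h.antisymm _ _ h1.1 h2)

theorem lt_or_le {x y z : M} (hx : Le x z) (hy : Le y z) : Lt x y ∨ Le y x := by
  rcases h.tree x y z hx hy with h1 | h1
  · by_cases e : x = y
    · subst e
      exact Or.inr h1
    · exact Or.inl ⟨h1, e⟩
  · exact Or.inr h1

theorem isPoint_left {x y : M} (h1 : Le x y) : IsPoint x := (h.le_point _ _ h1).1

theorem isPoint_right {x y : M} (h1 : Le x y) : IsPoint y := (h.le_point _ _ h1).2

theorem isMeet_unique {e e' x y : M} (h1 : IsMeet e x y) (h2 : IsMeet e' x y) : e = e' :=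
  h.antisymm _ _ (h2.2.2 _ h1.1 h1.2.1) (h1.2.2 _ h2.1 h2.2.1)

theorem isMeet_of_le {x y : M} (h1 : Le x y) : IsMeet x x y :=
  ⟨h.refl _ (h.isPoint_left h1), h1, fun _ h2 _ => h2⟩

theorem lab_lt {d x g : M} (h1 : Lab d x g) : Lt d x := (h.lab_sort _ _ _ h1).1

theorem lab_isLabel {d x g : M} (h1 : Lab d x g) : IsLabel g := (h.lab_sort _ _ _ h1).2

theorem lab_mono {d x y g : M} (h1 : Lab d x g) (h2 : Le x y) : Lab d y g :=
  (h.lab_cone d x y g h1 (h.lt_of_lt_of_le (h.lab_lt h1) h2)).2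
    ⟨x, h.lab_lt h1, h.refl _ (h.isPoint_left h2), h2⟩

theorem lab_anti {d x y g : M} (h1 : Lab d y g) (h2 : Lt d x) (h3 : Le x y) : Lab d x g :=
  (h.lab_cone d y x g h1 h2).2 ⟨x, h2, h3, h.refl _ (h.isPoint_left h3)⟩

theorem lt_meet_of_lab {d x y g e : M} (h1 : Lab d x g) (h2 : Lab d y g) (he : IsMeet e x y) :
    Lt d e := by
  obtain ⟨z, hz, h3, h4⟩ := (h.lab_cone d x y g h1 (h.lab_lt h2)).1 h2
  exact h.lt_of_lt_of_le hz (he.2.2 z h3 h4)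

/-- A common lower bound strictly above `d` would place `x` and `y` in one open cone at `d`, which
has only one label. -/
theorem meet_eq_of_lab_ne {d x y g g' : M} (h1 : Lab d x g) (h2 : Lab d y g') (hne : g ≠ g') :
    IsMeet d x y := by
  refine ⟨(h.lab_lt h1).1, (h.lab_lt h2).1, fun w hx hy => ?_⟩
  rcases h.lt_or_le (h.lab_lt h1).1 hx with h3 | h3
  · have h4 := h.lab_anti h1 h3 hx
    exact absurd (h.lab_unique _ _ _ _ (h.lab_mono h4 hy) h2) hne
  · exact h3

theorem exists_isLabel_notMem {F : Set M} (hF : F.Finite) : ∃ g : M, IsLabel g ∧ g ∉ F :=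
  h.infinite.exists_notMem_finite hF

end IsConeTree

/-- The kinds of the one-element extensions of a finite set closed under meets and labels. -/
inductive MoveKind
  | old | label | down | up

instance : Finite MoveKind :=
  Finite.of_surjective (![.old, .label, .down, .up] : Fin 4 → MoveKind) fun k => by
    cases k
    exacts [⟨0, rfl⟩, ⟨1, rfl⟩, ⟨2, rfl⟩, ⟨3, rfl⟩]

/-- `y` is a one-element extension of `P`, of kind `k`, with data `c` and `g` from `P`: an old
element `c`; a new label; a point below `c` and above all the elements of `P` below `c`, where
`c` has label `g`; a point above `c` in the cone with label `g`, which contains no point of `P`. -/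
def Move (P : Set M) (k : MoveKind) (y c g : M) : Prop :=
  c ∈ P ∧ g ∈ P ∧ match k with
    | .old => y = c
    | .label => IsLabel y ∧ y ∉ P
    | .down => Lab y c g ∧ ∀ d ∈ P, Lt d c → Lt d y
    | .up => Lab c y g ∧ ∀ d ∈ P, ¬ Lab c d g

end Basics

/-! ### Finite partial isomorphisms over a bijection of labels -/

/-- `S` is a finite partial isomorphism which follows `σ` on the labels; its domain contains a point
and is closed under meets and labels. -/
structure Good {M : Type u} {N : Type v} [coneLang.Structure M] [coneLang.Structure N]
    (σ : {x : M // IsLabel x} ≃ {x : N // IsLabel x}) (S : Set (M × N)) : Prop where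
  finite : S.Finite
  nonempty : ∃ q ∈ S, IsPoint q.1
  point : ∀ q ∈ S, IsPoint q.1 ↔ IsPoint q.2
  label : ∀ q ∈ S, ∀ hx : IsLabel q.1, q.2 = σ ⟨q.1, hx⟩
  le : ∀ q ∈ S, ∀ r ∈ S, Le q.1 r.1 ↔ Le q.2 r.2
  meet : ∀ q ∈ S, ∀ r ∈ S, IsPoint q.1 → IsPoint r.1 →
    ∃ e ∈ S, IsMeet e.1 q.1 r.1 ∧ IsMeet e.2 q.2 r.2
  lab : ∀ q ∈ S, ∀ r ∈ S, Lt q.1 r.1 → ∃ g ∈ S, Lab q.1 r.1 g.1 ∧ Lab q.2 r.2 g.2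

namespace Good

variable {M : Type u} {N : Type v} [coneLang.Structure M] [coneLang.Structure N]
  {σ : {x : M // IsLabel x} ≃ {x : N // IsLabel x}} {S : Set (M × N)}

/-- Equality is not among the conditions on `S`: for points it follows from antisymmetry, for labels
from injectivity of `σ`. -/
theorem eq_iff (hM : IsConeTree M) (hN : IsConeTree N) (hS : Good σ S) {q r : M × N}
    (hq : q ∈ S) (hr : r ∈ S) : q.1 = r.1 ↔ q.2 = r.2 := by
  by_cases h1 : IsPoint q.1
  · constructor
    · intro e
      have h2 := hM.refl _ h1
      exact hN.antisymm _ _ ((hS.le q hq r hr).1 (by rw [← e]; exact h2))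
        ((hS.le r hr q hq).1 (by rw [← e]; exact h2))
    · intro e
      have h2 := hN.refl _ ((hS.point q hq).1 h1)
      exact hM.antisymm _ _ ((hS.le q hq r hr).2 (by rw [← e]; exact h2))
        ((hS.le r hr q hq).2 (by rw [← e]; exact h2))
  · have h2 := hS.label q hq h1
    constructor
    · intro e
      have h3 : IsLabel r.1 := by rw [← e]; exact h1
      rw [h2, hS.label r hr h3]
      simp only [e]
    · intro e
      have h3 : IsLabel r.1 := fun h3 => h1 ((hS.point q hq).2 (by
        rw [e]; exact (hS.point r hr).1 h3))
      rw [h2, hS.label r hr h3] at e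
      exact congrArg Subtype.val (σ.injective (Subtype.ext e))

theorem lt_iff (hM : IsConeTree M) (hN : IsConeTree N) (hS : Good σ S) {q r : M × N}
    (hq : q ∈ S) (hr : r ∈ S) : Lt q.1 r.1 ↔ Lt q.2 r.2 := by
  rw [Lt, Lt, hS.le q hq r hr, Ne, Ne, hS.eq_iff hM hN hq hr]

/-- The field `lab` only provides one matching label in `S`; as the label of a cone is unique, this
already preserves the whole relation. -/
theorem lab_iff (hM : IsConeTree M) (hN : IsConeTree N) (hS : Good σ S) {q r t : M × N}
    (hq : q ∈ S) (hr : r ∈ S) (ht : t ∈ S) : Lab q.1 r.1 t.1 ↔ Lab q.2 r.2 t.2 := by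
  constructor
  · intro h1
    obtain ⟨g, hg, h2, h3⟩ := hS.lab q hq r hr (hM.lab_lt h1)
    rwa [(hS.eq_iff hM hN ht hg).1 (hM.lab_unique _ _ _ _ h1 h2)]
  · intro h1
    obtain ⟨g, hg, h2, h3⟩ := hS.lab q hq r hr ((hS.lt_iff hM hN hq hr).2 (hN.lab_lt h1))
    rwa [(hS.eq_iff hM hN ht hg).2 (hN.lab_unique _ _ _ _ h1 h3)]

theorem isMeet_map (hM : IsConeTree M) (hN : IsConeTree N) (hS : Good σ S) {q r t : M × N}
    (hq : q ∈ S) (hr : r ∈ S) (ht : t ∈ S) (h1 : IsMeet t.1 q.1 r.1) : IsMeet t.2 q.2 r.2 := by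
  obtain ⟨e, he, h2, h3⟩ := hS.meet q hq r hr (hM.isPoint_right h1.1) (hM.isPoint_right h1.2.1)
  rwa [(hS.eq_iff hM hN ht he).1 (hM.isMeet_unique h1 h2)]

theorem symm (hM : IsConeTree M) (hN : IsConeTree N) (hS : Good σ S) :
    Good σ.symm (Prod.swap '' S) where
  finite := hS.finite.image _
  nonempty := by
    obtain ⟨q, hq, hp⟩ := hS.nonempty
    exact ⟨q.swap, ⟨q, hq, rfl⟩, (hS.point q hq).1 hp⟩
  point := by
    rintro _ ⟨q, hq, rfl⟩
    exact (hS.point q hq).symm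
  label := by
    rintro _ ⟨q, hq, rfl⟩ hx
    have h1 : IsLabel q.1 := fun h1 => hx ((hS.point q hq).1 h1)
    have h2 : (⟨q.2, hx⟩ : {x : N // IsLabel x}) = σ ⟨q.1, h1⟩ :=
      Subtype.ext (hS.label q hq h1)
    simp only [Prod.fst_swap, Prod.snd_swap, h2, Equiv.symm_apply_apply]
  le := by
    rintro _ ⟨q, hq, rfl⟩ _ ⟨r, hr, rfl⟩
    exact (hS.le q hq r hr).symm
  meet := by
    rintro _ ⟨q, hq, rfl⟩ _ ⟨r, hr, rfl⟩ h1 h2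
    obtain ⟨e, he, h3, h4⟩ := hS.meet q hq r hr ((hS.point q hq).2 h1) ((hS.point r hr).2 h2)
    exact ⟨e.swap, ⟨e, he, rfl⟩, h4, h3⟩
  lab := by
    rintro _ ⟨q, hq, rfl⟩ _ ⟨r, hr, rfl⟩ h1
    obtain ⟨e, he, h3, h4⟩ := hS.lab q hq r hr ((hS.lt_iff hM hN hq hr).2 h1)
    exact ⟨e.swap, ⟨e, he, rfl⟩, h4, h3⟩

theorem single (hM : IsConeTree M) (hN : IsConeTree N)
    (σ : {x : M // IsLabel x} ≃ {x : N // IsLabel x}) {x : M} {y : N} (hx : IsPoint x)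
    (hy : IsPoint y) : Good σ {(x, y)} where
  finite := Set.finite_singleton _
  nonempty := ⟨_, rfl, hx⟩
  point := by
    rintro _ rfl
    exact iff_of_true hx hy
  label := by
    rintro _ rfl h1
    exact absurd hx h1
  le := by
    rintro _ rfl _ rfl
    exact iff_of_true (hM.refl _ hx) (hN.refl _ hy)
  meet := by
    rintro _ rfl _ rfl _ _
    exact ⟨_, rfl, hM.isMeet_of_le (hM.refl _ hx), hN.isMeet_of_le (hN.refl _ hy)⟩
  lab := by
    rintro _ rfl _ rfl h1
    exact h1.irrefl.elim

/-- A label is incomparable to everything, so its image under `σ` meets no obstruction. This is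
where the choice of `σ` in advance pays off. -/
theorem insert_label (hM : IsConeTree M) (hN : IsConeTree N) (hS : Good σ S) {y : M}
    (hy : IsLabel y) : Good σ (insert (y, (σ ⟨y, hy⟩ : N)) S) := by
  have hy' : IsLabel (σ ⟨y, hy⟩ : N) := (σ ⟨y, hy⟩).2
  have n1 : ∀ x, ¬ Le y x := fun x h1 => hy (hM.isPoint_left h1)
  have n2 : ∀ x, ¬ Le x y := fun x h1 => hy (hM.isPoint_right h1)
  have n3 : ∀ x, ¬ Le (σ ⟨y, hy⟩ : N) x := fun x h1 => hy' (hN.isPoint_left h1)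
  have n4 : ∀ x, ¬ Le x (σ ⟨y, hy⟩ : N) := fun x h1 => hy' (hN.isPoint_right h1)
  refine ⟨hS.finite.insert _, ?_, ?_, ?_, ?_, ?_, ?_⟩
  · obtain ⟨q, hq, hp⟩ := hS.nonempty
    exact ⟨q, Or.inr hq, hp⟩
  · rintro q (rfl | hq)
    · exact iff_of_false hy hy'
    · exact hS.point q hq
  · rintro q (rfl | hq) hx
    · rfl
    · exact hS.label q hq hx
  · rintro q (rfl | hq) r (rfl | hr)
    · exact iff_of_false (n1 _) (n3 _)
    · exact iff_of_false (n1 _) (n3 _)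
    · exact iff_of_false (n2 _) (n4 _)
    · exact hS.le q hq r hr
  · rintro q (rfl | hq) r (rfl | hr) h1 h2
    · exact absurd h1 hy
    · exact absurd h1 hy
    · exact absurd h2 hy
    · obtain ⟨e, he, h3⟩ := hS.meet q hq r hr h1 h2
      exact ⟨e, Or.inr he, h3⟩
  · rintro q (rfl | hq) r (rfl | hr) h1
    · exact (n1 _ h1.1).elim
    · exact (n1 _ h1.1).elim
    · exact (n2 _ h1.1).elim
    · obtain ⟨e, he, h3⟩ := hS.lab q hq r hr h1
      exact ⟨e, Or.inr he, h3⟩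

theorem insert_point (hM : IsConeTree M) (hN : IsConeTree N) (hS : Good σ S) {y : M} {y' : N}
    (hy : IsPoint y) (hy' : IsPoint y')
    (h1 : ∀ q ∈ S, Le y q.1 ↔ Le y' q.2) (h2 : ∀ q ∈ S, Le q.1 y ↔ Le q.2 y')
    (h3 : ∀ q ∈ S, IsPoint q.1 →
      ∃ e ∈ insert (y, y') S, IsMeet e.1 y q.1 ∧ IsMeet e.2 y' q.2)
    (h4 : ∀ q ∈ S, Lt y q.1 → ∃ g ∈ S, Lab y q.1 g.1 ∧ Lab y' q.2 g.2)
    (h5 : ∀ q ∈ S, Lt q.1 y → ∃ g ∈ S, Lab q.1 y g.1 ∧ Lab q.2 y' g.2) :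
    Good σ (insert (y, y') S) := by
  refine ⟨hS.finite.insert _, ?_, ?_, ?_, ?_, ?_, ?_⟩
  · exact ⟨_, Or.inl rfl, hy⟩
  · rintro q (rfl | hq)
    · exact iff_of_true hy hy'
    · exact hS.point q hq
  · rintro q (rfl | hq) hx
    · exact absurd hy hx
    · exact hS.label q hq hx
  · rintro q (rfl | hq) r (rfl | hr)
    · exact iff_of_true (hM.refl _ hy) (hN.refl _ hy')
    · exact h1 r hr
    · exact h2 q hq
    · exact hS.le q hq r hr
  · rintro q (rfl | hq) r (rfl | hr) i1 i2
    · exact ⟨_, Or.inl rfl, hM.isMeet_of_le (hM.refl _ hy), hN.isMeet_of_le (hN.refl _ hy')⟩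
    · exact h3 r hr i2
    · obtain ⟨e, he, h3, h4⟩ := h3 q hq i1
      exact ⟨e, he, h3.symm, h4.symm⟩
    · obtain ⟨e, he, h3⟩ := hS.meet q hq r hr i1 i2
      exact ⟨e, Or.inr he, h3⟩
  · rintro q (rfl | hq) r (rfl | hr) i1
    · exact i1.irrefl.elim
    · obtain ⟨g, hg, h⟩ := h4 r hr i1
      exact ⟨g, Or.inr hg, h⟩
    · obtain ⟨g, hg, h⟩ := h5 q hq i1
      exact ⟨g, Or.inr hg, h⟩
    · obtain ⟨e, he, h3⟩ := hS.lab q hq r hr i1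
      exact ⟨e, Or.inr he, h3⟩

end Good

/-! ### Position of a one-element extension relative to the old set -/

namespace Move

variable {M : Type u} [coneLang.Structure M] {P : Set M} {y c g d : M}

/-- If `d` is above `y` but not above `c`, then `c ∧ d` is an element of `P` strictly below `c`,
hence strictly below `y`; but `y` is a common lower bound of `c` and `d`. -/
theorem down_le_iff (h : IsConeTree M) (hm : Move P .down y c g)
    (hP : IsPoint d → ∃ e ∈ P, IsMeet e c d) : Le y d ↔ Le c d := by
  obtain ⟨-, -, h1, h2⟩ := hm
  constructor
  · intro h3
    obtain ⟨e, he, h4⟩ := hP (h.isPoint_right h3)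
    by_cases h5 : e = c
    · subst h5
      exact h4.2.1
    · exact absurd (h4.2.2 y (h.lab_lt h1).1 h3) (h.not_le_of_lt (h2 e he ⟨h4.1, h5⟩))
  · exact h.trans _ _ _ (h.lab_lt h1).1

theorem down_ge_iff (h : IsConeTree M) (hm : Move P .down y c g) (hd : d ∈ P) :
    Le d y ↔ Lt d c := by
  obtain ⟨-, -, h1, h2⟩ := hm
  exact ⟨fun h3 => h.lt_of_le_of_lt h3 (h.lab_lt h1), fun h3 => (h2 d hd h3).1⟩

theorem down_meet (h : IsConeTree M) (hm : Move P .down y c g) {e : M} (he : e ∈ P)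
    (h3 : IsMeet e c d) (h4 : ¬ Le c d) : IsMeet e y d := by
  obtain ⟨-, -, h1, h2⟩ := hm
  refine ⟨(h2 e he ⟨h3.1, fun h5 => h4 (h5 ▸ h3.2.1)⟩).1, h3.2.1, fun w hw hw' => ?_⟩
  exact h3.2.2 w (h.trans _ _ _ hw (h.lab_lt h1).1) hw'

theorem up_not_le (h : IsConeTree M) (hm : Move P .up y c g) (hd : d ∈ P) : ¬ Le y d :=
  fun h3 => hm.2.2.2 d hd (h.lab_mono hm.2.2.1 h3)

theorem up_ge_iff (h : IsConeTree M) (hm : Move P .up y c g) (hd : d ∈ P) :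
    Le d y ↔ Le d c := by
  obtain ⟨-, -, h1, h2⟩ := hm
  constructor
  · intro h3
    rcases h.lt_or_le (h.lab_lt h1).1 h3 with h4 | h4
    · exact absurd (h.lab_anti h1 h4 h3) (h2 d hd)
    · exact h4
  · exact fun h3 => h.trans _ _ _ h3 (h.lab_lt h1).1

/-- A common lower bound of `y` and `d` strictly above `c` would place `d` in the cone of `y` at
`c`, which is free of elements of `P`. -/
theorem up_meet (h : IsConeTree M) (hm : Move P .up y c g) (hd : d ∈ P) {e : M}
    (h3 : IsMeet e c d) : IsMeet e y d := by
  obtain ⟨-, -, h1, h2⟩ := hm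
  refine ⟨h.trans _ _ _ h3.1 (h.lab_lt h1).1, h3.2.1, fun w hw hw' => ?_⟩
  rcases h.lt_or_le (h.lab_lt h1).1 hw with h4 | h4
  · exact absurd (h.lab_mono (h.lab_anti h1 h4 hw) hw') (h2 d hd)
  · exact h3.2.2 w h4 hw'

end Move

/-! ### Extending a partial isomorphism by one element -/

namespace Good

variable {M : Type u} {N : Type v} [coneLang.Structure M] [coneLang.Structure N]
  {σ : {x : M // IsLabel x} ≃ {x : N // IsLabel x}} {S : Set (M × N)}

/-- The kind of a move and its data `c`, `g` determine all relations of the new element to the old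
ones; only for a new label does `σ` have to be consulted. -/
theorem insert_move (hM : IsConeTree M) (hN : IsConeTree N) (hS : Good σ S) {k : MoveKind}
    {y c g : M} {y' c' g' : N} (hc : (c, c') ∈ S) (hg : (g, g') ∈ S)
    (hm : Move (Prod.fst '' S) k y c g) (hm' : Move (Prod.snd '' S) k y' c' g')
    (hl : k = .label → ∀ hy : IsLabel y, y' = σ ⟨y, hy⟩) : Good σ (insert (y, y') S) := by
  have i1 : ∀ q ∈ S, q.1 ∈ Prod.fst '' S := fun q hq => ⟨q, hq, rfl⟩
  have i2 : ∀ q ∈ S, q.2 ∈ Prod.snd '' S := fun q hq => ⟨q, hq, rfl⟩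
  cases k with
  | old =>
    obtain ⟨-, -, h1⟩ := hm
    obtain ⟨-, -, h2⟩ := hm'
    simp only at h1 h2
    rw [h1, h2, Set.insert_eq_of_mem hc]
    exact hS
  | label =>
    obtain ⟨-, -, h1, -⟩ := hm
    rw [hl rfl h1]
    exact hS.insert_label hM hN h1
  | down =>
    have l1 := hM.lab_lt hm.2.2.1
    have l2 := hN.lab_lt hm'.2.2.1
    have pc := hM.isPoint_right l1.1
    have m1 : ∀ q ∈ S, Le y q.1 ↔ Le c q.1 := fun q hq => hm.down_le_iff hM fun hp => by
      obtain ⟨e, he, h1, -⟩ := hS.meet _ hc q hq pc hp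
      exact ⟨_, i1 e he, h1⟩
    have m2 : ∀ q ∈ S, Le y' q.2 ↔ Le c' q.2 := fun q hq => hm'.down_le_iff hN fun hp => by
      obtain ⟨e, he, -, h1⟩ := hS.meet _ hc q hq pc ((hS.point q hq).2 hp)
      exact ⟨_, i2 e he, h1⟩
    refine hS.insert_point hM hN (hM.isPoint_left l1.1) (hN.isPoint_left l2.1) ?_ ?_ ?_ ?_ ?_
    · intro q hq
      rw [m1 q hq, m2 q hq]
      exact hS.le _ hc q hq
    · intro q hq
      rw [hm.down_ge_iff hM (i1 q hq), hm'.down_ge_iff hN (i2 q hq)]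
      exact hS.lt_iff hM hN hq hc
    · intro q hq hp
      by_cases h1 : Le c q.1
      · exact ⟨_, Or.inl rfl, hM.isMeet_of_le ((m1 q hq).2 h1),
          hN.isMeet_of_le ((m2 q hq).2 ((hS.le _ hc q hq).1 h1))⟩
      · obtain ⟨e, he, h2, h3⟩ := hS.meet _ hc q hq pc hp
        exact ⟨e, Or.inr he, hm.down_meet hM (i1 e he) h2 h1,
          hm'.down_meet hN (i2 e he) h3 fun h4 => h1 ((hS.le _ hc q hq).2 h4)⟩
    · intro q hq h1
      have h2 := (m1 q hq).1 h1.1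
      exact ⟨_, hg, hM.lab_mono hm.2.2.1 h2, hN.lab_mono hm'.2.2.1 ((hS.le _ hc q hq).1 h2)⟩
    · intro q hq h1
      have h2 := (hm.down_ge_iff hM (i1 q hq)).1 h1.1
      have h2' := (hS.lt_iff hM hN hq hc).1 h2
      obtain ⟨e, he, h3, h4⟩ := hS.lab q hq _ hc h2
      exact ⟨e, he, hM.lab_anti h3 h1 l1.1,
        hN.lab_anti h4 (hm'.2.2.2 _ (i2 q hq) h2') l2.1⟩
  | up =>
    have l1 := hM.lab_lt hm.2.2.1
    have l2 := hN.lab_lt hm'.2.2.1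
    have pc := hM.isPoint_left l1.1
    refine hS.insert_point hM hN (hM.isPoint_right l1.1) (hN.isPoint_right l2.1) ?_ ?_ ?_ ?_ ?_
    · intro q hq
      exact iff_of_false (hm.up_not_le hM (i1 q hq)) (hm'.up_not_le hN (i2 q hq))
    · intro q hq
      rw [hm.up_ge_iff hM (i1 q hq), hm'.up_ge_iff hN (i2 q hq)]
      exact hS.le q hq _ hc
    · intro q hq hp
      obtain ⟨e, he, h2, h3⟩ := hS.meet _ hc q hq pc hp
      exact ⟨e, Or.inr he, hm.up_meet hM (i1 q hq) h2, hm'.up_meet hN (i2 q hq) h3⟩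
    · intro q hq h1
      exact absurd h1.1 (hm.up_not_le hM (i1 q hq))
    · intro q hq h1
      have h2 := (hm.up_ge_iff hM (i1 q hq)).1 h1.1
      by_cases h3 : q.1 = c
      · have h4 : q.2 = c' := (hS.eq_iff hM hN hq hc).1 h3
        rw [h3, h4]
        exact ⟨_, hg, hm.2.2.1, hm'.2.2.1⟩
      · obtain ⟨e, he, h5, h6⟩ := hS.lab q hq _ hc ⟨h2, h3⟩
        exact ⟨e, he, hM.lab_mono h5 l1.1, hN.lab_mono h6 l2.1⟩

theorem exists_move (hM : IsConeTree M) (hN : IsConeTree N) (hS : Good σ S) {k : MoveKind}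
    {y c g : M} (hm : Move (Prod.fst '' S) k y c g) : ∃ y', Good σ (insert (y, y') S) := by
  obtain ⟨⟨⟨_, c'⟩, hc, rfl⟩, ⟨⟨_, g'⟩, hg, rfl⟩, -⟩ := id hm
  have hc' : c' ∈ Prod.snd '' S := ⟨_, hc, rfl⟩
  have hg' : g' ∈ Prod.snd '' S := ⟨_, hg, rfl⟩
  cases k with
  | old => exact ⟨c', hS.insert_move hM hN hc hg hm ⟨hc', hg', rfl⟩ (by simp)⟩
  | label => exact ⟨_, hS.insert_label hM hN hm.2.2.1⟩
  | down =>
    have l1 := hM.lab_lt hm.2.2.1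
    have pc : IsPoint c' := (hS.point _ hc).1 (hM.isPoint_right l1.1)
    have pg : IsLabel g' := fun h1 => hM.lab_isLabel hm.2.2.1 ((hS.point _ hg).2 h1)
    -- The elements of the range below `c'` form a chain; `m` is the greatest of them, or any point
    -- below `c'` if there are none. Genericity on the interval from `m` to `c'` then produces a
    -- point where the label of `c'` is `g'`.
    obtain ⟨m, hm1, hm2⟩ : ∃ m, Lt m c' ∧ ∀ d ∈ Prod.snd '' S, Lt d c' → Le d m := by
      by_cases hne : {d | d ∈ Prod.snd '' S ∧ Lt d c'}.Nonempty
      · obtain ⟨m, hm1, hm2⟩ := exists_greatest_of_directed (r := Le) hN.trans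
          ((hS.finite.image Prod.snd).subset (Set.sep_subset _ (fun d => Lt d c'))) hne (by
            intro x hx y hy
            rcases hN.tree x y c' hx.2.1 hy.2.1 with h1 | h1
            · exact ⟨y, hy, h1, hN.refl _ (hN.isPoint_left hy.2.1)⟩
            · exact ⟨x, hx, hN.refl _ (hN.isPoint_left hx.2.1), h1⟩)
        exact ⟨m, hm1.2, fun d hd hd' => hm2 d ⟨hd, hd'⟩⟩
      · obtain ⟨m, hm⟩ := hN.no_min c' pc
        exact ⟨m, hm, fun d hd hd' => (hne ⟨d, hd, hd'⟩).elim⟩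
    obtain ⟨w, h1, h2, h3⟩ := hN.generic m c' g' hm1 pg
    exact ⟨w, hS.insert_move hM hN hc hg hm
      ⟨hc', hg', h3, fun d hd hd' => hN.lt_of_le_of_lt (hm2 d hd hd') h1⟩ (by simp)⟩
  | up =>
    have l1 := hM.lab_lt hm.2.2.1
    have pc : IsPoint c' := (hS.point _ hc).1 (hM.isPoint_left l1.1)
    have pg : IsLabel g' := fun h1 => hM.lab_isLabel hm.2.2.1 ((hS.point _ hg).2 h1)
    obtain ⟨x, hx⟩ := hN.lab_surj c' g' pc pg
    refine ⟨x, hS.insert_move hM hN hc hg hm ⟨hc', hg', hx, ?_⟩ (by simp)⟩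
    rintro _ ⟨q, hq, rfl⟩ h1
    exact hm.2.2.2 q.1 ⟨q, hq, rfl⟩ ((hS.lab_iff hM hN hc hq hg).2 h1)

end Good

/-! ### Closed sets, and reaching an element in four steps -/

/-- `P` is a finite set which contains a point and is closed under meets and labels. -/
def Closed {M : Type u} [coneLang.Structure M] (P : Set M) : Prop :=
  Good (Equiv.refl _) ((fun x : M => (x, x)) '' P)

/-- `z` is a one-element extension of `P`. -/
def Step {M : Type u} [coneLang.Structure M] (P : Set M) (z : M) : Prop :=
  ∃ k c g, Move P k z c g

theorem fst_image_diag {M : Type u} (P : Set M) : Prod.fst '' ((fun x : M => (x, x)) '' P) = P := by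
  rw [Set.image_image, Set.image_id']

theorem snd_image_diag {M : Type u} (P : Set M) : Prod.snd '' ((fun x : M => (x, x)) '' P) = P := by
  rw [Set.image_image, Set.image_id']

section Steps

variable {M : Type u} [coneLang.Structure M]

theorem Step.old {P : Set M} {x : M} (hx : x ∈ P) : Step P x := ⟨.old, x, x, hx, hx, rfl⟩

theorem Step.of_isLabel {P : Set M} (hne : P.Nonempty) {x : M} (hx : IsLabel x) : Step P x := by
  by_cases h : x ∈ P
  · exact Step.old h
  · obtain ⟨p, hp⟩ := hne
    exact ⟨.label, p, p, hp, hp, hx, h⟩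

/-- An element of `P` in the cone of `x` at `w` would meet `x` strictly above `w`, against the
maximality of `w`. -/
theorem step_up (h : IsConeTree M) {P Q : Set M} {x w g : M}
    (hQ : ∀ q ∈ Q, q ∈ P ∨ IsLabel q ∨ q = w) (hw : w ∈ Q) (hg : g ∈ Q) (hl : Lab w x g)
    (hmax : ∀ c ∈ P, ∀ e, IsMeet e x c → Le e w) : Step Q x := by
  refine ⟨.up, w, g, hw, hg, hl, fun d hd hd' => ?_⟩
  rcases hQ d hd with h1 | h1 | h1
  · obtain ⟨e, he⟩ := h.meet x d (h.isPoint_right (h.lab_lt hl).1)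
      (h.isPoint_right (h.lab_lt hd').1)
    exact h.not_le_of_lt (h.lt_meet_of_lab hl hd' he) (hmax d h1 e he)
  · exact h1 (h.isPoint_right (h.lab_lt hd').1)
  · subst h1
    exact (h.lab_lt hd').irrefl

/-- Each element is reached from a closed set in four steps. -/
theorem exists_steps (h : IsConeTree M) {P : Set M} (hP : Closed P) (x : M) :
    ∃ a b c, Step P a ∧ Step (insert a P) b ∧ Step (insert b (insert a P)) c ∧
      Step (insert c (insert b (insert a P))) x := by
  have hmeet : ∀ a ∈ P, ∀ b ∈ P, IsPoint a → IsPoint b → ∃ e ∈ P, IsMeet e a b := by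
    intro a ha b hb h1 h2
    obtain ⟨_, ⟨e, he, rfl⟩, h3, -⟩ := hP.meet _ ⟨a, ha, rfl⟩ _ ⟨b, hb, rfl⟩ h1 h2
    exact ⟨e, he, h3⟩
  have hfin : P.Finite := by
    have := hP.finite.image Prod.fst
    rwa [fst_image_diag] at this
  obtain ⟨_, ⟨p, hp, rfl⟩, pp⟩ := hP.nonempty
  simp only at pp
  have hne : P.Nonempty := ⟨p, hp⟩
  have m1 : ∀ (y : M) (Q : Set M), y ∈ insert y Q := fun y Q => Set.mem_insert _ _
  by_cases hx : IsPoint x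
  swap
  · exact ⟨x, x, x, Step.of_isLabel hne hx, Step.old (m1 _ _), Step.old (m1 _ _),
      Step.old (m1 _ _)⟩
  have hfin2 : {e | ∃ c ∈ P, IsMeet e x c}.Finite := by
    have : {e | ∃ c ∈ P, IsMeet e x c} ⊆ ⋃ c ∈ P, {e | IsMeet e x c} := by
      rintro e ⟨c, hc, he⟩
      exact Set.mem_biUnion hc he
    refine (hfin.biUnion fun c _ => Set.Subsingleton.finite ?_).subset this
    exact fun e he e' he' => h.isMeet_unique he he'
  -- The point `w` is where the path to `x` leaves the tree spanned by `P`: the greatest meet of `x`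
  -- with a point of `P`. The meets lie below `x`, so they form a chain.
  obtain ⟨w, ⟨c0, hc0, hw⟩, hmax⟩ := exists_greatest_of_directed (r := Le) h.trans hfin2 (by
      obtain ⟨e, he⟩ := h.meet x p hx pp
      exact ⟨e, p, hp, he⟩) (by
    intro a ha b hb
    obtain ⟨_, _, ha1⟩ := id ha
    obtain ⟨_, _, hb1⟩ := id hb
    rcases h.tree a b x ha1.1 hb1.1 with h1 | h1
    · exact ⟨b, hb, h1, h.refl _ (h.isPoint_left hb1.1)⟩
    · exact ⟨a, ha, h.refl _ (h.isPoint_left ha1.1), h1⟩)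
  replace hmax : ∀ c ∈ P, ∀ e, IsMeet e x c → Le e w := fun c hc e he => hmax e ⟨c, hc, he⟩
  have hwp := h.isPoint_left hw.1
  by_cases hwP : w ∈ P
  · by_cases hwx : w = x
    · subst hwx
      exact ⟨w, w, w, Step.old hwP, Step.old (m1 _ _), Step.old (m1 _ _), Step.old (m1 _ _)⟩
    · obtain ⟨g, hg⟩ := h.lab_total w x ⟨hw.1, hwx⟩
      refine ⟨g, x, x, Step.of_isLabel hne (h.lab_isLabel hg), ?_, Step.old (m1 _ _),
        Step.old (m1 _ _)⟩
      refine step_up h (P := P) ?_ (Or.inr hwP) (m1 _ _) hg hmax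
      rintro q (rfl | hq)
      · exact Or.inr (Or.inl (h.lab_isLabel hg))
      · exact Or.inl hq
  -- If `w` is new, it is inserted just below the least element `c` of `P` above it, which exists
  -- because `P` is closed under meets. The steps are the label of `c` at `w`, then `w`, then the
  -- label of `x` at `w`, then `x`.
  · obtain ⟨c, ⟨hc, hwc⟩, hmin⟩ := exists_greatest_of_directed (r := fun a b : M => Le b a)
      (fun a b c h1 h2 => h.trans _ _ _ h2 h1) (hfin.subset (Set.sep_subset P (fun c => Le w c)))
      ⟨c0, hc0, hw.2.1⟩ (by
        intro a ha b hb
        obtain ⟨e, he, h1⟩ := hmeet a ha.1 b hb.1 (h.isPoint_right ha.2) (h.isPoint_right hb.2)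
        exact ⟨e, ⟨he, h1.2.2 _ ha.2 hb.2⟩, h1.1, h1.2.1⟩)
    have hlt : Lt w c := ⟨hwc, fun e => hwP (e ▸ hc)⟩
    obtain ⟨g, hg⟩ := h.lab_total w c hlt
    have hdown : Step (insert g P) w := by
      refine ⟨.down, c, g, Or.inr hc, Or.inl rfl, hg, ?_⟩
      rintro d (rfl | hd) h1
      · exact absurd (h.isPoint_left h1.1) (h.lab_isLabel hg)
      · rcases h.lt_or_le h1.1 hwc with h2 | h2
        · exact h2
        · exact absurd (hmin d ⟨hd, h2⟩) (h.not_le_of_lt h1)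
    refine ⟨g, w, ?_⟩
    by_cases hwx : w = x
    · subst hwx
      exact ⟨w, Step.of_isLabel hne (h.lab_isLabel hg), hdown, Step.old (m1 _ _),
        Step.old (m1 _ _)⟩
    · obtain ⟨g2, hg2⟩ := h.lab_total w x ⟨hw.1, hwx⟩
      refine ⟨g2, Step.of_isLabel hne (h.lab_isLabel hg), hdown,
        Step.of_isLabel ⟨w, m1 _ _⟩ (h.lab_isLabel hg2), ?_⟩
      refine step_up h (P := P) ?_ (Or.inr (m1 _ _)) (m1 _ _) hg2 hmax
      rintro q (rfl | rfl | rfl | hq)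
      · exact Or.inr (Or.inl (h.lab_isLabel hg2))
      · exact Or.inr (Or.inr rfl)
      · exact Or.inr (Or.inl (h.lab_isLabel hg))
      · exact Or.inl hq

end Steps

/-! ### Back-and-forth -/

namespace Good

variable {M : Type u} {N : Type v} [coneLang.Structure M] [coneLang.Structure N]
  {σ : {x : M // IsLabel x} ≃ {x : N // IsLabel x}} {S : Set (M × N)}

theorem closed_fst (hS : Good σ S) :
    Closed (Prod.fst '' S) where
  finite := (hS.finite.image _).image _
  nonempty := by
    obtain ⟨q, hq, hp⟩ := hS.nonempty
    exact ⟨_, ⟨_, ⟨q, hq, rfl⟩, rfl⟩, hp⟩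
  point := by
    rintro _ ⟨_, ⟨q, hq, rfl⟩, rfl⟩
    rfl
  label := by
    rintro _ ⟨_, ⟨q, hq, rfl⟩, rfl⟩ hx
    rfl
  le := by
    rintro _ ⟨_, ⟨q, hq, rfl⟩, rfl⟩ _ ⟨_, ⟨r, hr, rfl⟩, rfl⟩
    rfl
  meet := by
    rintro _ ⟨_, ⟨q, hq, rfl⟩, rfl⟩ _ ⟨_, ⟨r, hr, rfl⟩, rfl⟩ h1 h2
    obtain ⟨e, he, h3, -⟩ := hS.meet q hq r hr h1 h2
    exact ⟨_, ⟨_, ⟨e, he, rfl⟩, rfl⟩, h3, h3⟩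
  lab := by
    rintro _ ⟨_, ⟨q, hq, rfl⟩, rfl⟩ _ ⟨_, ⟨r, hr, rfl⟩, rfl⟩ h1
    obtain ⟨e, he, h3, -⟩ := hS.lab q hq r hr h1
    exact ⟨_, ⟨_, ⟨e, he, rfl⟩, rfl⟩, h3, h3⟩

theorem exists_step (hM : IsConeTree M) (hN : IsConeTree N) (hS : Good σ S) {P : Set M}
    (hP : Prod.fst '' S = P) {z : M} (hz : Step P z) :
    ∃ z', Good σ (insert (z, z') S) ∧ Prod.fst '' (insert (z, z') S) = insert z P := by
  subst hP
  obtain ⟨k, c, g, hm⟩ := hz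
  obtain ⟨z', h⟩ := hS.exists_move hM hN hm
  exact ⟨z', h, by rw [Set.image_insert_eq]⟩

theorem extend (hM : IsConeTree M) (hN : IsConeTree N) (hS : Good σ S) (x : M) :
    ∃ x' S', S ⊆ S' ∧ Good σ S' ∧ (x, x') ∈ S' := by
  obtain ⟨a, b, c, s1, s2, s3, s4⟩ := exists_steps hM hS.closed_fst x
  obtain ⟨a', g1, e1⟩ := hS.exists_step hM hN rfl s1
  obtain ⟨b', g2, e2⟩ := g1.exists_step hM hN e1 s2
  obtain ⟨c', g3, e3⟩ := g2.exists_step hM hN e2 s3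
  obtain ⟨x', g4, -⟩ := g3.exists_step hM hN e3 s4
  refine ⟨x', _, ?_, g4, Set.mem_insert _ _⟩
  exact fun q hq => Or.inr (Or.inr (Or.inr (Or.inr hq)))

theorem extend_symm (hM : IsConeTree M) (hN : IsConeTree N) (hS : Good σ S) (x' : N) :
    ∃ x S', S ⊆ S' ∧ Good σ S' ∧ (x, x') ∈ S' := by
  obtain ⟨x, S', h1, h2, h3⟩ := (hS.symm hM hN).extend hN hM x'
  have h4 := h2.symm hN hM
  rw [Equiv.symm_symm] at h4
  exact ⟨x, Prod.swap '' S', fun q hq => ⟨q.swap, h1 ⟨q, hq, rfl⟩, rfl⟩, h4, ⟨(x', x), h3, rfl⟩⟩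

theorem extend_finite (hM : IsConeTree M) (hN : IsConeTree N) (hS : Good σ S) {F : Set M}
    (hF : F.Finite) : ∃ S', S ⊆ S' ∧ Good σ S' ∧ ∀ x ∈ F, ∃ x', (x, x') ∈ S' := by
  induction F, hF using Set.Finite.induction_on with
  | empty => exact ⟨S, subset_rfl, hS, fun x hx => hx.elim⟩
  | @insert a F _ _ ih =>
    obtain ⟨S', h1, h2, h3⟩ := ih
    obtain ⟨a', S'', h4, h5, h6⟩ := h2.extend hM hN a
    refine ⟨S'', h1.trans h4, h5, ?_⟩
    rintro x (rfl | hx)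
    · exact ⟨a', h6⟩
    · obtain ⟨x', hx'⟩ := h3 x hx
      exact ⟨x', h4 hx'⟩

theorem extend_tuple (hM : IsConeTree M) (hN : IsConeTree N) (hS : Good σ S) {ι : Type*}
    [Finite ι] (x : ι → M) : ∃ (x' : ι → N) (S' : Set (M × N)), S ⊆ S' ∧ Good σ S' ∧ ∀ i, (x i, x' i) ∈ S' := by
  obtain ⟨S', h1, h2, h3⟩ := hS.extend_finite hM hN (Set.finite_range x)
  choose x' hx' using fun i => h3 (x i) ⟨i, rfl⟩
  exact ⟨x', S', h1, h2, hx'⟩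

end Good

/-! ### Preservation of formulas -/

section Matches

variable {M : Type u} {N : Type v}

/-- The tuples `v` and `v'` correspond under `S`. -/
def Matches {ι : Type*} (S : Set (M × N)) (v : ι → M) (v' : ι → N) : Prop :=
  ∀ i, (v i, v' i) ∈ S

theorem Matches.mono {ι : Type*} {S S' : Set (M × N)} {v : ι → M} {v' : ι → N}
    (h : Matches S v v') (hS : S ⊆ S') : Matches S' v v' := fun i => hS (h i)

theorem Matches.elim {ι κ : Type*} {S : Set (M × N)} {v : ι → M} {v' : ι → N} {w : κ → M}
    {w' : κ → N} (h : Matches S v v') (h' : Matches S w w') :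
    Matches S (Sum.elim v w) (Sum.elim v' w') := by
  rintro (i | i)
  exacts [h i, h' i]

end Matches

section Transfer

variable {M : Type u} {N : Type v} [coneLang.Structure M] [coneLang.Structure N]
  {σ : {x : M // IsLabel x} ≃ {x : N // IsLabel x}} {S : Set (M × N)}

theorem exists_eq_var {α : Type*} (t : coneLang.Term α) : ∃ i, t = Term.var i := by
  cases t with
  | var i => exact ⟨i, rfl⟩
  | func f ts => exact f.elim

theorem Good.relMap_iff (hM : IsConeTree M) (hN : IsConeTree N) (hS : Good σ S) {l : ℕ}
    (R : coneLang.Relations l) {v : Fin l → M} {v' : Fin l → N} (hv : Matches S v v') :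
    Structure.RelMap R v ↔ Structure.RelMap R v' := by
  have e1 : ∀ {K : Type u} (w : Fin 1 → K), w = ![w 0] := fun w => by
    funext i; fin_cases i; rfl
  have e1' : ∀ {K : Type v} (w : Fin 1 → K), w = ![w 0] := fun w => by
    funext i; fin_cases i; rfl
  have e2 : ∀ {K : Type u} (w : Fin 2 → K), w = ![w 0, w 1] := fun w => by
    funext i; fin_cases i <;> rfl
  have e2' : ∀ {K : Type v} (w : Fin 2 → K), w = ![w 0, w 1] := fun w => by
    funext i; fin_cases i <;> rfl
  have e3 : ∀ {K : Type u} (w : Fin 3 → K), w = ![w 0, w 1, w 2] := fun w => by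
    funext i; fin_cases i <;> rfl
  have e3' : ∀ {K : Type v} (w : Fin 3 → K), w = ![w 0, w 1, w 2] := fun w => by
    funext i; fin_cases i <;> rfl
  cases R with
  | point =>
    rw [e1 v, e1' v']
    exact hS.point _ (hv 0)
  | le =>
    rw [e2 v, e2' v']
    exact hS.le _ (hv 0) _ (hv 1)
  | lab =>
    rw [e3 v, e3' v']
    exact hS.lab_iff hM hN (hv 0) (hv 1) (hv 2)

/-- By induction on the formula; the quantifier step is the back-and-forth property, with the same
`σ` throughout. The language is relational, so terms are variables. -/
theorem Good.boundedRealize_iff (hM : IsConeTree M) (hN : IsConeTree N) {α : Type*} {n : ℕ}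
    (φ : coneLang.BoundedFormula α n) {S : Set (M × N)} (hS : Good σ S) {v : α → M} {v' : α → N}
    {xs : Fin n → M} {xs' : Fin n → N} (hv : Matches S v v') (hxs : Matches S xs xs') :
    φ.Realize v xs ↔ φ.Realize v' xs' := by
  have ht : ∀ {n : ℕ} (t : coneLang.Term (α ⊕ Fin n)) {S : Set (M × N)} {xs : Fin n → M}
      {xs' : Fin n → N}, Matches S v v' → Matches S xs xs' →
      (t.realize (Sum.elim v xs), t.realize (Sum.elim v' xs')) ∈ S := by
    intro n t S xs xs' hv hxs
    obtain ⟨i, rfl⟩ := exists_eq_var t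
    exact hv.elim hxs i
  induction φ generalizing S with
  | falsum => rfl
  | equal t₁ t₂ => exact hS.eq_iff hM hN (ht t₁ hv hxs) (ht t₂ hv hxs)
  | rel R ts => exact hS.relMap_iff hM hN R fun i => ht (ts i) hv hxs
  | imp f g ih1 ih2 => exact imp_congr (ih1 hS hv hxs) (ih2 hS hv hxs)
  | all f ih =>
    have hsnoc : ∀ {S' : Set (M × N)} {x x'}, S ⊆ S' → (x, x') ∈ S' →
        Matches S' (Fin.snoc xs x : Fin _ → M) (Fin.snoc xs' x' : Fin _ → N) := by
      intro S' x x' h1 h2 i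
      induction i using Fin.lastCases with
      | last => simpa using h2
      | cast i => simpa using h1 (hxs i)
    simp only [BoundedFormula.realize_all]
    constructor
    · intro h x'
      obtain ⟨x, S', h1, h2, h3⟩ := hS.extend_symm hM hN x'
      exact (ih h2 (hv.mono h1) (hsnoc h1 h3)).1 (h x)
    · intro h x
      obtain ⟨x', S', h1, h2, h3⟩ := hS.extend hM hN x
      exact (ih h2 (hv.mono h1) (hsnoc h1 h3)).2 (h x')

theorem Good.realize_iff (hM : IsConeTree M) (hN : IsConeTree N) {α : Type*}
    (φ : coneLang.Formula α) (hS : Good σ S) {v : α → M} {v' : α → N} (hv : Matches S v v') :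
    φ.Realize v ↔ φ.Realize v' :=
  hS.boundedRealize_iff hM hN φ hv fun i => i.elim0

end Transfer

/-! ### Definable sets and finite supports -/

section Supported

variable {M : Type u} [coneLang.Structure M]

/-- `X` is invariant under the partial isomorphisms which fix the elements of `C`. -/
def SupportedBy (C : Set M) {α : Type*} (X : Set (α → M)) : Prop :=
  ∀ (σ : {x : M // IsLabel x} ≃ {x : M // IsLabel x}) (S : Set (M × M)), Good σ S →
    (∀ c ∈ C, (c, c) ∈ S) → ∀ v v' : α → M, Matches S v v' → (v ∈ X ↔ v' ∈ X)

theorem SupportedBy.mono {C C' : Set M} {α : Type*} {X : Set (α → M)} (h : SupportedBy C X)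
    (hC : C ⊆ C') : SupportedBy C' X :=
  fun σ S hS h1 => h σ S hS fun c hc => h1 c (hC hc)

theorem supportedBy_of_definable (hM : IsConeTree M) {A : Set M} {α : Type*} {X : Set (α → M)}
    (h : A.Definable coneLang X) : SupportedBy A X := by
  intro σ S hS h1 v v' hv
  obtain ⟨φ, rfl⟩ := Set.definable_iff_exists_formula_sum.1 h
  exact hS.realize_iff hM hM φ (Matches.elim (fun a => h1 a a.2) hv)

theorem exists_supportedBy (hM : IsConeTree M) {A : Set M} {α : Type*} {X : Set (α → M)}
    (h : A.Definable coneLang X) : ∃ C : Set M, C ⊆ A ∧ C.Finite ∧ SupportedBy C X := by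
  obtain ⟨A0, h1, h2⟩ := Set.definable_iff_finitely_definable.1 h
  exact ⟨A0, h1, A0.finite_toSet, supportedBy_of_definable hM h2⟩

end Supported

/-! ### Closed sets of linearly bounded size -/

section Closure

variable {M : Type u} [coneLang.Structure M]

theorem closed_singleton (hM : IsConeTree M) {x : M} (hx : IsPoint x) : Closed {x} := by
  rw [Closed, Set.image_singleton]
  exact Good.single hM hM _ hx hx

theorem Closed.finite {P : Set M} (h : Closed P) : P.Finite := by
  have := Good.finite h
  have := this.image Prod.fst
  rwa [fst_image_diag] at this

theorem Closed.insert_step (hM : IsConeTree M) {P : Set M} (h : Closed P) {z : M}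
    (hz : Step P z) : Closed (insert z P) := by
  obtain ⟨z', h1, h2⟩ := Good.exists_step hM hM h (fst_image_diag P) hz
  rw [← h2]
  exact h1.closed_fst

theorem Closed.exists_insert (hM : IsConeTree M) {P : Set M} (h : Closed P) (x : M) :
    ∃ Q, P ⊆ Q ∧ Closed Q ∧ x ∈ Q ∧ Q.ncard ≤ P.ncard + 4 := by
  obtain ⟨a, b, c, s1, s2, s3, s4⟩ := exists_steps hM h x
  refine ⟨_, ?_, (((h.insert_step hM s1).insert_step hM s2).insert_step hM s3).insert_step hM s4,
    Set.mem_insert _ _, ?_⟩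
  · exact fun q hq => Or.inr (Or.inr (Or.inr (Or.inr hq)))
  · have := Set.ncard_insert_le a P
    have := Set.ncard_insert_le b (insert a P)
    have := Set.ncard_insert_le c (insert b (insert a P))
    have := Set.ncard_insert_le x (insert c (insert b (insert a P)))
    omega

/-- Each finite set `F` is contained in a closed set with at most `4 |F| + 1` elements. -/
theorem exists_closed (hM : IsConeTree M) {F : Set M} (hF : F.Finite) :
    ∃ P, F ⊆ P ∧ Closed P ∧ P.ncard ≤ 4 * F.ncard + 1 := by
  induction F, hF using Set.Finite.induction_on with
  | empty =>
    -- A closed set has to contain a point even if `F` is empty; this is the `+ 1` in the bound.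
    obtain ⟨x, hx⟩ := hM.exists_point
    exact ⟨{x}, Set.empty_subset _, closed_singleton hM hx, by simp⟩
  | @insert a F ha hF ih =>
    obtain ⟨P, h1, h2, h3⟩ := ih
    obtain ⟨Q, h4, h5, h6, h7⟩ := h2.exists_insert hM a
    refine ⟨Q, Set.insert_subset h6 (h1.trans h4), h5, ?_⟩
    rw [Set.ncard_insert_of_notMem ha hF]
    omega

theorem Closed.isPoint {P : Set M} (h : Closed P) : ∃ p ∈ P, IsPoint p := by
  obtain ⟨_, ⟨p, hp, rfl⟩, h1⟩ := h.nonempty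
  exact ⟨p, hp, h1⟩

theorem Closed.good {P : Set M} (h : Closed P)
    (σ : {x : M // IsLabel x} ≃ {x : M // IsLabel x})
    (hσ : ∀ x (hx : IsLabel x), x ∈ P → (σ ⟨x, hx⟩ : M) = x) :
    Good σ ((fun x : M => (x, x)) '' P) where
  finite := Good.finite h
  nonempty := h.nonempty
  point := h.point
  label := by
    rintro _ ⟨x, hx, rfl⟩ h1
    exact (hσ x h1 hx).symm
  le := h.le
  meet := h.meet
  lab := h.lab

theorem Closed.exists_meet {P : Set M} (h : Closed P) {a b : M} (ha : a ∈ P) (hb : b ∈ P)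
    (pa : IsPoint a) (pb : IsPoint b) : ∃ e ∈ P, IsMeet e a b := by
  obtain ⟨_, ⟨e, he, rfl⟩, h3, -⟩ := h.meet _ ⟨a, ha, rfl⟩ _ ⟨b, hb, rfl⟩ pa pb
  exact ⟨e, he, h3⟩

/-- A closed set has a least point. -/
theorem Closed.exists_root (hM : IsConeTree M) {P : Set M} (h : Closed P) :
    ∃ r ∈ P, IsPoint r ∧ ∀ x ∈ P, IsPoint x → Le r x := by
  obtain ⟨p, hp, pp⟩ := h.isPoint
  obtain ⟨r, hr, hr'⟩ := exists_greatest_of_directed (r := fun a b : M => Le b a)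
    (fun a b c h1 h2 => hM.trans _ _ _ h2 h1) (h.finite.subset (Set.sep_subset P IsPoint))
    ⟨p, hp, pp⟩ (by
      intro a ha b hb
      obtain ⟨e, he, h1⟩ := h.exists_meet ha.1 hb.1 ha.2 hb.2
      exact ⟨e, ⟨he, hM.isPoint_left h1.1⟩, h1.1, h1.2.1⟩)
  exact ⟨r, hr.1, hr.2, fun x hx hp => hr' x ⟨hx, hp⟩⟩

end Closure

/-! ### Permutations of labels -/

section Perm

variable {M : Type u} [coneLang.Structure M]

/-- A finite partial injection between labels extends to a permutation of the labels. -/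
theorem exists_perm_extend (hM : IsConeTree M) {F : Set (M × M)} (hF : F.Finite)
    (h1 : ∀ q ∈ F, IsLabel q.1 ∧ IsLabel q.2)
    (h2 : ∀ q ∈ F, ∀ r ∈ F, q.1 = r.1 ↔ q.2 = r.2) :
    ∃ σ : {x : M // IsLabel x} ≃ {x : M // IsLabel x},
      ∀ q ∈ F, ∀ hx : IsLabel q.1, (σ ⟨q.1, hx⟩ : M) = q.2 := by
  have : Infinite {x : M // IsLabel x} := hM.infinite.to_subtype
  let D : Set {x : M // IsLabel x} := {x | ∃ y, ((x : M), y) ∈ F}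
  have hD : D.Finite := by
    refine ((hF.image Prod.fst).preimage Subtype.val_injective.injOn).subset ?_
    rintro x ⟨y, hy⟩
    exact ⟨_, hy, rfl⟩
  choose f hf using fun x : D => x.2
  let g : D ↪ {x : M // IsLabel x} := ⟨fun x => ⟨f x, (h1 _ (hf x)).2⟩, fun x y hxy => by
    have := (h2 _ (hf x) _ (hf y)).2 (congrArg Subtype.val hxy)
    exact Subtype.ext (Subtype.ext this)⟩
  obtain ⟨σ, hσ⟩ := Cardinal.extend_function_of_lt g (by
    exact (Cardinal.lt_aleph0_iff_set_finite.2 hD).trans_le (Cardinal.aleph0_le_mk _))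
    ⟨Equiv.refl _⟩
  refine ⟨σ, fun q hq hx => ?_⟩
  have hd : (⟨q.1, hx⟩ : {x : M // IsLabel x}) ∈ D := ⟨q.2, hq⟩
  rw [hσ ⟨_, hd⟩]
  exact (h2 _ (hf ⟨_, hd⟩) _ hq).1 rfl

end Perm

/-! ### A standard model: paths of labels over the real line -/

section Model

/-- A point of the standard tree over `δ : ℝ → Γ`: a height `ht`, and a path to this height, which
is given by the labels `f t` of the cones it takes at the heights `t < ht`; these labels are those
of `δ`, with finitely many exceptions. -/
@[ext] structure StdPoint {Γ : Type} (δ : ℝ → Γ) where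
  ht : ℝ
  f : ℝ → Γ
  finite : {t | f t ≠ δ t}.Finite
  eq_of_le : ∀ t, ht ≤ t → f t = δ t

namespace StdPoint

variable {Γ : Type} {δ : ℝ → Γ}

instance : LE (StdPoint δ) := ⟨fun p q => p.ht ≤ q.ht ∧ ∀ t < p.ht, p.f t = q.f t⟩

theorem le_antisymm {p q : StdPoint δ} (h1 : p ≤ q) (h2 : q ≤ p) : p = q := by
  have h3 : p.ht = q.ht := _root_.le_antisymm h1.1 h2.1
  refine StdPoint.ext h3 (funext fun t => ?_)
  rcases lt_or_ge t p.ht with h4 | h4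
  · exact h1.2 t h4
  · rw [p.eq_of_le t h4, q.eq_of_le t (h3 ▸ h4)]

theorem le_trans {p q r : StdPoint δ} (h1 : p ≤ q) (h2 : q ≤ r) : p ≤ r :=
  ⟨h1.1.trans h2.1, fun t ht => (h1.2 t ht).trans (h2.2 t (ht.trans_le h1.1))⟩

theorem le_of_le_of_le {p q r : StdPoint δ} (h1 : p ≤ r) (h2 : q ≤ r) (h3 : p.ht ≤ q.ht) :
    p ≤ q :=
  ⟨h3, fun t ht => (h1.2 t ht).trans (h2.2 t (ht.trans_le h3)).symm⟩

theorem ht_lt {p q : StdPoint δ} (h1 : p ≤ q) (h2 : p ≠ q) : p.ht < q.ht := by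
  refine lt_of_le_of_ne h1.1 fun h3 => h2 (le_antisymm h1 ?_)
  exact ⟨h3.ge, fun t ht => (h1.2 t (h3 ▸ ht)).symm⟩

open Classical in
/-- The point of height `s` on the path of `p`. -/
noncomputable def restrict (p : StdPoint δ) (s : ℝ) : StdPoint δ where
  ht := s
  f t := if t < s then p.f t else δ t
  finite := p.finite.subset fun t ht h => ht (by
    split_ifs
    · exact h
    · rfl)
  eq_of_le t ht := if_neg ht.not_gt

theorem restrict_le {p : StdPoint δ} {s : ℝ} (hs : s ≤ p.ht) : p.restrict s ≤ p :=
  ⟨hs, fun _ ht => if_pos ht⟩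

theorem restrict_le_of_agree {p q : StdPoint δ} {s : ℝ} (hs : s ≤ q.ht)
    (h : ∀ t < s, p.f t = q.f t) : p.restrict s ≤ q :=
  ⟨hs, fun t ht => (if_pos ht).trans (h t ht)⟩

theorem le_restrict {p q : StdPoint δ} {s : ℝ} (h : p ≤ q) (hs : p.ht ≤ s) :
    p ≤ q.restrict s :=
  ⟨hs, fun t ht => (h.2 t ht).trans (if_pos (ht.trans_le hs)).symm⟩

open Classical in
/-- The point of height `p.ht + 1` above `p` in the cone with label `g`. -/
noncomputable def above (p : StdPoint δ) (g : Γ) : StdPoint δ where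
  ht := p.ht + 1
  f t := if t = p.ht then g else p.f t
  finite := (p.finite.insert p.ht).subset fun t ht => by
    by_cases h : t = p.ht
    · exact Or.inl h
    · exact Or.inr (by simpa [h] using ht)
  eq_of_le t ht := by
    rw [if_neg (by linarith), p.eq_of_le t (by linarith)]

theorem le_above (p : StdPoint δ) (g : Γ) : p ≤ p.above g :=
  ⟨by simp [above], fun t ht => (if_neg ht.ne).symm⟩

theorem above_apply (p : StdPoint δ) (g : Γ) : (p.above g).f p.ht = g := if_pos rfl

/-- Applied to the exceptional heights of a path: right above any given height the path follows `δ`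
for a while, and there it inherits the genericity of `δ`. -/
theorem exists_gap {F : Set ℝ} (hF : F.Finite) {q r : ℝ} (hqr : q < r) :
    ∃ s, q < s ∧ s ≤ r ∧ ∀ t, q < t → t < s → t ∉ F := by
  induction F, hF using Set.Finite.induction_on with
  | empty => exact ⟨r, hqr, le_rfl, fun _ _ _ h => h⟩
  | @insert a F _ _ ih =>
    obtain ⟨s, h1, h2, h3⟩ := ih
    by_cases ha : q < a
    · refine ⟨min s a, lt_min h1 ha, (min_le_left _ _).trans h2, ?_⟩
      rintro t h4 h5 (rfl | h6)
      · exact lt_irrefl _ (h5.trans_le (min_le_right _ _))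
      · exact h3 t h4 (h5.trans_le (min_le_left _ _)) h6
    · refine ⟨s, h1, h2, ?_⟩
      rintro t h4 h5 (rfl | h6)
      · exact ha h4
      · exact h3 t h4 h5 h6

/-- Two paths agree up to the height at which they branch. -/
theorem exists_branch (p q : StdPoint δ) : ∃ s, s ≤ p.ht ∧ s ≤ q.ht ∧ (∀ t < s, p.f t = q.f t) ∧
    (s = p.ht ∨ s = q.ht ∨ p.f s ≠ q.f s) := by
  by_cases hne : {t | t < min p.ht q.ht ∧ p.f t ≠ q.f t}.Nonempty
  -- Where two paths differ, one of them departs from `δ`, which happens finitely often. So there is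
  -- a first difference, and meets exist.
  · have hfin : {t | t < min p.ht q.ht ∧ p.f t ≠ q.f t}.Finite := by
      refine (p.finite.union q.finite).subset fun t ht => ?_
      by_contra h
      simp only [Set.mem_union, Set.mem_ofPred_eq, not_or, not_not] at h
      exact ht.2 (h.1.trans h.2.symm)
    obtain ⟨s, hs, hmin⟩ := Set.exists_min_image _ id hfin hne
    have h1 := lt_min_iff.1 hs.1
    refine ⟨s, h1.1.le, h1.2.le, fun t ht => ?_, Or.inr (Or.inr hs.2)⟩
    by_contra h
    exact absurd (hmin t ⟨ht.trans hs.1, h⟩) (not_le.2 ht)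
  · refine ⟨min p.ht q.ht, min_le_left _ _, min_le_right _ _, fun t ht => ?_, ?_⟩
    · by_contra h
      exact hne ⟨t, ht, h⟩
    · rcases min_choice p.ht q.ht with h | h
      · exact Or.inl h
      · exact Or.inr (Or.inl h)

end StdPoint

/-- The universe of the standard model over `δ : ℝ → Γ`: the points and the labels. -/
def StdModel {Γ : Type} (δ : ℝ → Γ) : Type := StdPoint δ ⊕ Γ

/-- The relations of the standard model. -/
def StdModel.Rel {Γ : Type} {δ : ℝ → Γ} : ∀ {n : ℕ}, ConeRel n → (Fin n → StdModel δ) → Prop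
  | _, .point, x => ∃ p, x 0 = Sum.inl p
  | _, .le, x => ∃ p q : StdPoint δ, x 0 = Sum.inl p ∧ x 1 = Sum.inl q ∧ p ≤ q
  | _, .lab, x => ∃ (p q : StdPoint δ) (g : Γ), x 0 = Sum.inl p ∧ x 1 = Sum.inl q ∧
      x 2 = Sum.inr g ∧ p ≤ q ∧ p.ht < q.ht ∧ q.f p.ht = g

instance {Γ : Type} (δ : ℝ → Γ) : coneLang.Structure (StdModel δ) where
  funMap := fun f => f.elim
  RelMap := StdModel.Rel

namespace StdModel

variable {Γ : Type} {δ : ℝ → Γ}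

/-- A point as an element of the standard model. -/
def pt (p : StdPoint δ) : StdModel δ := Sum.inl p

/-- A label as an element of the standard model. -/
def lb (g : Γ) : StdModel δ := Sum.inr g

theorem pt_injective {p q : StdPoint δ} (h : pt p = pt q) : p = q := Sum.inl_injective h

theorem lb_injective {g g' : Γ} (h : (lb g : StdModel δ) = lb g') : g = g' :=
  Sum.inr_injective h

theorem cases (x : StdModel δ) : (∃ p, x = pt p) ∨ ∃ g, x = lb g := by
  rcases x with p | g
  exacts [Or.inl ⟨p, rfl⟩, Or.inr ⟨g, rfl⟩]

theorem isPoint_iff {x : StdModel δ} : IsPoint x ↔ ∃ p, x = pt p := Iff.rfl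

theorem isLabel_iff {x : StdModel δ} : IsLabel x ↔ ∃ g, x = lb g := by
  rw [IsLabel, isPoint_iff]
  constructor
  · exact (cases x).resolve_left
  · rintro ⟨g, rfl⟩ ⟨p, hp⟩
    cases hp

theorem le_iff {x y : StdModel δ} : Le x y ↔ ∃ p q : StdPoint δ, x = pt p ∧ y = pt q ∧ p ≤ q :=
  Iff.rfl

theorem lab_iff {x y z : StdModel δ} : Lab x y z ↔ ∃ (p q : StdPoint δ) (g : Γ),
    x = pt p ∧ y = pt q ∧ z = lb g ∧ p ≤ q ∧ p.ht < q.ht ∧ q.f p.ht = g := Iff.rfl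

theorem pt_le {p q : StdPoint δ} : Le (pt p) (pt q) ↔ p ≤ q := by
  rw [le_iff]
  constructor
  · rintro ⟨p', q', h1, h2, h3⟩
    rwa [pt_injective h1, pt_injective h2]
  · exact fun h => ⟨p, q, rfl, rfl, h⟩

theorem pt_lab {p q : StdPoint δ} {g : Γ} :
    Lab (pt p) (pt q) (lb g) ↔ p ≤ q ∧ p.ht < q.ht ∧ q.f p.ht = g := by
  rw [lab_iff]
  constructor
  · rintro ⟨p', q', g', h1, h2, h3, h4⟩
    rwa [pt_injective h1, pt_injective h2, lb_injective h3]
  · exact fun h => ⟨p, q, g, rfl, rfl, rfl, h⟩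

theorem pt_lt {p q : StdPoint δ} : Lt (pt p) (pt q) ↔ p ≤ q ∧ p.ht < q.ht := by
  rw [Lt, pt_le]
  constructor
  · exact fun h => ⟨h.1, StdPoint.ht_lt h.1 fun e => h.2 (e ▸ rfl)⟩
  · exact fun h => ⟨h.1, fun e => h.2.ne (pt_injective e ▸ rfl)⟩

theorem exists_pt_of_lt {x y : StdModel δ} (h : Lt x y) :
    ∃ p q : StdPoint δ, x = pt p ∧ y = pt q ∧ p ≤ q ∧ p.ht < q.ht := by
  obtain ⟨p, q, rfl, rfl, -⟩ := le_iff.1 h.1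
  exact ⟨p, q, rfl, rfl, pt_lt.1 h⟩

/-- Density of every value of `δ` is what makes the labelling generic; the other axioms hold for any
`δ` with infinitely many labels. -/
theorem isConeTree [Infinite Γ] (hδ : ∀ q r : ℝ, q < r → ∀ g, ∃ t, q < t ∧ t < r ∧ δ t = g) :
    IsConeTree (StdModel δ) where
  exists_point := ⟨pt ⟨0, δ, by simp, fun _ _ => rfl⟩, _, rfl⟩
  le_point := by
    intro x y h
    obtain ⟨p, q, rfl, rfl, -⟩ := le_iff.1 h
    exact ⟨⟨p, rfl⟩, ⟨q, rfl⟩⟩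
  refl := by
    rintro _ ⟨p, rfl⟩
    exact pt_le.2 ⟨le_rfl, fun _ _ => rfl⟩
  antisymm := by
    intro x y h h'
    obtain ⟨p, q, rfl, rfl, h1⟩ := le_iff.1 h
    rw [StdPoint.le_antisymm h1 (pt_le.1 h')]
  trans := by
    intro x y z h h'
    obtain ⟨p, q, rfl, rfl, h1⟩ := le_iff.1 h
    obtain ⟨_, r, e, rfl, h2⟩ := le_iff.1 h'
    rw [← pt_injective e] at h2
    exact pt_le.2 (StdPoint.le_trans h1 h2)
  tree := by
    intro x y z h h'
    obtain ⟨p, r, rfl, rfl, h1⟩ := le_iff.1 h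
    obtain ⟨q, _, rfl, e, h2⟩ := le_iff.1 h'
    rw [← pt_injective e] at h2
    rcases le_total p.ht q.ht with h3 | h3
    · exact Or.inl (pt_le.2 (StdPoint.le_of_le_of_le h1 h2 h3))
    · exact Or.inr (pt_le.2 (StdPoint.le_of_le_of_le h2 h1 h3))
  meet := by
    rintro _ _ ⟨p, rfl⟩ ⟨q, rfl⟩
    obtain ⟨s, h1, h2, h3, h4⟩ := p.exists_branch q
    refine ⟨pt (p.restrict s), pt_le.2 (StdPoint.restrict_le h1),
      pt_le.2 (StdPoint.restrict_le_of_agree h2 h3), fun w hw hw' => ?_⟩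
    obtain ⟨w, _, rfl, -, -⟩ := le_iff.1 hw
    have hp := pt_le.1 hw
    have hq := pt_le.1 hw'
    refine pt_le.2 (StdPoint.le_restrict hp ?_)
    rcases h4 with rfl | rfl | h4
    · exact hp.1
    · exact hq.1
    · by_contra h5
      push Not at h5
      exact h4 ((hp.2 s h5).symm.trans (hq.2 s h5))
  dense := by
    intro x y h
    obtain ⟨p, q, rfl, rfl, h1, h2⟩ := exists_pt_of_lt h
    refine ⟨pt (q.restrict ((p.ht + q.ht) / 2)),
      pt_lt.2 ⟨StdPoint.le_restrict h1 (by linarith), ?_⟩,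
      pt_lt.2 ⟨StdPoint.restrict_le (by linarith), ?_⟩⟩
    · change p.ht < (p.ht + q.ht) / 2
      linarith
    · change (p.ht + q.ht) / 2 < q.ht
      linarith
  no_min := by
    rintro _ ⟨p, rfl⟩
    refine ⟨pt (p.restrict (p.ht - 1)), pt_lt.2 ⟨StdPoint.restrict_le (by linarith), ?_⟩⟩
    change p.ht - 1 < p.ht
    linarith
  infinite := by
    refine (Set.infinite_range_of_injective (f := (lb : Γ → StdModel δ))
      fun _ _ => lb_injective).mono ?_
    rintro _ ⟨g, rfl⟩
    exact isLabel_iff.2 ⟨g, rfl⟩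
  lab_sort := by
    intro d x γ h
    obtain ⟨p, q, g, rfl, rfl, rfl, h1, h2, h3⟩ := lab_iff.1 h
    exact ⟨pt_lt.2 ⟨h1, h2⟩, isLabel_iff.2 ⟨g, rfl⟩⟩
  lab_total := by
    intro d x h
    obtain ⟨p, q, rfl, rfl, h1, h2⟩ := exists_pt_of_lt h
    exact ⟨_, pt_lab.2 ⟨h1, h2, rfl⟩⟩
  lab_unique := by
    intro d x γ γ' h h'
    obtain ⟨p, q, g, rfl, rfl, rfl, -, -, h1⟩ := lab_iff.1 h
    obtain ⟨_, _, g', e1, e2, rfl, -, -, h2⟩ := lab_iff.1 h'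
    rw [← pt_injective e1, ← pt_injective e2] at h2
    rw [← h1, ← h2]
  lab_cone := by
    intro d x y γ h h'
    obtain ⟨p, q, g, rfl, rfl, rfl, h1, h2, h3⟩ := lab_iff.1 h
    obtain ⟨_, r, e, rfl, h4, h5⟩ := exists_pt_of_lt h'
    rw [← pt_injective e] at h4 h5
    rw [pt_lab]
    constructor
    · rintro ⟨-, -, h6⟩
      obtain ⟨s, i1, i2, i3, i4⟩ := q.exists_branch r
      have hs : p.ht < s := by
        rcases i4 with rfl | rfl | i4
        · exact h2
        · exact h5
        · rcases lt_trichotomy s p.ht with i5 | rfl | i5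
          · exact absurd ((h1.2 s i5).symm.trans (h4.2 s i5)) i4
          · exact absurd (h3.trans h6.symm) i4
          · exact i5
      exact ⟨pt (q.restrict s), pt_lt.2 ⟨StdPoint.le_restrict h1 hs.le, hs⟩,
        pt_le.2 (StdPoint.restrict_le i1), pt_le.2 (StdPoint.restrict_le_of_agree i2 i3)⟩
    · rintro ⟨z, i1, i2, i3⟩
      obtain ⟨z, _, rfl, -, -⟩ := le_iff.1 i2
      have i4 := (pt_lt.1 i1).2
      refine ⟨h4, h5, ?_⟩
      rw [← (pt_le.1 i3).2 _ i4, (pt_le.1 i2).2 _ i4, h3]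
  lab_surj := by
    rintro _ γ ⟨p, rfl⟩ h
    obtain ⟨g, rfl⟩ := isLabel_iff.1 h
    refine ⟨pt (p.above g), pt_lab.2 ⟨p.le_above g, ?_, p.above_apply g⟩⟩
    change p.ht < p.ht + 1
    linarith
  generic := by
    intro d x γ h h'
    obtain ⟨p, q, rfl, rfl, h1, h2⟩ := exists_pt_of_lt h
    obtain ⟨g, rfl⟩ := isLabel_iff.1 h'
    obtain ⟨s, h3, h4, h5⟩ := StdPoint.exists_gap q.finite h2
    obtain ⟨t, h6, h7, h8⟩ := hδ p.ht s h3 g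
    have h9 : q.f t = δ t := not_not.1 (h5 t h6 h7)
    have h10 := StdPoint.restrict_le (p := q) (h7.le.trans h4)
    exact ⟨pt (q.restrict t), pt_lt.2 ⟨StdPoint.le_restrict h1 h6.le, h6⟩,
      pt_lt.2 ⟨h10, h7.trans_le h4⟩, pt_lab.2 ⟨h10, h7.trans_le h4, h9.trans h8⟩⟩

end StdModel

theorem coneTheory_isSatisfiable : coneTheory.IsSatisfiable := by
  -- The labels are the cosets of ℚ in ℝ, and `δ` is the quotient map: each coset is dense, and
  -- there are infinitely many cosets since ℝ is uncountable.
  let H : AddSubgroup ℝ := (algebraMap ℚ ℝ).toAddMonoidHom.range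
  have : Infinite (ℝ ⧸ H) := by
    by_contra h
    rw [not_infinite_iff_finite] at h
    have : Countable ((ℝ ⧸ H) × H) := by
      have : Countable H := (Set.countable_range (algebraMap ℚ ℝ)).to_subtype
      infer_instance
    exact not_countable (Countable.of_equiv _
      (AddSubgroup.addGroupEquivQuotientProdAddSubgroup (s := H)).symm : Countable ℝ)
  have hM : IsConeTree (StdModel (QuotientAddGroup.mk : ℝ → ℝ ⧸ H)) := by
    refine StdModel.isConeTree fun q r hqr g => ?_
    obtain ⟨x, rfl⟩ := QuotientAddGroup.mk_surjective g
    obtain ⟨a, h1, h2⟩ := exists_rat_btwn (sub_lt_sub_right hqr x)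
    refine ⟨x + a, by linarith, by linarith, QuotientAddGroup.eq.2 ⟨-a, ?_⟩⟩
    simp
  have hT := model_coneTheory_iff.2 hM
  have : Nonempty (StdModel (QuotientAddGroup.mk : ℝ → ℝ ⧸ H)) := ⟨Sum.inr 0⟩
  exact hT.isSatisfiable

end Model

/-! ### Completeness of the theory -/

section Complete

theorem card_coneLang_le : coneLang.card ≤ Cardinal.aleph0 := by
  have h1 : ∀ l, Countable (coneLang.Functions l) := fun l => inferInstanceAs (Countable Empty)
  have h2 : ∀ l, Countable (coneLang.Relations l) := fun l => by
    refine ⟨⟨fun R => match l, R with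
      | _, ConeRel.point => 0
      | _, ConeRel.le => 1
      | _, ConeRel.lab => 2, ?_⟩⟩
    intro R R' _
    change ConeRel l at R R'
    cases R <;> cases R' <;> rfl
  have h3 : Countable coneLang.Symbols := by
    unfold Language.Symbols
    infer_instance
  exact Cardinal.mk_le_aleph0_iff.2 h3

theorem exists_countable_equivalent (M : Type) [coneLang.Structure M] (hM : IsConeTree M) :
    ∃ S : coneLang.ElementarySubstructure M, Countable S ∧ IsConeTree S := by
  have : Infinite M := Set.infinite_univ_iff.1 (hM.infinite.mono (Set.subset_univ _))
  obtain ⟨S, -, hS⟩ := exists_elementarySubstructure_card_eq coneLang (M := M) ∅ Cardinal.aleph0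
    le_rfl (by simp) (by simpa using card_coneLang_le) (by simp)
  refine ⟨S, ?_, ?_⟩
  · rw [Cardinal.lift_id, Cardinal.lift_id] at hS
    exact Cardinal.mk_le_aleph0_iff.1 hS.le
  · exact model_coneTheory_iff.1
      (S.elementarilyEquivalent.symm.theory_model_iff.1 (model_coneTheory_iff.2 hM))

/-- Countability only serves to get a bijection `σ` between the label sets; any pair of points then
starts the back-and-forth. -/
theorem elementarilyEquivalent_of_countable {M N : Type} [coneLang.Structure M]
    [coneLang.Structure N] [Countable M] [Countable N] (hM : IsConeTree M) (hN : IsConeTree N)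
    (φ : coneLang.Sentence) : M ⊨ φ ↔ N ⊨ φ := by
  have : Infinite {x : M // IsLabel x} := hM.infinite.to_subtype
  have : Infinite {x : N // IsLabel x} := hN.infinite.to_subtype
  obtain ⟨σ⟩ : Nonempty ({x : M // IsLabel x} ≃ {x : N // IsLabel x}) := nonempty_equiv_of_countable
  obtain ⟨x, hx⟩ := hM.exists_point
  obtain ⟨y, hy⟩ := hN.exists_point
  exact (Good.single hM hN σ hx hy).realize_iff hM hN φ fun i => i.elim

theorem coneTheory_isComplete : coneTheory.IsComplete := by
  refine ⟨coneTheory_isSatisfiable, fun φ => ?_⟩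
  have key : ∀ M N : coneTheory.ModelType.{0, 0, 0}, M ⊨ φ ↔ N ⊨ φ := by
    intro M N
    obtain ⟨S, h1, h2⟩ := exists_countable_equivalent M (model_coneTheory_iff.1 M.is_model)
    obtain ⟨S', h1', h2'⟩ := exists_countable_equivalent N (model_coneTheory_iff.1 N.is_model)
    rw [← elementarilyEquivalent_iff.1 S.elementarilyEquivalent φ,
      ← elementarilyEquivalent_iff.1 S'.elementarilyEquivalent φ]
    exact elementarilyEquivalent_of_countable h2 h2' φ
  obtain ⟨M⟩ := coneTheory_isSatisfiable
  simp only [Theory.models_sentence_iff]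
  by_cases h : M ⊨ φ
  · exact Or.inl fun N => (key M N).1 h
  · exact Or.inr fun N hN => h ((key M N).2 hN)

end Complete

/-! ### Closure properties of definability in a structure -/

section Calculus

variable {L : FirstOrder.Language.{0, 0}} {M : Type u} [L.Structure M] {A : Set M}
  {α β ι : Type*}

theorem definable_and {P Q : (α → M) → Prop} (hP : A.Definable L {v | P v})
    (hQ : A.Definable L {v | Q v}) : A.Definable L {v | P v ∧ Q v} := hP.inter hQ

theorem definable_or {P Q : (α → M) → Prop} (hP : A.Definable L {v | P v})
    (hQ : A.Definable L {v | Q v}) : A.Definable L {v | P v ∨ Q v} := hP.union hQ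

theorem definable_not {P : (α → M) → Prop} (hP : A.Definable L {v | P v}) :
    A.Definable L {v | ¬ P v} := hP.compl

theorem definable_imp {P Q : (α → M) → Prop} (hP : A.Definable L {v | P v})
    (hQ : A.Definable L {v | Q v}) : A.Definable L {v | P v → Q v} := by
  simpa only [imp_iff_not_or] using definable_or (definable_not hP) hQ

theorem definable_iff {P Q : (α → M) → Prop} (hP : A.Definable L {v | P v})
    (hQ : A.Definable L {v | Q v}) : A.Definable L {v | P v ↔ Q v} := by
  simpa only [iff_iff_implies_and_implies] using
    definable_and (definable_imp hP hQ) (definable_imp hQ hP)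

theorem definable_const (p : Prop) : A.Definable L {_v : α → M | p} := by
  by_cases h : p
  · simp [h]
  · simp [h]

theorem definable_forall_finite [Finite ι] {P : ι → (α → M) → Prop}
    (hP : ∀ i, A.Definable L {v | P i v}) : A.Definable L {v | ∀ i, P i v} := by
  have := Set.definable_iInter_of_finite hP
  rwa [← Set.ofPred_forall] at this

theorem definable_exists_finite [Finite ι] {P : ι → (α → M) → Prop}
    (hP : ∀ i, A.Definable L {v | P i v}) : A.Definable L {v | ∃ i, P i v} := by
  have := Set.definable_iUnion_of_finite hP
  rwa [← Set.ofPred_exists] at this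

theorem definable_exists [Finite β] {P : (α → M) → (β → M) → Prop}
    (hP : A.Definable L {w : α ⊕ β → M | P (fun a => w (.inl a)) (fun b => w (.inr b))}) :
    A.Definable L {v | ∃ u, P v u} := hP.exists_of_finite

theorem definable_forall [Finite β] {P : (α → M) → (β → M) → Prop}
    (hP : A.Definable L {w : α ⊕ β → M | P (fun a => w (.inl a)) (fun b => w (.inr b))}) :
    A.Definable L {v | ∀ u, P v u} := hP.forall_of_finite

theorem definable_exists_one {P : (α → M) → M → Prop}
    (hP : A.Definable L {w : α ⊕ Unit → M | P (fun a => w (.inl a)) (w (.inr ()))}) :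
    A.Definable L {v | ∃ u, P v u} := by
  have := definable_exists (P := fun v (u : Unit → M) => P v (u ())) hP
  convert this using 3
  exact ⟨fun ⟨u, hu⟩ => ⟨fun _ => u, hu⟩, fun ⟨u, hu⟩ => ⟨u (), hu⟩⟩

theorem definable_forall_one {P : (α → M) → M → Prop}
    (hP : A.Definable L {w : α ⊕ Unit → M | P (fun a => w (.inl a)) (w (.inr ()))}) :
    A.Definable L {v | ∀ u, P v u} := by
  have := definable_forall (P := fun v (u : Unit → M) => P v (u ())) hP
  convert this using 3
  exact ⟨fun h u => h (u ()), fun h u => h fun _ => u⟩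

theorem definable_eq (i j : α) : A.Definable L {v : α → M | v i = v j} := by
  have h : (∅ : Set M).Definable L {v : α → M | v i = v j} := by
    rw [Set.empty_definable_iff]
    exact ⟨(Term.var i).equal (Term.var j), by ext v; simp⟩
  exact h.mono (Set.empty_subset _)

theorem definable_setoid (s : ImagSort L M) (f g : Fin s.n → α) :
    A.Definable L {v : α → M | s.E.r (fun i => v (f i)) (fun i => v (g i))} := by
  have h : (∅ : Set M).Definable L {v : α → M | s.E.r (fun i => v (f i)) (fun i => v (g i))} :=
    s.definable.preimage_comp (Sum.elim f g)
  exact h.mono (Set.empty_subset _)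

end Calculus

/-! ### Closure properties of definability over imaginaries -/

section Imaginaries

variable {L : FirstOrder.Language.{0, 0}} {M : Type u} [L.Structure M] {A B : Set (Imag L M)}
  {α β ι κ : Type}

/-- The variables for the representatives of a tuple of imaginaries. -/
abbrev RepIdx (e : ι → Imag L M) : Type := Σ i, Fin (e i).1.n

/-- `y` represents the tuple `e` of imaginaries. -/
def IsRep (e : ι → Imag L M) (y : RepIdx e → M) : Prop :=
  ∀ i, Quotient.mk (e i).1.E (fun j => y ⟨i, j⟩) = (e i).2

theorem exists_isRep (e : ι → Imag L M) : ∃ y, IsRep e y := by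
  choose y hy using fun i => Quotient.exists_rep (e i).2
  exact ⟨fun j => y j.1 j.2, hy⟩

theorem eqDefinable_of_exists [Finite ι] {e : ι → Imag L M} (he : ∀ i, e i ∈ A)
    {Z : Set (α ⊕ RepIdx e → M)} (hZ : (∅ : Set M).Definable L Z) :
    EqDefinable A {x | ∃ y, IsRep e y ∧ Sum.elim x y ∈ Z} := by
  obtain ⟨k, ⟨f⟩⟩ := Finite.exists_equiv_fin ι
  obtain ⟨R, rfl⟩ := Set.empty_definable_iff.1 hZ
  let g : RepIdx (e ∘ f.symm) ≃ RepIdx e :=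
    Equiv.sigmaCongrLeft (β := fun i => Fin (e i).1.n) f.symm
  have hrep : ∀ y : RepIdx e → M, IsRep e y ↔ IsRep (e ∘ f.symm) (y ∘ g) := by
    intro y
    constructor
    · exact fun h i => h (f.symm i)
    · intro h i
      obtain ⟨j, rfl⟩ := f.symm.surjective i
      exact h j
  refine ⟨k, e ∘ f.symm, fun i => he _, R.relabel (Sum.map id g.symm), ?_⟩
  ext x
  simp only [Set.mem_ofPred_eq, Formula.realize_relabel]
  constructor
  · rintro ⟨y, hy, h⟩
    refine ⟨fun i j => y (g ⟨i, j⟩), (hrep y).1 hy, ?_⟩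
    convert h using 1
    funext j
    rcases j with j | j
    · rfl
    · change y (g ⟨(g.symm j).1, (g.symm j).2⟩) = y j
      rw [Sigma.eta, Equiv.apply_symm_apply]
  · rintro ⟨y, hy, h⟩
    refine ⟨fun j => y (g.symm j).1 (g.symm j).2, ?_, ?_⟩
    · rw [hrep]
      intro i
      rw [← hy i]
      congr 1
      funext j
      simp only [Function.comp_apply]
      rw [Equiv.symm_apply_apply]
    · convert h using 1
      funext j
      rcases j with j | j <;> rfl

/-- A normal form of definability over imaginaries: the formula does not depend on the choice of
the representatives. -/
theorem EqDefinable.exists_normal {X : Set (α → M)} (h : EqDefinable A X) :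
    ∃ (k : ℕ) (e : Fin k → Imag L M) (Z : Set (α ⊕ RepIdx e → M)), (∀ i, e i ∈ A) ∧
      (∅ : Set M).Definable L Z ∧ ∀ y, IsRep e y → ∀ x, x ∈ X ↔ Sum.elim x y ∈ Z := by
  obtain ⟨k, e, he, R, rfl⟩ := h
  -- The formula is saturated under change of representatives of the parameters, which is possible
  -- without parameters because the equivalence relations of the sorts are ∅-definable.
  refine ⟨k, e, {v | ∃ y : RepIdx e → M, (∀ i, (e i).1.E.r (fun j => y ⟨i, j⟩)
    (fun j => v (.inr ⟨i, j⟩))) ∧ R.Realize (Sum.elim (fun a => v (.inl a)) y)}, he, ?_, ?_⟩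
  · refine definable_exists (P := fun (v : α ⊕ RepIdx e → M) (y : RepIdx e → M) => (∀ i, (e i).1.E.r (fun j => y ⟨i, j⟩)
      (fun j => v (.inr ⟨i, j⟩))) ∧ R.Realize (Sum.elim (fun a => v (.inl a)) y)) ?_
    refine definable_and (definable_forall_finite fun i => definable_setoid _ _ _) ?_
    have h : (∅ : Set M).Definable L {v : α ⊕ RepIdx e → M | R.Realize v} :=
      Set.empty_definable_iff.2 ⟨R, rfl⟩
    convert h.preimage_comp (fun j : α ⊕ RepIdx e => (Sum.map Sum.inl id j :
      (α ⊕ RepIdx e) ⊕ RepIdx e)) using 1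
    ext v
    simp only [Set.mem_ofPred_eq, Set.mem_preimage]
    apply iff_of_eq
    congr 1
    funext j
    rcases j with j | j <;> rfl
  · intro y hy x
    constructor
    · rintro ⟨y', hy', h⟩
      exact ⟨fun j => y' j.1 j.2, fun i => Quotient.exact ((hy' i).trans (hy i).symm), h⟩
    · rintro ⟨y', hy', h⟩
      exact ⟨fun i j => y' ⟨i, j⟩, fun i => (Quotient.sound (hy' i)).trans (hy i), h⟩

theorem eqDefinable_of_normal [Finite ι] {e : ι → Imag L M} (he : ∀ i, e i ∈ A)
    {Z : Set (α ⊕ RepIdx e → M)} (hZ : (∅ : Set M).Definable L Z) {X : Set (α → M)}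
    (h : ∀ y, IsRep e y → ∀ x, x ∈ X ↔ Sum.elim x y ∈ Z) : EqDefinable A X := by
  convert eqDefinable_of_exists he hZ using 1
  ext x
  constructor
  · intro hx
    obtain ⟨y, hy⟩ := exists_isRep e
    exact ⟨y, hy, (h y hy x).1 hx⟩
  · rintro ⟨y, hy, hx⟩
    exact (h y hy x).2 hx

theorem EqDefinable.mono {X : Set (α → M)} (h : EqDefinable A X) (hAB : A ⊆ B) :
    EqDefinable B X := by
  obtain ⟨k, e, he, R, rfl⟩ := h
  exact ⟨k, e, fun i => hAB (he i), R, rfl⟩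

theorem EqDefinable.of_definable {X : Set (α → M)} (h : (∅ : Set M).Definable L X) :
    EqDefinable A X := by
  refine eqDefinable_of_normal (ι := Empty) (e := fun i => i.elim) (fun i => i.elim)
    (h.preimage_comp Sum.inl) fun y _ x => ?_
  rfl

/-- A definable operation `T` that acts uniformly, with the representatives of the parameters
carried along as extra variables, preserves definability over `A`. -/
theorem EqDefinable.map_definable {X : Set (α → M)} (h : EqDefinable A X)
    {T : Set (α → M) → Set (β → M)}
    (hT : ∀ {κ : Type} (Z : Set (α ⊕ κ → M)), (∅ : Set M).Definable L Z →
      ∃ Z' : Set (β ⊕ κ → M), (∅ : Set M).Definable L Z' ∧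
        ∀ y x, Sum.elim x y ∈ Z' ↔ x ∈ T {x | Sum.elim x y ∈ Z}) :
    EqDefinable A (T X) := by
  obtain ⟨k, e, Z, he, hZ, h⟩ := h.exists_normal
  obtain ⟨Z', hZ', h'⟩ := hT Z hZ
  refine eqDefinable_of_normal he hZ' fun y hy x => ?_
  rw [h', show X = {x | Sum.elim x y ∈ Z} from Set.ext (h y hy)]

theorem eqDefinable_not {P : (α → M) → Prop} (h : EqDefinable A {x | P x}) :
    EqDefinable A {x | ¬ P x} :=
  h.map_definable (T := fun X => Xᶜ) fun Z hZ => ⟨Zᶜ, hZ.compl, fun _ _ => Iff.rfl⟩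

theorem eqDefinable_comp {P : (α → M) → Prop} (f : α → β) (h : EqDefinable A {x | P x}) :
    EqDefinable A {x | P fun a => x (f a)} := by
  refine h.map_definable (T := fun X => {x | (fun a => x (f a)) ∈ X}) fun Z hZ =>
    ⟨_, hZ.preimage_comp (Sum.map f id), fun y x => ?_⟩
  simp only [Set.mem_preimage, Set.mem_ofPred_eq]
  apply iff_of_eq
  congr 1
  funext j
  rcases j with j | j <;> rfl

theorem eqDefinable_exists [Finite β] {P : (α → M) → (β → M) → Prop}
    (h : EqDefinable A {w : α ⊕ β → M | P (fun a => w (.inl a)) (fun b => w (.inr b))}) :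
    EqDefinable A {x | ∃ u, P x u} := by
  refine h.map_definable (T := fun X => {x | ∃ u, Sum.elim x u ∈ X}) fun {κ} Z hZ =>
    ⟨{v | ∃ u : β → M, Sum.elim (Sum.elim (fun a => v (.inl a)) u) (fun c => v (.inr c)) ∈ Z},
      ?_, fun y x => Iff.rfl⟩
  refine definable_exists (P := fun (v : α ⊕ κ → M) (u : β → M) =>
    Sum.elim (Sum.elim (fun a => v (.inl a)) u) (fun c => v (.inr c)) ∈ Z) ?_
  convert hZ.preimage_comp (Sum.elim (Sum.elim (fun a => .inl (.inl a)) Sum.inr)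
    (fun c => .inl (.inr c)) : (α ⊕ β) ⊕ κ → (α ⊕ κ) ⊕ β) using 1
  ext v
  simp only [Set.mem_ofPred_eq, Set.mem_preimage]
  apply iff_of_eq
  congr 1
  funext j
  rcases j with (j | j) | j <;> rfl

theorem eqDefinable_and {P Q : (α → M) → Prop} (hP : EqDefinable A {x | P x})
    (hQ : EqDefinable A {x | Q x}) : EqDefinable A {x | P x ∧ Q x} := by
  obtain ⟨k, e, Z, he, hZ, h⟩ := hP.exists_normal
  obtain ⟨k', e', Z', he', hZ', h'⟩ := hQ.exists_normal
  have hA : ∀ i, Sum.elim e e' i ∈ A := by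
    rintro (i | i)
    exacts [he i, he' i]
  refine eqDefinable_of_normal hA (definable_and
    (hZ.preimage_comp (Sum.map id fun j => ⟨.inl j.1, j.2⟩ :
      α ⊕ RepIdx e → α ⊕ RepIdx (Sum.elim e e')))
    (hZ'.preimage_comp (Sum.map id fun j => ⟨.inr j.1, j.2⟩ :
      α ⊕ RepIdx e' → α ⊕ RepIdx (Sum.elim e e')))) fun y hy x => ?_
  have h1 := h (fun j => y ⟨.inl j.1, j.2⟩) (fun i => hy (.inl i)) x
  have h2 := h' (fun j => y ⟨.inr j.1, j.2⟩) (fun i => hy (.inr i)) x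
  refine (and_congr h1 h2).trans (iff_of_eq ?_)
  congr 2
  · funext j
    rcases j with j | j <;> rfl
  · funext j
    rcases j with j | j <;> rfl

theorem eqDefinable_imp {P Q : (α → M) → Prop} (hP : EqDefinable A {x | P x})
    (hQ : EqDefinable A {x | Q x}) : EqDefinable A {x | P x → Q x} := by
  simpa only [not_and_not_right] using eqDefinable_not (eqDefinable_and hP (eqDefinable_not hQ))

theorem eqDefinable_iff {P Q : (α → M) → Prop} (hP : EqDefinable A {x | P x})
    (hQ : EqDefinable A {x | Q x}) : EqDefinable A {x | P x ↔ Q x} := by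
  simpa only [iff_iff_implies_and_implies] using
    eqDefinable_and (eqDefinable_imp hP hQ) (eqDefinable_imp hQ hP)

theorem eqDefinable_forall [Finite β] {P : (α → M) → (β → M) → Prop}
    (h : EqDefinable A {w : α ⊕ β → M | P (fun a => w (.inl a)) (fun b => w (.inr b))}) :
    EqDefinable A {x | ∀ u, P x u} := by
  simpa only [not_exists, not_not] using eqDefinable_not (eqDefinable_exists
    (P := fun x u => ¬ P x u) (eqDefinable_not h))

theorem eqDefinable_forall_lt {P : ℕ → (α → M) → Prop} (k : ℕ)
    (h : ∀ i < k, EqDefinable A {x | P i x}) : EqDefinable A {x | ∀ i < k, P i x} := by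
  induction k with
  | zero => simpa using EqDefinable.of_definable (Set.definable_univ (L := L) (α := α))
  | succ k ih =>
    simp only [Nat.lt_succ_iff_lt_or_eq, or_imp, forall_and, forall_eq]
    exact eqDefinable_and (ih fun i hi => h i (hi.trans (Nat.lt_succ_self k)))
      (h k (Nat.lt_succ_self k))

theorem eqDefinable_forall_fin {k : ℕ} {P : Fin k → (α → M) → Prop}
    (h : ∀ i, EqDefinable A {x | P i x}) : EqDefinable A {x | ∀ i, P i x} := by
  have := eqDefinable_forall_lt (A := A) (P := fun i x => ∀ hi : i < k, P ⟨i, hi⟩ x) k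
    fun i hi => by simpa [hi] using h ⟨i, hi⟩
  convert this using 3
  exact ⟨fun h i hi _ => h ⟨i, hi⟩, fun h i => h i i.2 i.2⟩

theorem eqDefinable_reps {e : Imag L M} (he : e ∈ A) : EqDefinable A (reps e.1 {e.2}) := by
  refine eqDefinable_of_normal (ι := Unit) (e := fun _ => e) (fun _ => he)
    (definable_setoid e.1 Sum.inl fun j => .inr ⟨(), j⟩) fun y hy x => ?_
  have h1 : Quotient.mk e.1.E (fun j => y ⟨(), j⟩) = e.2 := hy ()
  change Quotient.mk e.1.E x = e.2 ↔ e.1.E.r x fun j => y ⟨(), j⟩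
  rw [← h1]
  exact Quotient.eq

/-- In a set definable over `A` and a finite tuple `a`, the tuple `a` can be replaced by
variables for its representatives. -/
theorem EqDefinable.exists_family {n : ℕ} {a : Fin n → Imag L M} {X : Set (α → M)}
    (h : EqDefinable (A ∪ Set.range a) X) : ∃ W : Set (RepIdx a ⊕ α → M), EqDefinable A W ∧
      ∀ x, IsRep a x → ∀ t, t ∈ X ↔ Sum.elim x t ∈ W := by
  classical
  obtain ⟨k, e, Z, he, hZ, h⟩ := h.exists_normal
  choose φ hφ using fun (i : Fin k) (hi : e i ∉ A) => (he i).resolve_left hi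
  let e₁ : {i // e i ∈ A} → Imag L M := fun i => e i
  -- Parameters from `A` stay parameters. Any other parameter equals some `a j`, so its
  -- representative is replaced by the variables for `a j`, up to a cast between equal sorts.
  let θ : α ⊕ RepIdx e → (RepIdx a ⊕ α) ⊕ RepIdx e₁ := Sum.elim (fun s => .inl (.inr s))
    fun j => if hj : e j.1 ∈ A then .inr ⟨⟨j.1, hj⟩, j.2⟩ else
      .inl (.inl ⟨φ j.1 hj, Fin.cast (by rw [hφ j.1 hj]) j.2⟩)
  refine ⟨_, eqDefinable_of_exists (e := e₁) (fun i => i.2) (hZ.preimage_comp θ), ?_⟩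
  intro x hx t
  have hcast : ∀ (j : Fin n) (e' : Imag L M) (hj : a j = e'),
      Quotient.mk e'.1.E (fun i => x ⟨j, Fin.cast (by rw [hj]) i⟩) = e'.2 := by
    rintro j _ rfl
    exact hx j
  have key : ∀ y, IsRep e₁ y → (t ∈ X ↔ Sum.elim (Sum.elim x t) y ∈ (fun g => g ∘ θ) ⁻¹' Z) := by
    intro y hy
    have hrep : IsRep e fun j => Sum.elim (Sum.elim x t) y (θ (.inr j)) := by
      intro i
      by_cases hi : e i ∈ A
      · simp only [θ, Sum.elim_inr, hi, dite_true]
        exact hy ⟨i, hi⟩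
      · simp only [θ, Sum.elim_inr, hi, dite_false, Sum.elim_inl]
        exact hcast _ _ (hφ i hi)
    rw [h _ hrep t]
    apply iff_of_eq
    rw [Set.mem_preimage]
    congr 1
    funext j
    rcases j with j | j <;> rfl
  constructor
  · intro ht
    obtain ⟨y, hy⟩ := exists_isRep e₁
    exact ⟨y, hy, (key y hy).1 ht⟩
  · rintro ⟨y, hy, ht⟩
    exact (key y hy).2 ht

end Imaginaries

theorem EqDefinable.exists_supportedBy {M : Type u} [coneLang.Structure M] (hM : IsConeTree M)
    {A : Set (Imag coneLang M)} {α : Type} {X : Set (α → M)} (h : EqDefinable A X) :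
    ∃ C : Set M, C.Finite ∧ SupportedBy C X := by
  obtain ⟨k, e, Z, he, hZ, h⟩ := h.exists_normal
  obtain ⟨y, hy⟩ := exists_isRep e
  refine ⟨Set.range y, Set.finite_range y, fun σ S hS h1 v v' hv => ?_⟩
  rw [h y hy, h y hy]
  exact supportedBy_of_definable hM hZ σ S hS (fun c hc => hc.elim) _ _
    (hv.elim fun i => h1 _ ⟨i, rfl⟩)

/-! ### Equality patterns do not have the order property -/

section Order

/-- On a large subset, each of finitely many functions is constant or injective. -/
theorem exists_const_or_injOn {τ Γ : Type*} (T : Finset τ) (n : ℕ) :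
    ∃ N, ∀ (c : ℕ → τ → Γ) (s : Finset ℕ), N ≤ s.card → ∃ s' ⊆ s, n ≤ s'.card ∧
      ∀ p ∈ T, (∀ i ∈ s', ∀ j ∈ s', c i p = c j p) ∨
        ∀ i ∈ s', ∀ j ∈ s', c i p = c j p → i = j := by
  classical
  induction T using Finset.induction_on generalizing n with
  | empty => exact ⟨n, fun c s hs => ⟨s, subset_rfl, hs, by simp⟩⟩
  | insert p T hp ih =>
    -- On `n * n` indices, a function takes some value `n` times or takes at least `n` values.
    obtain ⟨N, hN⟩ := ih (n * n)
    refine ⟨N, fun c s hs => ?_⟩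
    obtain ⟨s', h1, h2, h3⟩ := hN c s hs
    by_cases hf : ∃ g, n ≤ (s'.filter fun i => c i p = g).card
    · obtain ⟨g, hg⟩ := hf
      refine ⟨_, (Finset.filter_subset _ _).trans h1, hg, fun q hq => ?_⟩
      rcases Finset.mem_insert.1 hq with rfl | hq
      · left
        intro i hi j hj
        rw [(Finset.mem_filter.1 hi).2, (Finset.mem_filter.1 hj).2]
      · exact (h3 q hq).imp
          (fun h i hi j hj => h i (Finset.mem_filter.1 hi).1 j (Finset.mem_filter.1 hj).1)
          (fun h i hi j hj => h i (Finset.mem_filter.1 hi).1 j (Finset.mem_filter.1 hj).1)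
    · push Not at hf
      obtain ⟨t, ht, hinj, himg⟩ := Finset.exists_subset_injOn_image_eq_of_surjOn (s')
        (s'.image fun i => c i p) (f := fun i => c i p) (by simp [Set.surjOn_image])
      refine ⟨t, ht.trans h1, ?_, fun q hq => ?_⟩
      · have h4 := Finset.card_le_mul_card_image (f := fun i => c i p) s' n fun g _ => (hf g).le
        rw [← himg, Finset.card_image_of_injOn hinj] at h4
        rcases Nat.eq_zero_or_pos n with rfl | hn
        · exact Nat.zero_le _
        · exact Nat.le_of_mul_le_mul_left (h2.trans h4) hn
      · rcases Finset.mem_insert.1 hq with rfl | hq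
        · exact Or.inr fun i hi j hj h => hinj hi hj h
        · exact (h3 q hq).imp (fun h i hi j hj => h i (ht hi) j (ht hj))
            (fun h i hi j hj => h i (ht hi) j (ht hj))

theorem eq_of_three_props (P Q R : Prop) : P = Q ∨ P = R ∨ Q = R := by
  by_cases P <;> by_cases Q <;> by_cases R <;> simp_all

/-- If each of finitely many conditions excludes at most one element of a large set, some element
is not excluded. -/
theorem exists_not_excluded {ι ρ : Type*} [Fintype ρ] {s : Finset ι} (bad : ι → ρ → Prop)
    (hs : Fintype.card ρ < s.card)
    (h : ∀ r, ∀ i ∈ s, ∀ j ∈ s, bad i r → bad j r → i = j) : ∃ i ∈ s, ∀ r, ¬ bad i r := by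
  by_contra hne
  push Not at hne
  choose r hr using fun i : s => hne i i.2
  have := Fintype.card_le_of_injective r fun i j hij =>
    Subtype.ext (h (r i) i i.2 j j.2 (hr i) (by rw [hij]; exact hr j))
  rw [Fintype.card_coe] at this
  omega

/-- In two long sequences of tuples the same pattern of equalities occurs at some `i < j` and at
some `i' ≥ j'`. -/
theorem exists_same_pattern (κ ν Γ : Type*) [Finite κ] [Finite ν] :
    ∃ N, ∀ (a : Fin N → κ → Γ) (b : Fin N → ν → Γ), ∃ i j i' j', i < j ∧ j' ≤ i' ∧
      ∀ p q, Sum.elim (a i) (b j) p = Sum.elim (a i) (b j) q ↔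
        Sum.elim (a i') (b j') p = Sum.elim (a i') (b j') q := by
  classical
  have := Fintype.ofFinite κ
  have := Fintype.ofFinite ν
  -- Each pair of coordinates `(p, q)` will exclude at most one index, so `m` indices leave one that
  -- is not excluded. The size `m + m + 3` requested below gives two blocks of `m` indices, and at
  -- least three indices for the argument on propositions.
  set m := Fintype.card κ * Fintype.card ν + 1 with hm
  obtain ⟨N, hN⟩ := exists_const_or_injOn
    (Finset.univ : Finset ((κ ⊕ ν) ⊕ ((κ × κ) ⊕ (ν × ν)))) (Γ := Γ ⊕ Prop) (m + m + 3)
  refine ⟨N, fun a b => ?_⟩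
  by_cases hN0 : N = 0
  · subst hN0
    obtain ⟨s, hs, h1, -⟩ := hN (fun _ _ => Sum.inr True) ∅ (by simp)
    rw [Finset.subset_empty.1 hs] at h1
    simp at h1
  have hpos : 0 < N := Nat.pos_of_ne_zero hN0
  let f : ℕ → Fin N := fun i => if h : i < N then ⟨i, h⟩ else ⟨0, hpos⟩
  -- The columns are the coordinates of `a` and of `b`, together with the truth values of the
  -- equalities inside `a i` and inside `b i`.
  let c : ℕ → ((κ ⊕ ν) ⊕ ((κ × κ) ⊕ (ν × ν))) → Γ ⊕ Prop := fun i => Sum.elim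
    (fun p => Sum.inl (Sum.elim (a (f i)) (b (f i)) p))
    (Sum.elim (fun p => Sum.inr (a (f i) p.1 = a (f i) p.2))
      (fun p => Sum.inr (b (f i) p.1 = b (f i) p.2)))
  obtain ⟨s, hs, hcard, hc⟩ := hN c (Finset.range N) (by simp)
  have hsN : ∀ i ∈ s, i < N := fun i hi => Finset.mem_range.1 (hs hi)
  -- A column of truth values cannot be injective on three indices, so it is constant.
  have hprop : ∀ (q : (κ × κ) ⊕ (ν × ν)), ∀ i ∈ s, ∀ j ∈ s, c i (.inr q) = c j (.inr q) := by
    intro q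
    rcases hc (.inr q) (Finset.mem_univ _) with h | h
    · exact h
    · exfalso
      obtain ⟨x, y, z, hx, hy, hz, h1, h2, h3⟩ := Finset.two_lt_card_iff.1
        (show 2 < s.card by omega)
      obtain ⟨F, hF⟩ : ∃ F : ℕ → Prop, ∀ i, c i (.inr q) = Sum.inr (F i) := by
        rcases q with q | q
        exacts [⟨_, fun i => rfl⟩, ⟨_, fun i => rfl⟩]
      simp only [hF] at h
      rcases eq_of_three_props (F x) (F y) (F z) with h4 | h4 | h4
      · exact h1 (h x hx y hy (congrArg Sum.inr h4))
      · exact h2 (h x hx z hz (congrArg Sum.inr h4))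
      · exact h3 (h y hy z hz (congrArg Sum.inr h4))
  -- One can choose `i` and `j` such that the only equalities between `a i` and `b j` are between
  -- constant columns: first `i` avoids equalities of injective columns of `a` with the fixed tuple
  -- `b j₀`, then `j` avoids equalities of injective columns of `b` with `a i`. Equalities of
  -- constant columns hold for all pairs of indices, so the order of `i` and `j` is invisible.
  have hgen : ∀ s₁ ⊆ s, ∀ s₂ ⊆ s, m ≤ s₁.card → m ≤ s₂.card → ∃ i ∈ s₁, ∃ j ∈ s₂, ∀ p q,
      a (f i) p = b (f j) q → (∀ i ∈ s, ∀ j ∈ s, a (f i) p = a (f j) p) ∧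
        ∀ i ∈ s, ∀ j ∈ s, b (f i) q = b (f j) q := by
    intro s₁ hs₁ s₂ hs₂ c₁ c₂
    obtain ⟨j₀, hj₀⟩ : s₂.Nonempty := Finset.card_pos.1 (by omega)
    have hcp : Fintype.card (κ × ν) < m := by
      rw [Fintype.card_prod]
      exact Nat.lt_succ_self _
    have hA := exists_not_excluded (ρ := κ × ν) (s := s₁) (fun i r => (∀ i ∈ s, ∀ j ∈ s,
      a (f i) r.1 = a (f j) r.1 → i = j) ∧ a (f i) r.1 = b (f j₀) r.2) (hcp.trans_le c₁)
      fun r i hi j hj h h' => h.1 i (hs₁ hi) j (hs₁ hj) (h.2.trans h'.2.symm)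
    obtain ⟨i, hi, hi'⟩ := hA
    have hB := exists_not_excluded (ρ := κ × ν) (s := s₂) (fun j r => (∀ i ∈ s, ∀ j ∈ s,
      b (f i) r.2 = b (f j) r.2 → i = j) ∧ a (f i) r.1 = b (f j) r.2) (hcp.trans_le c₂)
      fun r j hj k hk h h' => h.1 j (hs₂ hj) k (hs₂ hk) (h.2.symm.trans h'.2)
    obtain ⟨j, hj, hj'⟩ := hB
    refine ⟨i, hi, j, hj, fun p q hpq => ?_⟩
    have d1 : ∀ i ∈ s, ∀ j ∈ s, b (f i) q = b (f j) q := by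
      rcases hc (.inl (.inr q)) (Finset.mem_univ _) with h | h
      · exact fun i hi j hj => Sum.inl_injective (h i hi j hj)
      · exact (hj' (p, q) ⟨fun i hi j hj e => h i hi j hj (congrArg Sum.inl e), hpq⟩).elim
    refine ⟨?_, d1⟩
    rcases hc (.inl (.inl p)) (Finset.mem_univ _) with h | h
    · exact fun i hi j hj => Sum.inl_injective (h i hi j hj)
    · exact (hi' (p, q) ⟨fun i hi j hj e => h i hi j hj (congrArg Sum.inl e),
        hpq.trans (d1 j (hs₂ hj) j₀ (hs₂ hj₀))⟩).elim
  obtain ⟨s₁, s₂, hs₁, hs₂, c₁, c₂, hlt⟩ : ∃ s₁ s₂ : Finset ℕ, s₁ ⊆ s ∧ s₂ ⊆ s ∧ m ≤ s₁.card ∧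
      m ≤ s₂.card ∧ ∀ i ∈ s₁, ∀ j ∈ s₂, i < j := by
    let g := s.orderEmbOfFin rfl
    have hg : ∀ x, g x ∈ s := s.orderEmbOfFin_mem rfl
    refine ⟨(Finset.univ.filter fun x : Fin s.card => x.1 < m).image g,
      (Finset.univ.filter fun x : Fin s.card => m ≤ x.1).image g, ?_, ?_, ?_, ?_, ?_⟩
    · exact Finset.image_subset_iff.2 fun x _ => hg x
    · exact Finset.image_subset_iff.2 fun x _ => hg x
    · rw [Finset.card_image_of_injective _ g.injective]
      have := Finset.card_le_card_of_injOn (s := (Finset.univ : Finset (Fin m)))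
        (t := Finset.univ.filter fun x : Fin s.card => x.1 < m)
        (fun x => ⟨x.1, by omega⟩) (by simp) (fun x _ y _ h => by simpa [Fin.ext_iff] using h)
      simpa using this
    · rw [Finset.card_image_of_injective _ g.injective]
      have := Finset.card_le_card_of_injOn (s := (Finset.univ : Finset (Fin m)))
        (t := Finset.univ.filter fun x : Fin s.card => m ≤ x.1)
        (fun x => ⟨m + x.1, by omega⟩) (by simp) (fun x _ y _ h => by simpa [Fin.ext_iff] using h)
      simpa using this
    · intro i hi j hj
      obtain ⟨x, hx, rfl⟩ := Finset.mem_image.1 hi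
      obtain ⟨y, hy, rfl⟩ := Finset.mem_image.1 hj
      exact g.strictMono (Fin.lt_def.2 ((Finset.mem_filter.1 hx).2.trans_le
        (Finset.mem_filter.1 hy).2))
  obtain ⟨i, hi, j, hj, h1⟩ := hgen s₁ hs₁ s₂ hs₂ c₁ c₂
  obtain ⟨i', hi', j', hj', h2⟩ := hgen s₂ hs₂ s₁ hs₁ c₂ c₁
  have fval : ∀ i ∈ s, (f i).1 = i := fun i hi => by simp [f, hsN i hi]
  refine ⟨f i, f j, f i', f j', ?_, ?_, ?_⟩
  · rw [Fin.lt_def, fval i (hs₁ hi), fval j (hs₂ hj)]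
    exact hlt i hi j hj
  · rw [Fin.le_def, fval i' (hs₂ hi'), fval j' (hs₁ hj')]
    exact (hlt j' hj' i' hi').le
  · have hmix : ∀ p q, a (f i) p = b (f j) q ↔ a (f i') p = b (f j') q := by
      intro p q
      constructor
      · intro h
        obtain ⟨e1, e2⟩ := h1 p q h
        rw [e1 i' (hs₂ hi') i (hs₁ hi), e2 j' (hs₁ hj') j (hs₂ hj), h]
      · intro h
        obtain ⟨e1, e2⟩ := h2 p q h
        rw [e1 i (hs₁ hi) i' (hs₂ hi'), e2 j (hs₂ hj) j' (hs₁ hj'), h]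
    rintro (p | p) (q | q)
    · exact iff_of_eq (Sum.inr_injective (hprop (.inl (p, q)) i (hs₁ hi) i' (hs₂ hi')))
    · exact hmix p q
    · exact eq_comm.trans ((hmix q p).trans eq_comm)
    · exact iff_of_eq (Sum.inr_injective (hprop (.inr (p, q)) j (hs₂ hj) j' (hs₁ hj')))

end Order

/-! ### The labels are stable and stably embedded -/

section Labels

variable {M : Type u} [coneLang.Structure M]

theorem isPoint_definable {A : Set M} {α : Type} (i : α) :
    A.Definable coneLang {v : α → M | IsPoint (v i)} := by
  have h : (∅ : Set M).Definable coneLang {v : α → M | IsPoint (v i)} := by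
    rw [Set.empty_definable_iff]
    exact ⟨pointF (Term.var (.inl i)), by ext w; simp [Formula.Realize]⟩
  exact h.mono (Set.empty_subset _)

theorem SupportedBy.comp {C : Set M} {α β : Type*} {X : Set (α → M)} (h : SupportedBy C X)
    (f : α → β) : SupportedBy C {w : β → M | (fun a => w (f a)) ∈ X} :=
  fun σ S hS h1 _ _ hv => h σ S hS h1 _ _ fun a => hv (f a)

/-- A partial isomorphism of closed sets extends to labels, following the permutation. -/
theorem Good.extend_labels (hM : IsConeTree M)
    {σ : {x : M // IsLabel x} ≃ {x : M // IsLabel x}} {S : Set (M × M)} (hS : Good σ S)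
    {α : Type*} [Finite α] {v v' : α → M} (hv : ∀ i, IsLabel (v i))
    (hσ : ∀ i, (σ ⟨v i, hv i⟩ : M) = v' i) : ∃ S', S ⊆ S' ∧ Good σ S' ∧ Matches S' v v' := by
  obtain ⟨v'', S', h1, h2, h3⟩ := hS.extend_tuple hM hM v
  refine ⟨S', h1, h2, fun i => ?_⟩
  have h4 := h2.label _ (h3 i) (hv i)
  rw [← hσ i, ← h4]
  exact h3 i

/-- Labels are indiscernible over `P` up to equality: the partial injection that fixes the labels of
`P` and sends `v` to `v'` extends to a permutation `σ`, and `σ` is compatible with the identity on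
`P`. -/
theorem SupportedBy.mem_iff_of_pattern (hM : IsConeTree M) {C P : Set M} (hCP : C ⊆ P)
    (hP : Closed P) {α : Type*} [Finite α] {X : Set (α → M)} (hX : SupportedBy C X)
    {v v' : α → M} (hv : ∀ i, IsLabel (v i)) (hv' : ∀ i, IsLabel (v' i))
    (h1 : ∀ i j, v i = v j ↔ v' i = v' j)
    (h2 : ∀ i, ∀ g ∈ P, IsLabel g → (v i = g ↔ v' i = g)) : v ∈ X ↔ v' ∈ X := by
  obtain ⟨σ, hσ⟩ := exists_perm_extend hM
    (F := (fun x : M => (x, x)) '' {x | x ∈ P ∧ IsLabel x} ∪ Set.range fun i => (v i, v' i))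
    (((hP.finite.subset fun x hx => hx.1).image _).union (Set.finite_range _))
    (by
      rintro q (⟨x, hx, rfl⟩ | ⟨i, rfl⟩)
      · exact ⟨hx.2, hx.2⟩
      · exact ⟨hv i, hv' i⟩)
    (by
      rintro q (⟨x, hx, rfl⟩ | ⟨i, rfl⟩) r (⟨y, hy, rfl⟩ | ⟨j, rfl⟩)
      · rfl
      · exact eq_comm.trans ((h2 j x hx.1 hx.2).trans eq_comm)
      · exact h2 i y hy.1 hy.2
      · exact h1 i j)
  obtain ⟨S, h3, h4, h5⟩ := (hP.good σ fun x hx hxP =>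
    hσ (x, x) (Or.inl ⟨x, ⟨hxP, hx⟩, rfl⟩) hx).extend_labels hM hv
      (fun i => hσ (v i, v' i) (Or.inr ⟨i, rfl⟩) (hv i))
  exact hX σ S h4 (fun c hc => h3 ⟨c, hCP hc, rfl⟩) v v' h5

/-- On the labels, no relation that is definable over at most one point has the order property. -/
theorem SupportedBy.exists_no_order (hM : IsConeTree M) {a : M} (ha : IsPoint a) {κ ν : Type}
    [Finite κ] [Finite ν] {X : Set (κ ⊕ ν → M)} (hX : SupportedBy {a} X) :
    ∃ N : ℕ, ∀ (x : Fin N → κ → M) (y : Fin N → ν → M), (∀ i k, IsLabel (x i k)) →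
      (∀ i k, IsLabel (y i k)) → ¬ ∀ i j, Sum.elim (x i) (y j) ∈ X ↔ i < j := by
  obtain ⟨N, hN⟩ := exists_same_pattern κ ν M
  refine ⟨N, fun x y hx hy h => ?_⟩
  obtain ⟨i, j, i', j', h1, h2, h3⟩ := hN x y
  have hlab : ∀ i j k, IsLabel (Sum.elim (x i) (y j) k) := by
    rintro i j (k | k)
    exacts [hx i k, hy j k]
  -- The closed set consists of one point and contains no label, so only equalities within the
  -- tuples matter.
  have h4 := hX.mem_iff_of_pattern hM subset_rfl (closed_singleton hM ha) (hlab i j)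
    (hlab i' j') h3 (by
      rintro k g rfl hg
      exact absurd ha hg)
  rw [h, h] at h4
  exact absurd (h4.1 h1) (not_lt.2 h2)

/-- A definable set of tuples of labels is definable over finitely many labels. -/
theorem SupportedBy.exists_labels (hM : IsConeTree M) {C : Set M} (hC : C.Finite) {α : Type}
    [Finite α] {X : Set (α → M)} (hX : SupportedBy C X) (hl : ∀ v ∈ X, ∀ i, IsLabel (v i)) :
    ∃ (N : ℕ) (g : Fin N → M) (Y : Set (α ⊕ Fin N → M)), (∀ k, IsLabel (g k)) ∧
      (∅ : Set M).Definable coneLang Y ∧ ∀ v, v ∈ X ↔ Sum.elim v g ∈ Y := by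
  obtain ⟨P, hCP, hP, -⟩ := exists_closed hM hC
  obtain ⟨N, g, hg⟩ : ∃ (N : ℕ) (g : Fin N → M), Set.range g = {x | x ∈ P ∧ IsLabel x} := by
    obtain ⟨N, g, -, hg⟩ := (hP.finite.subset fun x (hx : x ∈ P ∧ IsLabel x) => hx.1).fin_param
    exact ⟨N, g, hg⟩
  have hgP : ∀ k, g k ∈ P ∧ IsLabel (g k) := fun k => by
    have : g k ∈ Set.range g := ⟨k, rfl⟩
    rwa [hg] at this
  -- `X` is a union of patterns of equalities among the entries of a tuple and the labels `g` of the
  -- closed support; there are finitely many patterns.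
  let pat : (α ⊕ Fin N → M) → α → (α ⊕ Fin N) → Prop := fun w i j => w (.inl i) = w j
  let T : Set (α → (α ⊕ Fin N) → Prop) := {t | ∃ v ∈ X, pat (Sum.elim v g) = t}
  refine ⟨N, g, {w | (∀ i, IsLabel (w (.inl i))) ∧ ∃ t : T, ∀ i j, pat w i j ↔ t.1 i j},
    fun k => (hgP k).2, ?_, fun v => ?_⟩
  · refine definable_and (definable_forall_finite fun i => definable_not (isPoint_definable _))
      (definable_exists_finite fun t => definable_forall_finite fun i =>
        definable_forall_finite fun j => definable_iff (definable_eq _ _) (definable_const _))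
  · constructor
    · intro hv
      exact ⟨hl v hv, ⟨_, v, hv, rfl⟩, fun i j => Iff.rfl⟩
    · rintro ⟨h1, ⟨_, v', hv', rfl⟩, h2⟩
      refine (hX.mem_iff_of_pattern hM hCP hP h1 (hl v' hv') (fun i j => h2 i (.inl j)) ?_).2 hv'
      intro i x hx hxl
      obtain ⟨k, rfl⟩ : x ∈ Set.range g := by rw [hg]; exact ⟨hx, hxl⟩
      exact h2 i (.inr k)

/-- A definable set of imaginaries is stable and stably embedded if its elements are represented by
tuples of labels only, and each label is definable over one of its elements. -/
theorem mem_St_of_labels (hM : IsConeTree M) {a : M} (ha : IsPoint a) {B : Set M} (hB : B ⊆ {a})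
    (s : ImagSort coneLang M) (D : Set (Quotient s.E))
    (h1 : ∀ x ∈ reps s D, ∀ i, IsLabel (x i)) (h2 : B.Definable coneLang (reps s D))
    (h3 : ∀ g : M, IsLabel g → ∃ d ∈ D, EqDefinable {(⟨s, d⟩ : Imag coneLang M)}
      {x : Unit → M | x () = g}) {d : Quotient s.E} (hd : d ∈ D) :
    (⟨s, d⟩ : Imag coneLang M) ∈ St coneLang B := by
  refine ⟨D, hd, h2, ?_, ?_⟩
  · intro k Y hY hdef
    obtain ⟨C, -, hC, hsupp⟩ := exists_supportedBy hM hdef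
    obtain ⟨N, g, Z, hg, hZ, hYZ⟩ := hsupp.exists_labels hM hC (by
      rintro v hv ⟨i, j⟩
      exact h1 _ (hY _ hv i) j)
    have e1 : tupleReps s Y = {v | ∃ u : Fin N → M, (∀ k, u k = g k) ∧ Sum.elim v u ∈ Z} := by
      ext v
      rw [hYZ]
      constructor
      · exact fun h => ⟨g, fun _ => rfl, h⟩
      · rintro ⟨u, hu, h⟩
        rwa [← funext hu]
    rw [e1]
    refine eqDefinable_exists (P := fun v (u : Fin N → M) => (∀ k, u k = g k) ∧ Sum.elim v u ∈ Z)
      (eqDefinable_and (eqDefinable_forall_fin fun k => ?_) ?_)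
    -- Stable embeddedness requires parameters from `D`, so each label parameter is replaced by an
    -- element of `D` over which it is definable.
    · obtain ⟨d', hd', h⟩ := h3 (g k) (hg k)
      refine (eqDefinable_comp (P := fun x : Unit → M => x () = g k)
        (fun _ => (Sum.inr k : (Fin _ × Fin s.n) ⊕ Fin N)) h).mono ?_
      rintro _ rfl
      exact Or.inr ⟨d', hd', rfl⟩
    · refine EqDefinable.of_definable ?_
      convert hZ using 1
      ext w
      simp only [Set.mem_ofPred_eq]
      rw [show Sum.elim (fun a => w (.inl a)) (fun b => w (.inr b)) = w from
        Sum.elim_comp_inl_inr w]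
  · intro k l R hR
    have hsupp : SupportedBy {a} (tupleReps s R) := (supportedBy_of_definable hM hR).mono hB
    -- An ordered family in `D` would lift, through representatives, to an ordered family of label
    -- tuples.
    obtain ⟨N, hN⟩ := (hsupp.comp fun p : (Fin k ⊕ Fin l) × Fin s.n =>
      (Sum.map (fun i => (i, p.2)) (fun i => (i, p.2)) p.1 :
        (Fin k × Fin s.n) ⊕ (Fin l × Fin s.n))).exists_no_order hM ha
    refine ⟨N, ?_⟩
    rintro ⟨x, y, hx, hy, h⟩
    choose x' hx' using fun i j => Quotient.exists_rep (x i j)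
    choose y' hy' using fun i j => Quotient.exists_rep (y i j)
    refine hN (fun i p => x' i p.1 p.2) (fun i p => y' i p.1 p.2) ?_ ?_ fun i j => ?_
    · rintro i ⟨j, n⟩
      refine h1 _ ?_ n
      change Quotient.mk _ (x' i j) ∈ D
      rw [hx']
      exact hx i j
    · rintro i ⟨j, n⟩
      refine h1 _ ?_ n
      change Quotient.mk _ (y' i j) ∈ D
      rw [hy']
      exact hy i j
    · rw [← h i j, ← show (fun c : Fin k ⊕ Fin l => Quotient.mk s.E fun n =>
        Sum.elim (fun p : Fin k × Fin s.n => x' i p.1 p.2) (fun p => y' j p.1 p.2)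
          (Sum.map (fun i => (i, n)) (fun i => (i, n)) c)) = Sum.elim (x i) (y j) by
        funext c
        rcases c with c | c
        exacts [hx' i c, hy' j c] ]
      rfl

theorem mk_realSort_eq {x : Fin 1 → M} {g : M} :
    Quotient.mk (realSort coneLang).E x = Quotient.mk _ (fun _ => g) ↔ x 0 = g := by
  refine ⟨fun h => congrFun (Quotient.exact h) (0 : Fin 1), fun h => Quotient.sound ?_⟩
  exact funext fun i : Fin 1 => by rw [Subsingleton.elim i 0, h]

theorem eqDefinable_real {g : M} : EqDefinable {real coneLang g} {x : Unit → M | x () = g} := by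
  have h := eqDefinable_comp (P := fun x : Fin 1 → M => Quotient.mk (realSort coneLang).E x =
    Quotient.mk _ fun _ => g) (fun _ => ()) (eqDefinable_reps (Set.mem_singleton (real coneLang g)))
  simpa only [mk_realSort_eq] using h

theorem real_mem_St (hM : IsConeTree M) {a y : M} (ha : IsPoint a) (hy : IsLabel y) :
    real coneLang y ∈ St coneLang {a} := by
  have hrep : reps (realSort (L := coneLang)) {d | ∃ g : M, IsLabel g ∧
      d = Quotient.mk _ fun _ => g} = {x : Fin 1 → M | IsLabel (x 0)} := by
    ext (x : Fin 1 → M)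
    constructor
    · rintro ⟨g, hg, h⟩
      have h' := mk_realSort_eq.1 h
      subst h'
      exact hg
    · exact fun h => ⟨x 0, h, mk_realSort_eq.2 rfl⟩
  refine mem_St_of_labels hM ha subset_rfl (realSort (L := coneLang))
    {d | ∃ g : M, IsLabel g ∧ d = Quotient.mk _ fun _ => g} ?_ ?_ ?_ ⟨y, hy, rfl⟩
  · rw [hrep]
    intro x hx (i : Fin 1)
    rw [Subsingleton.elim i 0]
    exact hx
  · rw [hrep]
    exact definable_not (isPoint_definable (0 : Fin 1))
  · exact fun g hg => ⟨_, ⟨g, hg, rfl⟩, eqDefinable_real⟩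

end Labels

/-! ### Definability of the basic relations -/

section Definability

variable {M : Type u} [coneLang.Structure M] {A : Set M} {α : Type}

theorem le_definable (i j : α) : A.Definable coneLang {v : α → M | Le (v i) (v j)} := by
  have h : (∅ : Set M).Definable coneLang {v : α → M | Le (v i) (v j)} := by
    rw [Set.empty_definable_iff]
    exact ⟨leF (Term.var (.inl i)) (Term.var (.inl j)), by ext w; simp [Formula.Realize]⟩
  exact h.mono (Set.empty_subset _)

theorem lt_definable (i j : α) : A.Definable coneLang {v : α → M | Lt (v i) (v j)} :=
  definable_and (le_definable i j) (definable_not (definable_eq i j))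

theorem lab_definable (i j k : α) :
    A.Definable coneLang {v : α → M | Lab (v i) (v j) (v k)} := by
  have h : (∅ : Set M).Definable coneLang {v : α → M | Lab (v i) (v j) (v k)} := by
    rw [Set.empty_definable_iff]
    exact ⟨labF (Term.var (.inl i)) (Term.var (.inl j)) (Term.var (.inl k)),
      by ext w; simp [Formula.Realize]⟩
  exact h.mono (Set.empty_subset _)

theorem isMeet_definable (i j k : α) :
    A.Definable coneLang {v : α → M | IsMeet (v i) (v j) (v k)} :=
  definable_and (le_definable _ _) (definable_and (le_definable _ _)
    (definable_forall_one (P := fun (v : α → M) w => Le w (v j) → Le w (v k) → Le w (v i))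
      (definable_imp (le_definable _ _) (definable_imp (le_definable _ _) (le_definable _ _)))))

theorem definable_subst {L : FirstOrder.Language.{0, 0}} {M : Type u} [L.Structure M]
    {α β : Type*} [Finite β] {Z : Set (α ⊕ β → M)} (hZ : (∅ : Set M).Definable L Z) {C : Set M}
    (c : β → M) (hc : ∀ b, c b ∈ C) : C.Definable L {v | Sum.elim v c ∈ Z} := by
  obtain ⟨φ, rfl⟩ := Set.empty_definable_iff.1 hZ
  refine Set.definable_iff_exists_formula_sum.2
    ⟨φ.relabel (Sum.elim .inr fun b => .inl ⟨c b, hc b⟩), ?_⟩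
  ext v
  simp only [Set.mem_ofPred_eq, Formula.realize_relabel]
  apply iff_of_eq
  congr 1
  funext j
  rcases j with j | j <;> rfl

end Definability

/-! ### Composing and amalgamating partial isomorphisms -/

namespace Good

variable {M : Type u} [coneLang.Structure M]

theorem comp (hM : IsConeTree M) {σ τ : {x : M // IsLabel x} ≃ {x : M // IsLabel x}}
    {S T : Set (M × M)} (hS : Good σ S) (hT : Good τ T)
    (hne : ∃ a b c, IsPoint a ∧ (a, b) ∈ S ∧ (b, c) ∈ T) :
    Good (σ.trans τ) {q | ∃ b, (q.1, b) ∈ S ∧ (b, q.2) ∈ T} where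
  finite := by
    refine ((hS.finite.image Prod.fst).prod (hT.finite.image Prod.snd)).subset ?_
    rintro q ⟨b, h1, h2⟩
    exact ⟨⟨_, h1, rfl⟩, ⟨_, h2, rfl⟩⟩
  nonempty := by
    obtain ⟨a, b, c, h1, h2, h3⟩ := hne
    exact ⟨(a, c), ⟨b, h2, h3⟩, h1⟩
  point := by
    rintro q ⟨b, h1, h2⟩
    exact (hS.point _ h1).trans (hT.point _ h2)
  label := by
    rintro q ⟨b, h1, h2⟩ hx
    have h3 := hS.label _ h1 hx
    have hb : IsLabel b := fun hb => hx ((hS.point _ h1).2 hb)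
    rw [hT.label _ h2 hb, Equiv.trans_apply]
    congr 2
    exact Subtype.ext h3
  le := by
    rintro q ⟨b, h1, h2⟩ r ⟨b', h3, h4⟩
    exact (hS.le _ h1 _ h3).trans (hT.le _ h2 _ h4)
  meet := by
    rintro q ⟨b, h1, h2⟩ r ⟨b', h3, h4⟩ pq pr
    obtain ⟨⟨e, f⟩, i1, i2, i3⟩ := hS.meet _ h1 _ h3 pq pr
    obtain ⟨⟨f', g⟩, j1, j2, j3⟩ := hT.meet _ h2 _ h4 ((hS.point _ h1).1 pq)
      ((hS.point _ h3).1 pr)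
    have := hM.isMeet_unique i3 j2
    subst this
    exact ⟨(e, g), ⟨_, i1, j1⟩, i2, j3⟩
  lab := by
    rintro q ⟨b, h1, h2⟩ r ⟨b', h3, h4⟩ hlt
    obtain ⟨⟨e, f⟩, i1, i2, i3⟩ := hS.lab _ h1 _ h3 hlt
    obtain ⟨⟨f', g⟩, j1, j2, j3⟩ := hT.lab _ h2 _ h4 ((hS.lt_iff hM hM h1 h3).1 hlt)
    have := hM.lab_unique _ _ _ _ i3 j2
    subst this
    exact ⟨(e, g), ⟨_, i1, j1⟩, i2, j3⟩

/-- Two partial isomorphisms of finite sets in different cones at a point `w` can be combined. -/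
theorem union_branch (hM : IsConeTree M) {σ : {x : M // IsLabel x} ≃ {x : M // IsLabel x}}
    {S T : Set (M × M)} (hS : Good σ S) (hT : Good σ T) {w w' g g' k k' : M} (hg : (g, g') ∈ S)
    (hk : (k, k') ∈ S) (hgk : g ≠ k)
    (h1 : ∀ q ∈ S, IsPoint q.1 → Lab w q.1 g ∧ Lab w' q.2 g')
    (h2 : ∀ q ∈ T, IsPoint q.1 → Lab w q.1 k ∧ Lab w' q.2 k') :
    Good σ (insert (w, w') (S ∪ T)) := by
  have hgk' : g' ≠ k' := fun h => hgk ((hS.eq_iff hM hM hg hk).2 h)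
  obtain ⟨q₀, hq₀, hp₀⟩ := hS.nonempty
  have pw : IsPoint w := hM.isPoint_left (hM.lab_lt (h1 q₀ hq₀ hp₀).1).1
  have pw' : IsPoint w' := hM.isPoint_left (hM.lab_lt (h1 q₀ hq₀ hp₀).2).1
  have hpt : ∀ q ∈ S ∪ T, IsPoint q.1 ↔ IsPoint q.2 := by
    rintro q (hq | hq)
    exacts [hS.point q hq, hT.point q hq]
  have hlab : ∀ q ∈ S ∪ T, IsPoint q.1 → ∃ l ∈ S, Lab w q.1 l.1 ∧ Lab w' q.2 l.2 := by
    rintro q (hq | hq) hp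
    exacts [⟨_, hg, h1 q hq hp⟩, ⟨_, hk, h2 q hq hp⟩]
  have hw : ∀ q ∈ S ∪ T, IsPoint q.1 → Lt w q.1 ∧ Lt w' q.2 := by
    intro q hq hp
    obtain ⟨l, -, i1, i2⟩ := hlab q hq hp
    exact ⟨hM.lab_lt i1, hM.lab_lt i2⟩
  have hle1 : ∀ q ∈ S ∪ T, Le w q.1 ↔ Le w' q.2 := fun q hq =>
    ⟨fun h => (hw q hq (hM.isPoint_right h)).2.1,
      fun h => (hw q hq ((hpt q hq).2 (hM.isPoint_right h))).1.1⟩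
  have hle2 : ∀ q ∈ S ∪ T, ¬ Le q.1 w := fun q hq h =>
    hM.not_le_of_lt (hw q hq (hM.isPoint_left h)).1 h
  have hle2' : ∀ q ∈ S ∪ T, ¬ Le q.2 w' := fun q hq h =>
    hM.not_le_of_lt (hw q hq ((hpt q hq).2 (hM.isPoint_left h))).2 h
  have hmix : ∀ q ∈ S, ∀ r ∈ T, IsPoint q.1 → IsPoint r.1 →
      IsMeet w q.1 r.1 ∧ IsMeet w' q.2 r.2 := fun q hq r hr i1 i2 =>
    ⟨hM.meet_eq_of_lab_ne (h1 q hq i1).1 (h2 r hr i2).1 hgk,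
      hM.meet_eq_of_lab_ne (h1 q hq i1).2 (h2 r hr i2).2 hgk'⟩
  have n1 : ∀ q ∈ S, ∀ r ∈ T, ¬ Le q.1 r.1 ∧ ¬ Le r.1 q.1 := by
    intro q hq r hr
    constructor
    · intro h
      have i1 := hM.isPoint_left h
      exact hle2 q (Or.inl hq) ((hmix q hq r hr i1 (hM.isPoint_right h)).1.2.2 _
        (hM.refl _ i1) h)
    · intro h
      have i1 := hM.isPoint_left h
      exact hle2 r (Or.inr hr) ((hmix q hq r hr (hM.isPoint_right h) i1).1.2.2 _ h
        (hM.refl _ i1))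
  have n2 : ∀ q ∈ S, ∀ r ∈ T, ¬ Le q.2 r.2 ∧ ¬ Le r.2 q.2 := by
    intro q hq r hr
    constructor
    · intro h
      have i1 := hM.isPoint_left h
      exact hle2' q (Or.inl hq) ((hmix q hq r hr ((hS.point q hq).2 i1)
        ((hT.point r hr).2 (hM.isPoint_right h))).2.2.2 _ (hM.refl _ i1) h)
    · intro h
      have i1 := hM.isPoint_left h
      exact hle2' r (Or.inr hr) ((hmix q hq r hr ((hS.point q hq).2 (hM.isPoint_right h))
        ((hT.point r hr).2 i1)).2.2.2 _ h (hM.refl _ i1))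
  refine ⟨(hS.finite.union hT.finite).insert _, ⟨_, Or.inl rfl, pw⟩, ?_, ?_, ?_, ?_, ?_⟩
  · rintro q (rfl | hq)
    · exact iff_of_true pw pw'
    · exact hpt q hq
  · rintro q (rfl | hq | hq) hx
    · exact absurd pw hx
    · exact hS.label q hq hx
    · exact hT.label q hq hx
  · rintro q (rfl | hq) r (rfl | hr)
    · exact iff_of_true (hM.refl _ pw) (hM.refl _ pw')
    · exact hle1 r hr
    · exact iff_of_false (hle2 q hq) (hle2' q hq)
    · rcases hq with hq | hq <;> rcases hr with hr | hr
      · exact hS.le q hq r hr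
      · exact iff_of_false (n1 q hq r hr).1 (n2 q hq r hr).1
      · exact iff_of_false (n1 r hr q hq).2 (n2 r hr q hq).2
      · exact hT.le q hq r hr
  · rintro q (rfl | hq) r (rfl | hr) i1 i2
    · exact ⟨_, Or.inl rfl, hM.isMeet_of_le (hM.refl _ pw), hM.isMeet_of_le (hM.refl _ pw')⟩
    · exact ⟨_, Or.inl rfl, hM.isMeet_of_le (hw r hr i2).1.1, hM.isMeet_of_le (hw r hr i2).2.1⟩
    · exact ⟨_, Or.inl rfl, (hM.isMeet_of_le (hw q hq i1).1.1).symm,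
        (hM.isMeet_of_le (hw q hq i1).2.1).symm⟩
    · rcases hq with hq | hq <;> rcases hr with hr | hr
      · obtain ⟨e, he, h⟩ := hS.meet q hq r hr i1 i2
        exact ⟨e, Or.inr (Or.inl he), h⟩
      · exact ⟨_, Or.inl rfl, hmix q hq r hr i1 i2⟩
      · have := hmix r hr q hq i2 i1
        exact ⟨_, Or.inl rfl, this.1.symm, this.2.symm⟩
      · obtain ⟨e, he, h⟩ := hT.meet q hq r hr i1 i2
        exact ⟨e, Or.inr (Or.inr he), h⟩
  · rintro q (rfl | hq) r (rfl | hr) i1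
    · exact i1.irrefl.elim
    · obtain ⟨l, hl, h⟩ := hlab r hr (hM.isPoint_right i1.1)
      exact ⟨l, Or.inr (Or.inl hl), h⟩
    · exact absurd i1.1 (hle2 q hq)
    · rcases hq with hq | hq <;> rcases hr with hr | hr
      · obtain ⟨e, he, h⟩ := hS.lab q hq r hr i1
        exact ⟨e, Or.inr (Or.inl he), h⟩
      · exact absurd i1.1 (n1 q hq r hr).1
      · exact absurd i1.1 (n1 r hr q hq).2
      · obtain ⟨e, he, h⟩ := hT.lab q hq r hr i1
        exact ⟨e, Or.inr (Or.inr he), h⟩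

end Good

/-! ### Copies of a configuration with the same labels, and branching -/

section Copies

variable {M : Type u} [coneLang.Structure M] {ι : Type}

/-- The tuple `v` is a copy of the tuple `u` with the same labels. -/
def Copy (u v : ι → M) : Prop := Good (Equiv.refl _) (Set.range fun i => (u i, v i))

theorem Copy.symm (hM : IsConeTree M) {u v : ι → M} (h : Copy u v) : Copy v u := by
  have := Good.symm hM hM h
  rwa [← Set.range_comp] at this

theorem Copy.trans (hM : IsConeTree M) {u v w : ι → M} (h : Copy u v) (h' : Copy v w) :
    Copy u w := by
  have hne : ∃ i, IsPoint (u i) := by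
    obtain ⟨_, ⟨i, rfl⟩, hp⟩ := h.nonempty
    exact ⟨i, hp⟩
  obtain ⟨i, hi⟩ := hne
  have := Good.comp hM h h' ⟨_, _, _, hi, ⟨i, rfl⟩, ⟨i, rfl⟩⟩
  rw [Equiv.trans_refl] at this
  suffices e : (Set.range fun i => (u i, w i)) = {q : M × M |
      ∃ b, (q.1, b) ∈ (Set.range fun i => (u i, v i)) ∧
        (b, q.2) ∈ Set.range fun i => (v i, w i)} by
    rw [Copy, e]
    exact this
  ext ⟨a, c⟩
  constructor
  · rintro ⟨i, hi⟩
    simp only [Prod.mk.injEq] at hi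
    obtain ⟨rfl, rfl⟩ := hi
    exact ⟨_, ⟨i, rfl⟩, ⟨i, rfl⟩⟩
  · rintro ⟨b, ⟨i, hi⟩, ⟨j, hj⟩⟩
    simp only [Prod.mk.injEq] at hi hj
    obtain ⟨rfl, hi⟩ := hi
    obtain ⟨hj, rfl⟩ := hj
    have := (Good.eq_iff hM hM h ⟨i, rfl⟩ ⟨j, rfl⟩).2 (hi.trans hj.symm)
    exact ⟨j, Prod.ext this.symm rfl⟩

theorem Good.copy (hM : IsConeTree M) {S : Set (M × M)} (hS : Good (Equiv.refl _) S)
    {u v : ι → M} (hu : Copy u u) (hm : Matches S u v) : Copy u v where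
  finite := hS.finite.subset (by
    rintro _ ⟨i, rfl⟩
    exact hm i)
  nonempty := by
    obtain ⟨_, ⟨i, rfl⟩, hp⟩ := hu.nonempty
    exact ⟨_, ⟨i, rfl⟩, hp⟩
  point := by
    rintro _ ⟨i, rfl⟩
    exact hS.point _ (hm i)
  label := by
    rintro _ ⟨i, rfl⟩
    exact hS.label _ (hm i)
  le := by
    rintro _ ⟨i, rfl⟩ _ ⟨j, rfl⟩
    exact hS.le _ (hm i) _ (hm j)
  meet := by
    rintro _ ⟨i, rfl⟩ _ ⟨j, rfl⟩ h1 h2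
    obtain ⟨_, ⟨k, rfl⟩, h3, -⟩ := hu.meet _ ⟨i, rfl⟩ _ ⟨j, rfl⟩ h1 h2
    exact ⟨_, ⟨k, rfl⟩, h3, hS.isMeet_map hM hM (hm i) (hm j) (hm k) h3⟩
  lab := by
    rintro _ ⟨i, rfl⟩ _ ⟨j, rfl⟩ h1
    obtain ⟨_, ⟨k, rfl⟩, h3, -⟩ := hu.lab _ ⟨i, rfl⟩ _ ⟨j, rfl⟩ h1
    exact ⟨_, ⟨k, rfl⟩, h3, (hS.lab_iff hM hM (hm i) (hm j) (hm k)).1 h3⟩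

theorem copy_definable [Finite ι] {A : Set M} :
    A.Definable coneLang {w : ι ⊕ ι → M | Copy (fun i => w (.inl i)) fun i => w (.inr i)} := by
  have key : ∀ u v : ι → M, Copy u v ↔ (∃ i, IsPoint (u i)) ∧
      (∀ i, IsPoint (u i) ↔ IsPoint (v i)) ∧ (∀ i, ¬ IsPoint (u i) → v i = u i) ∧
      (∀ i j, Le (u i) (u j) ↔ Le (v i) (v j)) ∧
      (∀ i j, IsPoint (u i) → IsPoint (u j) →
        ∃ k, IsMeet (u k) (u i) (u j) ∧ IsMeet (v k) (v i) (v j)) ∧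
      ∀ i j, Lt (u i) (u j) → ∃ k, Lab (u i) (u j) (u k) ∧ Lab (v i) (v j) (v k) := by
    intro u v
    constructor
    · intro h
      refine ⟨?_, fun i => h.point _ ⟨i, rfl⟩, fun i hi => h.label _ ⟨i, rfl⟩ hi,
        fun i j => h.le _ ⟨i, rfl⟩ _ ⟨j, rfl⟩, fun i j h1 h2 => ?_, fun i j h1 => ?_⟩
      · obtain ⟨_, ⟨i, rfl⟩, hp⟩ := h.nonempty
        exact ⟨i, hp⟩
      · obtain ⟨_, ⟨k, rfl⟩, h3⟩ := h.meet _ ⟨i, rfl⟩ _ ⟨j, rfl⟩ h1 h2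
        exact ⟨k, h3⟩
      · obtain ⟨_, ⟨k, rfl⟩, h3⟩ := h.lab _ ⟨i, rfl⟩ _ ⟨j, rfl⟩ h1
        exact ⟨k, h3⟩
    · rintro ⟨⟨i, h1⟩, h2, h3, h4, h5, h6⟩
      refine ⟨Set.finite_range _, ⟨_, ⟨i, rfl⟩, h1⟩, ?_, ?_, ?_, ?_, ?_⟩
      · rintro _ ⟨i, rfl⟩
        exact h2 i
      · rintro _ ⟨i, rfl⟩ hx
        exact h3 i hx
      · rintro _ ⟨i, rfl⟩ _ ⟨j, rfl⟩
        exact h4 i j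
      · rintro _ ⟨i, rfl⟩ _ ⟨j, rfl⟩ i1 i2
        obtain ⟨k, h⟩ := h5 i j i1 i2
        exact ⟨_, ⟨k, rfl⟩, h⟩
      · rintro _ ⟨i, rfl⟩ _ ⟨j, rfl⟩ i1
        obtain ⟨k, h⟩ := h6 i j i1
        exact ⟨_, ⟨k, rfl⟩, h⟩
  simp only [key]
  refine definable_and (definable_exists_finite fun i => isPoint_definable _)
    (definable_and (definable_forall_finite fun i => definable_iff (isPoint_definable _)
      (isPoint_definable _)) (definable_and (definable_forall_finite fun i =>
        definable_imp (definable_not (isPoint_definable _)) (definable_eq _ _))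
      (definable_and (definable_forall_finite fun i => definable_forall_finite fun j =>
        definable_iff (le_definable _ _) (le_definable _ _)) (definable_and
      (definable_forall_finite fun i => definable_forall_finite fun j =>
        definable_imp (isPoint_definable _) (definable_imp (isPoint_definable _)
          (definable_exists_finite fun k => definable_and (isMeet_definable _ _ _)
            (isMeet_definable _ _ _))))
      (definable_forall_finite fun i => definable_forall_finite fun j =>
        definable_imp (lt_definable _ _) (definable_exists_finite fun k =>
          definable_and (lab_definable _ _ _) (lab_definable _ _ _)))))))

/-- The tuples `u` and `v`, with roots `u r` and `v r`, are copies of each other in the cones with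
the labels `u i` and `v j` at a common point. -/
def Branch (r i j : ι) (u v : ι → M) : Prop :=
  Copy u v ∧ ∃ w, Lab w (u r) (u i) ∧ Lab w (v r) (v j)

theorem branch_definable [Finite ι] {A : Set M} (r i j : ι) :
    A.Definable coneLang {w : ι ⊕ ι → M |
      Branch r i j (fun i => w (.inl i)) fun i => w (.inr i)} :=
  definable_and copy_definable (definable_exists_one
    (P := fun (v : ι ⊕ ι → M) w => Lab w (v (.inl r)) (v (.inl i)) ∧
      Lab w (v (.inr r)) (v (.inr j)))
    (definable_and (lab_definable _ _ _) (lab_definable _ _ _)))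

/-- `p` enumerates a closed set with the root `p r` and two different labels `p i` and `p j`. -/
structure IsFrame (r i j : ι) (p : ι → M) : Prop where
  copy : Copy p p
  root : IsPoint (p r)
  le : ∀ k, IsPoint (p k) → Le (p r) (p k)
  label₁ : IsLabel (p i)
  label₂ : IsLabel (p j)
  ne : p i ≠ p j

namespace IsFrame

variable {r i j : ι} {p u v w : ι → M}

theorem of_copy (hM : IsConeTree M) (hp : IsFrame r i j p) (h : Copy p u) : IsFrame r i j u where
  copy := (h.symm hM).trans hM h
  root := (h.point _ ⟨r, rfl⟩).1 hp.root
  le k hk := (h.le _ ⟨r, rfl⟩ _ ⟨k, rfl⟩).1 (hp.le k ((h.point _ ⟨k, rfl⟩).2 hk))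
  label₁ := fun h1 => hp.label₁ ((h.point _ ⟨i, rfl⟩).2 h1)
  label₂ := fun h1 => hp.label₂ ((h.point _ ⟨j, rfl⟩).2 h1)
  ne := fun h1 => hp.ne ((h.eq_iff hM hM ⟨i, rfl⟩ ⟨j, rfl⟩).2 h1)

theorem label_eq₁ (hp : IsFrame r i j p) (h : Copy p u) : u i = p i :=
  h.label _ ⟨i, rfl⟩ hp.label₁

theorem label_eq₂ (hp : IsFrame r i j p) (h : Copy p u) : u j = p j :=
  h.label _ ⟨j, rfl⟩ hp.label₂

/-- Genericity gives `w` below `x` where `x` has label `p i`, and back-and-forth over the identity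
of labels builds a copy in the cone labelled `p j`. The point `x` is free: it will be the root of
one copy, and the meet of the roots of two copies. -/
theorem exists_branch [Finite ι] (hM : IsConeTree M) (hp : IsFrame r i j p) {x : M}
    (hx : IsPoint x) : ∃ w v, Copy p v ∧ Lab w x (p i) ∧ Lab w (v r) (p j) := by
  obtain ⟨y, hy⟩ := hM.no_min x hx
  obtain ⟨w, -, h1, h2⟩ := hM.generic y x (p i) hy hp.label₁
  obtain ⟨r', hr'⟩ := hM.lab_surj w (p j) (hM.isPoint_left h1.1) hp.label₂
  obtain ⟨v, S, h3, h4, h5⟩ := (Good.single hM hM (Equiv.refl _) hp.root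
    (hM.isPoint_right (hM.lab_lt hr').1)).extend_tuple hM hM p
  refine ⟨w, v, h4.copy hM hp.copy h5, h2, ?_⟩
  have e : v r = r' := (h4.eq_iff hM hM (h5 r) (h3 rfl)).1 rfl
  rw [e]
  exact hr'

/-- Both branching points lie below the root of `v`, so they are comparable, and the lower one
separates `u` from `w`. They cannot coincide, since `v` leaves one by the label with index `j` and
the other by the different label with index `i`. -/
theorem branch_trans (hM : IsConeTree M) (hp : IsFrame r i j u) (h : Branch r i j u v)
    (h' : Branch r i j v w) : Branch r i j u w := by
  obtain ⟨c1, x, h1, h2⟩ := h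
  obtain ⟨c2, y, h3, h4⟩ := h'
  have c3 := c1.trans hM c2
  refine ⟨c3, ?_⟩
  rw [hp.label_eq₂ c1] at h2
  rw [hp.label_eq₁ c1] at h3
  rw [hp.label_eq₂ c3] at h4 ⊢
  rcases hM.lt_or_le (hM.lab_lt h2).1 (hM.lab_lt h3).1 with h5 | h5
  · exact ⟨x, h1, hM.lab_mono (hM.lab_anti h2 h5 (hM.lab_lt h3).1) (hM.lab_lt h4).1⟩
  · by_cases h6 : y = x
    · subst h6
      exact absurd (hM.lab_unique _ _ _ _ h3 h2) hp.ne
    · exact ⟨y, hM.lab_mono (hM.lab_anti h3 ⟨h5, h6⟩ (hM.lab_lt h2).1) (hM.lab_lt h1).1, h4⟩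

/-- All branching pairs of copies are conjugate over the labels: the two halves lie in different
cones at the branching point, so their isomorphisms can be combined. -/
theorem branch_good (hM : IsConeTree M) (hp : IsFrame r i j u) {u' v' : ι → M}
    (hu : Copy u u') (h : Branch r i j u v) (h' : Branch r i j u' v') :
    ∃ S, Good (Equiv.refl _) S ∧ Matches S u u' ∧ Matches S v v' := by
  obtain ⟨c1, x, h1, h2⟩ := h
  obtain ⟨c2, x', h3, h4⟩ := h'
  have hv := hp.of_copy hM c1
  have hu' := hp.of_copy hM hu
  have hv' := hu'.of_copy hM c2
  have c3 : Copy v v' := (c1.symm hM).trans hM (hu.trans hM c2)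
  refine ⟨_, Good.union_branch hM (w := x) (w' := x') hu c3 ⟨i, rfl⟩ ⟨j, rfl⟩ hp.ne ?_ ?_,
    fun k => Or.inr (Or.inl ⟨k, rfl⟩), fun k => Or.inr (Or.inr ⟨k, rfl⟩)⟩
  · rintro _ ⟨k, rfl⟩ hk
    exact ⟨hM.lab_mono h1 (hp.le k hk),
      hM.lab_mono h3 (hu'.le k ((hu.point _ ⟨k, rfl⟩).1 hk))⟩
  · rintro _ ⟨k, rfl⟩ hk
    rw [hp.label_eq₂ c1] at h2
    rw [hu'.label_eq₂ c2] at h4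
    exact ⟨hM.lab_mono h2 (hv.le k hk),
      hM.lab_mono h4 (hv'.le k ((c3.point _ ⟨k, rfl⟩).1 hk))⟩

end IsFrame

/-- Each partial isomorphism `S` that fixes the labels, with a tuple in its domain, restricts to
copies of frames. -/
theorem exists_frame (hM : IsConeTree M) {S : Set (M × M)} (hS : Good (Equiv.refl _) S) {n : ℕ}
    {t t' : Fin n → M} (ht : Matches S t t') : ∃ (q : ℕ) (r i j : Fin q) (p p' : Fin q → M)
      (f : Fin n → Fin q), IsFrame r i j p ∧ Copy p p' ∧ (∀ k, p (f k) = t k) ∧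
        ∀ k, p' (f k) = t' k := by
  -- Two different labels are adjoined to the domain because `Branch` needs them to tell its two
  -- cones apart.
  obtain ⟨g₁, hg₁, -⟩ := hM.exists_isLabel_notMem Set.finite_empty
  obtain ⟨g₂, hg₂, hne⟩ := hM.exists_isLabel_notMem (Set.finite_singleton g₁)
  have h1 := (hS.insert_label hM hM hg₁).insert_label hM hM hg₂
  set T := insert (g₂, ((Equiv.refl {x : M // IsLabel x}) ⟨g₂, hg₂⟩ : M))
    (insert (g₁, ((Equiv.refl {x : M // IsLabel x}) ⟨g₁, hg₁⟩ : M)) S) with hT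
  have hP := h1.closed_fst
  obtain ⟨x, hx, px, hroot⟩ := hP.exists_root hM
  obtain ⟨q, p, -, hp⟩ := hP.finite.fin_param
  have hmem : ∀ y ∈ Prod.fst '' T, ∃ k, p k = y := fun y hy => by
    rw [← hp] at hy
    exact hy
  obtain ⟨r, rfl⟩ := hmem x hx
  obtain ⟨i, hi⟩ := hmem g₁ ⟨_, Or.inr (Or.inl rfl), rfl⟩
  obtain ⟨j, hj⟩ := hmem g₂ ⟨_, Or.inl rfl, rfl⟩
  choose f hf using fun k => hmem (t k) ⟨_, Or.inr (Or.inr (ht k)), rfl⟩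
  have hp' : ∀ k, ∃ y, (p k, y) ∈ T := fun k => by
    obtain ⟨⟨a, b⟩, h2, h3⟩ : p k ∈ Prod.fst '' T := by
      rw [← hp]
      exact ⟨k, rfl⟩
    exact ⟨b, h3 ▸ h2⟩
  choose p' hp' using hp'
  have hcopy : Copy p p := by
    have : (Set.range fun k => (p k, p k)) = (fun x => (x, x)) '' (Prod.fst '' T) := by
      rw [← hp, ← Set.range_comp]
      rfl
    rw [Copy, this]
    exact hP
  refine ⟨q, r, i, j, p, p', f, ⟨hcopy, px, fun k hk => hroot _ ?_ hk, hi ▸ hg₁, hj ▸ hg₂, ?_⟩,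
    h1.copy hM hcopy hp', hf, fun k => ?_⟩
  · rw [← hp]
    exact ⟨k, rfl⟩
  · rw [hi, hj]
    exact fun h => hne h.symm
  · exact (h1.eq_iff hM hM (hp' (f k)) (Or.inr (Or.inr (ht k)))).1 (hf k)

end Copies

/-! ### Elements of St_∅ depend on labels only -/

section Stable

variable {M : Type u} [coneLang.Structure M]

theorem setoid_iff_of_good (hM : IsConeTree M) (s : ImagSort coneLang M)
    {σ : {x : M // IsLabel x} ≃ {x : M // IsLabel x}} {S : Set (M × M)} (hS : Good σ S)
    {x x' y y' : Fin s.n → M} (hx : Matches S x x') (hy : Matches S y y') :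
    Quotient.mk s.E x = Quotient.mk s.E y ↔ Quotient.mk s.E x' = Quotient.mk s.E y' := by
  rw [Quotient.eq, Quotient.eq]
  exact supportedBy_of_definable hM s.definable σ S hS (fun c hc => hc.elim)
    (Sum.elim x y) (Sum.elim x' y') (hx.elim hy)

theorem definable_reps {L : FirstOrder.Language.{0, 0}} {M : Type u} [L.Structure M]
    {s : ImagSort L M} {D : Set (Quotient s.E)} {A : Set M} (h : (∅ : Set M).Definable L (reps s D))
    {α : Type} (f : Fin s.n → α) :
    A.Definable L {v : α → M | (fun i => v (f i)) ∈ reps s D} :=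
  (h.preimage_comp f).mono (Set.empty_subset _)

namespace IsFrame

variable {q : ℕ} {r i j : Fin q} {p : Fin q → M}

/-- An infinite comb: each copy branches off below the root of the preceding one, and transitivity
orders all the copies. -/
theorem exists_chain (hM : IsConeTree M) (hp : IsFrame r i j p) : ∃ u : ℕ → Fin q → M,
    (∀ m, Copy p (u m)) ∧ ∀ m n, m < n → Branch r i j (u m) (u n) := by
  have step : ∀ x : {x // Copy p x}, ∃ y : {x // Copy p x}, Branch r i j x.1 y.1 := by
    intro x
    have hx := hp.of_copy hM x.2
    obtain ⟨w, v, h1, h2, h3⟩ := hx.exists_branch hM hx.root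
    exact ⟨⟨v, x.2.trans hM h1⟩, h1, w, h2, by
      change Lab w (v r) (v j)
      rwa [hx.label_eq₂ h1]⟩
  choose F hF using step
  let U : ℕ → {x // Copy p x} := fun m => Nat.rec ⟨p, hp.copy⟩ (fun _ x => F x) m
  refine ⟨fun m => (U m).1, fun m => (U m).2, fun m n h => ?_⟩
  induction n, h using Nat.le_induction with
  | base => exact hF (U m)
  | succ n _ ih => exact (hp.of_copy hM (U m).2).branch_trans hM ih (hF (U n))

/-- Stability applied to the comb. The classes of the copies that branch into a given copy form a
subset of `D`, which stable embeddedness defines over a tuple `δ` from `D`. Were no branching pair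
to share a class, the classes along the comb and the tuples `δ` would have the order property. -/
theorem exists_branch_setoid (hM : IsConeTree M) (hp : IsFrame r i j p) (s : ImagSort coneLang M)
    (f : Fin s.n → Fin q) {D : Set (Quotient s.E)} (hpD : p ∘ f ∈ reps s D)
    (hD : (∅ : Set M).Definable coneLang (reps s D)) (hemb : IsStablyEmbedded ∅ s D)
    (hstab : IsStable ∅ s D) : ∃ x y, Copy p x ∧ Branch r i j x y ∧
      Quotient.mk s.E (x ∘ f) = Quotient.mk s.E (y ∘ f) := by
  let Y : Set (Fin 1 → Quotient s.E) :=
    {c | c 0 ∈ D ∧ ∃ u, Branch r i j u p ∧ Quotient.mk s.E (u ∘ f) = c 0}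
  have hY : (Set.univ : Set M).Definable coneLang (tupleReps s Y) := by
    have h1 : (∅ : Set M).Definable coneLang {v : (Fin 1 × Fin s.n) ⊕ Fin q → M |
        (fun n => v (.inl (0, n))) ∈ reps s D ∧ ∃ u : Fin q → M,
          Branch r i j u (fun k => v (.inr k)) ∧
            s.E.r (fun n => u (f n)) (fun n => v (.inl (0, n)))} := by
      refine definable_and (definable_reps hD _) (definable_exists
        (P := fun (v : (Fin 1 × Fin s.n) ⊕ Fin q → M) u => Branch r i j u (fun k => v (.inr k)) ∧
            s.E.r (fun n => u (f n)) (fun n => v (.inl (0, n)))) (definable_and ?_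
              (definable_setoid s _ _)))
      exact (branch_definable (A := ∅) r i j).preimage_comp
        (Sum.elim Sum.inr fun k => Sum.inl (Sum.inr k))
    convert definable_subst h1 (C := Set.univ) p (fun _ => trivial) using 1
    ext v
    refine and_congr Iff.rfl (exists_congr fun u => and_congr Iff.rfl ?_)
    exact Quotient.eq
  obtain ⟨k, e, Z, he, hZ, h⟩ := (hemb 1 Y (by
    intro y hy i
    rw [Subsingleton.elim i 0]
    exact hy.1) hY).exists_normal
  have he' : ∀ i, ∃ d ∈ D, e i = ⟨s, d⟩ := by
    intro i
    rcases he i with h' | h'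
    · simp at h'
    · exact h'
  choose d hd hed using he'
  obtain rfl : e = fun i => ⟨s, d i⟩ := funext hed
  let g : (Fin 1 × Fin s.n) ⊕ (Σ _ : Fin k, Fin s.n) → (Fin 1 ⊕ Fin k) × Fin s.n :=
    Sum.elim (fun c => (.inl c.1, c.2)) fun c => (.inr c.1, c.2)
  -- The definition of `Y` over the parameters `d`, turned into an ∅-definable relation on elements
  -- of `D`.
  let R : Set (Fin 1 ⊕ Fin k → Quotient s.E) :=
    {c | ∃ w : (Fin 1 ⊕ Fin k) × Fin s.n → M, (∀ i, Quotient.mk s.E (fun n => w (i, n)) = c i) ∧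
      w ∘ g ∈ Z}
  have hR : (∅ : Set M).Definable coneLang (tupleReps s R) := by
    have h1 := definable_exists (P := fun (v w : (Fin 1 ⊕ Fin k) × Fin s.n → M) =>
      (∀ i, s.E.r (fun n => w (i, n)) fun n => v (i, n)) ∧ w ∘ g ∈ Z) (A := ∅) (L := coneLang)
      (definable_and (definable_forall_finite fun i => definable_setoid s _ _)
        (hZ.preimage_comp fun c => (Sum.inr (g c) :
          ((Fin 1 ⊕ Fin k) × Fin s.n) ⊕ ((Fin 1 ⊕ Fin k) × Fin s.n))))
    convert h1 using 1
    ext v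
    refine exists_congr fun w => and_congr (forall_congr' fun i => ?_) Iff.rfl
    exact Quotient.eq
  have hRd : ∀ c : Quotient s.E, Sum.elim (fun _ => c) d ∈ R ↔
      c ∈ D ∧ ∃ u, Branch r i j u p ∧ Quotient.mk s.E (u ∘ f) = c := by
    intro c
    have key : ∀ w : (Fin 1 ⊕ Fin k) × Fin s.n → M,
        (∀ i, Quotient.mk s.E (fun n => w (i, n)) = Sum.elim (fun _ => c) d i) →
        (w ∘ g ∈ Z ↔ c ∈ D ∧ ∃ u, Branch r i j u p ∧ Quotient.mk s.E (u ∘ f) = c) := by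
      intro w hw
      have h1 := h (fun c => w (.inr c.1, c.2)) (fun i => hw (.inr i))
        (fun c => w (.inl c.1, c.2))
      have h2 : w ∘ g = Sum.elim (fun c => w (.inl c.1, c.2)) (fun c => w (.inr c.1, c.2)) := by
        funext c
        rcases c with c | c <;> rfl
      rw [h2, ← h1]
      change (fun i : Fin 1 => Quotient.mk s.E (fun n => w (.inl i, n))) ∈ Y ↔ _
      rw [show (fun i : Fin 1 => Quotient.mk s.E (fun n => w (.inl i, n))) = fun _ => c from
        funext fun i => hw (.inl i)]
      rfl
    constructor
    · rintro ⟨w, hw, h1⟩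
      exact (key w hw).1 h1
    · intro h1
      choose w hw using fun i => Quotient.exists_rep (Sum.elim (fun _ : Fin 1 => c) d i)
      exact ⟨fun c => w c.1 c.2, hw, (key (fun c => w c.1 c.2) hw).2 h1⟩
  -- That some tuple from `D` defines the same kind of set through `R` is an ∅-definable property of
  -- the copy. It holds at `p`, hence at all copies of `p`, and so provides a tuple `δ m` for every
  -- copy `u m` in the comb.
  let χ : Set (Fin q → M) := {x | ∃ z : Fin k × Fin s.n → M,
    (∀ i, (fun n => z (i, n)) ∈ reps s D) ∧ ∀ v : Fin s.n → M, v ∈ reps s D →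
      ((fun c => Sum.elim (fun n : Fin 1 × Fin s.n => v n.2) z
        (match c with | (.inl a, n) => .inl (a, n) | (.inr a, n) => .inr (a, n))) ∈ tupleReps s R ↔
        ∃ u, Branch r i j u x ∧ s.E.r (fun n => u (f n)) v)}
  have hχ : (∅ : Set M).Definable coneLang χ := by
    refine definable_exists (P := fun (x : Fin q → M) (z : Fin k × Fin s.n → M) =>
      (∀ i, (fun n => z (i, n)) ∈ reps s D) ∧ ∀ v : Fin s.n → M, v ∈ reps s D →
      ((fun c => Sum.elim (fun n : Fin 1 × Fin s.n => v n.2) z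
        (match c with | (.inl a, n) => .inl (a, n) | (.inr a, n) => .inr (a, n))) ∈ tupleReps s R ↔
        ∃ u, Branch r i j u x ∧ s.E.r (fun n => u (f n)) v)) (definable_and
        (definable_forall_finite fun i => definable_reps hD _) (definable_forall
        (P := fun (x : Fin q ⊕ (Fin k × Fin s.n) → M) (v : Fin s.n → M) => v ∈ reps s D →
      ((fun c => Sum.elim (fun n : Fin 1 × Fin s.n => v n.2) (fun a => x (.inr a))
        (match c with | (.inl a, n) => .inl (a, n) | (.inr a, n) => .inr (a, n))) ∈ tupleReps s R ↔
        ∃ u, Branch r i j u (fun a => x (.inl a)) ∧ s.E.r (fun n => u (f n)) v)) (definable_imp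
        (definable_reps hD _) (definable_iff ?_ (definable_exists (P := fun
          (x : (Fin q ⊕ (Fin k × Fin s.n)) ⊕ Fin s.n → M) u =>
          Branch r i j u (fun a => x (.inl (.inl a))) ∧
            s.E.r (fun n => u (f n)) fun a => x (.inr a)) (definable_and ?_
          (definable_setoid s _ _)))))))
    · convert hR.preimage_comp (fun c : (Fin 1 ⊕ Fin k) × Fin s.n => (match c with
        | (.inl a, n) => .inr n
        | (.inr a, n) => .inl (.inr (a, n)) : (Fin q ⊕ (Fin k × Fin s.n)) ⊕ Fin s.n)) using 1
      ext v
      simp only [Set.mem_ofPred_eq, Set.mem_preimage]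
      refine iff_of_eq (congrArg (· ∈ tupleReps s R) (funext fun c => ?_))
      rcases c with ⟨c | c, n⟩ <;> rfl
    · exact (branch_definable (A := ∅) r i j).preimage_comp
        (Sum.elim Sum.inr fun k => Sum.inl (Sum.inl (Sum.inl k)))
  have hχ' : ∀ x, x ∈ χ ↔ ∃ δ : Fin k → Quotient s.E, (∀ i, δ i ∈ D) ∧ ∀ c ∈ D,
      (Sum.elim (fun _ => c) δ ∈ R ↔ ∃ u, Branch r i j u x ∧ Quotient.mk s.E (u ∘ f) = c) := by
    intro x
    have aux : ∀ (v : Fin s.n → M) (z : Fin k × Fin s.n → M),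
        (fun c => Sum.elim (fun n : Fin 1 × Fin s.n => v n.2) z
        (match c with | (.inl a, n) => .inl (a, n) | (.inr a, n) => .inr (a, n))) ∈ tupleReps s R ↔
        Sum.elim (fun _ => Quotient.mk s.E v) (fun i => Quotient.mk s.E fun n => z (i, n)) ∈ R := by
      intro v z
      refine iff_of_eq (congrArg (· ∈ R) (funext fun c => ?_))
      rcases c with c | c <;> rfl
    constructor
    · rintro ⟨z, h1, h2⟩
      refine ⟨fun i => Quotient.mk s.E fun n => z (i, n), h1, fun c hc => ?_⟩
      obtain ⟨v, rfl⟩ := Quotient.exists_rep c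
      rw [← aux, h2 v hc]
      exact exists_congr fun u => and_congr Iff.rfl Quotient.eq.symm
    · rintro ⟨δ, h1, h2⟩
      choose z hz using fun i => Quotient.exists_rep (δ i)
      refine ⟨fun c => z c.1 c.2, fun i => ?_, fun v hv => ?_⟩
      · change Quotient.mk s.E (z i) ∈ D
        rw [hz]
        exact h1 i
      · rw [aux, show (fun i => Quotient.mk s.E fun n => z i n) = δ from funext hz, h2 _ hv]
        exact exists_congr fun u => and_congr Iff.rfl Quotient.eq
  obtain ⟨u, hu, hbr⟩ := hp.exists_chain hM
  have hpχ : p ∈ χ := (hχ' p).2 ⟨d, hd, fun c hc => by simp [hRd, hc]⟩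
  have huχ : ∀ m, u m ∈ χ := fun m =>
    (supportedBy_of_definable hM hχ _ _ (hu m) (fun c hc => hc.elim) _ _ fun i => ⟨i, rfl⟩).1 hpχ
  have huD : ∀ m, Quotient.mk s.E (u m ∘ f) ∈ D := fun m =>
    (supportedBy_of_definable hM hD _ _ (hu m) (fun c hc => hc.elim) _ _
      fun i => ⟨f i, rfl⟩).1 hpD
  choose δ hδ hδ' using fun m => (hχ' (u m)).1 (huχ m)
  obtain ⟨N, hN⟩ := hstab 1 k R hR
  -- For `m < n` the relation holds because `u m` branches into `u n`. Stability therefore gives a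
  -- positive instance with `n ≤ m`, that is a copy `x` which branches into `u n` and has the class
  -- of `u m`; by transitivity `x` branches into `u m` too.
  have : ∃ m n : ℕ, n ≤ m ∧ Sum.elim (fun _ => Quotient.mk s.E (u m ∘ f)) (δ n) ∈ R := by
    by_contra! hcon
    refine hN ⟨fun a _ => Quotient.mk s.E (u a ∘ f), fun b => δ b, fun a _ => huD a,
      fun b => hδ b, fun a b => ?_⟩
    constructor
    · intro h1
      by_contra h2
      exact hcon a b (not_lt.1 h2) h1
    · intro h1
      exact (hδ' b _ (huD a)).2 ⟨_, hbr a b h1, rfl⟩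
  obtain ⟨m, n, hle, h1⟩ := this
  obtain ⟨x, hx, hxe⟩ := (hδ' n _ (huD m)).1 h1
  have hpx : Copy p x := (hu n).trans hM (hx.1.symm hM)
  rcases hle.eq_or_lt with rfl | hlt
  · exact ⟨x, u n, hpx, hx, hxe⟩
  · exact ⟨x, u m, hpx, (hp.of_copy hM hpx).branch_trans hM hx (hbr n m hlt), hxe⟩

end IsFrame

/-- The elements of `St_∅` only depend on labels: a partial isomorphism which fixes the labels
maps a representative of an element of `St_∅` to another representative of this element. -/
theorem mk_eq_of_mem_St (hM : IsConeTree M) {e : Imag coneLang M} (he : e ∈ St coneLang (∅ : Set M))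
    {S : Set (M × M)} (hS : Good (Equiv.refl _) S) {t t' : Fin e.1.n → M} (ht : Matches S t t')
    (h : Quotient.mk e.1.E t = e.2) : Quotient.mk e.1.E t' = e.2 := by
  obtain ⟨s, e⟩ := e
  obtain ⟨D, heD, hD, hemb, hstab⟩ := he
  obtain ⟨q, r, i, j, p, p', f, hp, hpp', hpt, hpt'⟩ := exists_frame hM hS ht
  have hpf : p ∘ f = t := funext hpt
  have hpf' : p' ∘ f = t' := funext hpt'
  obtain ⟨x, y, h1, h2, h3⟩ := hp.exists_branch_setoid hM s f (D := D) (by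
    change Quotient.mk s.E (p ∘ f) ∈ D
    rw [hpf]
    exact h.symm ▸ heD) hD hemb hstab
  have hx := hp.of_copy hM h1
  have hp' := hp.of_copy hM hpp'
  -- Conjugacy of branching pairs spreads the coincidence of classes from one pair to all of them.
  have key : ∀ u v, Copy x u → Branch r i j u v →
      Quotient.mk s.E (u ∘ f) = Quotient.mk s.E (v ∘ f) := by
    intro u v hu hv
    obtain ⟨T, hT, h4, h5⟩ := hx.branch_good hM hu h2 hv
    exact (setoid_iff_of_good hM s hT (fun k => h4 (f k)) (fun k => h5 (f k))).1 h3
  -- A third copy that branches off below the meet of the two roots branches from both `p` and `p'`,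
  -- so its class equals both of theirs.
  obtain ⟨m, hm⟩ := hM.meet _ _ hp.root hp'.root
  obtain ⟨w, v, h4, h5, h6⟩ := hp.exists_branch hM (hM.isPoint_left hm.1)
  have hvj : v j = p j := hp.label_eq₂ h4
  have k1 := key p v (h1.symm hM) ⟨h4, w, hM.lab_mono h5 hm.1, by rwa [hvj]⟩
  have k2 := key p' v ((h1.symm hM).trans hM hpp') ⟨(hpp'.symm hM).trans hM h4, w, by
    rw [hp.label_eq₁ hpp']
    exact hM.lab_mono h5 hm.2.1, by rwa [hvj]⟩
  rw [hpf] at k1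
  rw [hpf'] at k2
  exact (k2.trans k1.symm).trans h

end Stable

/-! ### Codes in St_∅ for sets of label tuples -/

section Codes

variable {M : Type u} [coneLang.Structure M]

/-- Sets of tuples of labels have codes in `St_∅`. -/
theorem exists_code (hM : IsConeTree M) {A : Set (Imag coneLang M)} {α : Type} [Finite α]
    {Θ : Set (α → M)} (hΘ : EqDefinable A Θ) (hl : ∀ v ∈ Θ, ∀ i, IsLabel (v i)) :
    ∃ d ∈ St coneLang (∅ : Set M) ∩ dclEq A, EqDefinable {d} Θ := by
  classical
  obtain ⟨C, hC, hsupp⟩ := hΘ.exists_supportedBy hM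
  obtain ⟨N, g, Y, hg, hY, hΘY⟩ := hsupp.exists_labels hM hC hl
  obtain ⟨x₀, hx₀⟩ := hM.exists_point
  let γ : (Fin (N + 2) → M) → Fin N → M := fun x k => x (Fin.castAdd 2 k)
  let a : Fin (N + 2) := Fin.natAdd N 0
  let b : Fin (N + 2) := Fin.natAdd N 1
  -- Label tuples with equal last two entries code members of the family defined by `Y`; those with
  -- different last two entries code the first of these. The latter make every label definable over
  -- an element of the sort, as `mem_St_of_labels` requires. Tuples that are not all labels stay out
  -- of the way, coding themselves.
  let F : (Fin (N + 2) → M) → (Fin (N + 2) → M) ⊕ (Set (α → M) ⊕ M) := fun x =>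
    if ∀ i, IsLabel (x i) then
      if x a = x b then .inr (.inl {v | Sum.elim v (γ x) ∈ Y}) else .inr (.inr (x a))
    else .inl x
  have hF : ∀ x y, F x = F y ↔ ((¬ (∀ i, IsLabel (x i)) ∧ ¬ (∀ i, IsLabel (y i)) ∧ ∀ i, x i = y i) ∨
      (((∀ i, IsLabel (x i)) ∧ ∀ i, IsLabel (y i)) ∧
        ((x a = x b ∧ y a = y b ∧ ∀ v, Sum.elim v (γ x) ∈ Y ↔ Sum.elim v (γ y) ∈ Y) ∨
          (x a ≠ x b ∧ y a ≠ y b ∧ x a = y a)))) := by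
    intro x y
    simp only [F]
    by_cases h1 : ∀ i, IsLabel (x i) <;> by_cases h2 : ∀ i, IsLabel (y i) <;>
      by_cases h3 : x a = x b <;> by_cases h4 : y a = y b <;>
      simp only [h1, h2, h3, h4, if_true, if_false, Sum.inr.injEq, Sum.inl.injEq, reduceCtorEq,
        not_true_eq_false, not_false_eq_true, true_and, and_true, false_and, and_false, or_false,
        false_or, ne_eq, Set.ext_iff, Set.mem_ofPred_eq, funext_iff, forall_const]
  have hlabel : ∀ {β : Type} (f : Fin (N + 2) → β),
      (∅ : Set M).Definable coneLang {v : β → M | ∀ i, IsLabel (v (f i))} := fun f =>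
    definable_forall_finite fun i => definable_not (isPoint_definable _)
  have hYdef : ∀ {β : Type} (f : α → β) (k : Fin N → β),
      (∅ : Set M).Definable coneLang {v : β → M |
        Sum.elim (fun i => v (f i)) (fun i => v (k i)) ∈ Y} := by
    intro β f k
    convert hY.preimage_comp (Sum.elim f k) using 1
    ext v
    simp only [Set.mem_ofPred_eq, Set.mem_preimage]
    refine iff_of_eq (congrArg (· ∈ Y) (funext fun c => ?_))
    rcases c with c | c <;> rfl
  let s : ImagSort coneLang M :=
    { n := N + 2
      E := Setoid.ker F
      definable := by
        change (∅ : Set M).Definable coneLang {v : Fin (N + 2) ⊕ Fin (N + 2) → M |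
          F (fun i => v (.inl i)) = F (fun i => v (.inr i))}
        simp only [hF]
        refine definable_or (definable_and (definable_not (hlabel _)) (definable_and
          (definable_not (hlabel _)) (definable_forall_finite fun i => definable_eq _ _)))
          (definable_and (definable_and (hlabel _) (hlabel _)) (definable_or
          (definable_and (definable_eq _ _) (definable_and (definable_eq _ _)
            (definable_forall (P := fun (x : Fin (N + 2) ⊕ Fin (N + 2) → M) v =>
              Sum.elim v (γ fun i => x (.inl i)) ∈ Y ↔ Sum.elim v (γ fun i => x (.inr i)) ∈ Y)
              (definable_iff (hYdef Sum.inr fun k => Sum.inl (Sum.inl (Fin.castAdd 2 k)))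
                (hYdef Sum.inr fun k => Sum.inl (Sum.inr (Fin.castAdd 2 k)))))))
          (definable_and (definable_not (definable_eq _ _)) (definable_and
            (definable_not (definable_eq _ _)) (definable_eq _ _))))) }
  have hmk : ∀ x y : Fin (N + 2) → M, Quotient.mk s.E x = Quotient.mk s.E y ↔ F x = F y :=
    fun x y => Quotient.eq
  let D : Set (Quotient s.E) := {d | ∃ x : Fin (N + 2) → M, (∀ i, IsLabel (x i)) ∧
    Quotient.mk s.E x = d}
  have hD : reps s D = {x : Fin (N + 2) → M | ∀ i, IsLabel (x i)} := by
    ext x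
    constructor
    · rintro ⟨y, hy, h⟩
      rcases (hF y x).1 ((hmk y x).1 h) with h' | h'
      · exact absurd hy h'.1
      · exact h'.1.2
    · exact fun hx => ⟨x, hx, rfl⟩
  have h3 : ∀ l : M, IsLabel l → ∃ d ∈ D, EqDefinable {(⟨s, d⟩ : Imag coneLang M)}
      {x : Unit → M | x () = l} := by
    intro l hl
    obtain ⟨l', hl', hne⟩ := hM.exists_isLabel_notMem (Set.finite_singleton l)
    let x : Fin (N + 2) → M := fun i => if i = b then l' else l
    have hx : ∀ i, IsLabel (x i) := fun i => by
      simp only [x]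
      split_ifs
      exacts [hl', hl]
    have hab : a ≠ b := fun h => by simp [a, b, Fin.ext_iff] at h
    have hxa : x a = l := if_neg hab
    have hxb : x b = l' := if_pos rfl
    refine ⟨Quotient.mk s.E x, ⟨x, hx, rfl⟩, ?_⟩
    have h := eqDefinable_exists (P := fun (v : Unit → M) (y : Fin s.n → M) =>
      y ∈ reps s {Quotient.mk s.E x} ∧ v () = y a) (eqDefinable_and (eqDefinable_comp Sum.inr
        (eqDefinable_reps (Set.mem_singleton (⟨s, Quotient.mk s.E x⟩ : Imag coneLang M))))
        (EqDefinable.of_definable (definable_eq _ _)))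
    rw [show {v : Unit → M | v () = l} = {v | ∃ y : Fin s.n → M,
      y ∈ reps s {Quotient.mk s.E x} ∧ v () = y a} from Set.ext fun v => ?_]
    · exact h
    constructor
    · intro hv
      exact ⟨x, rfl, hv.trans hxa.symm⟩
    · rintro ⟨y, hy, hv⟩
      rw [Set.mem_ofPred_eq, hv, ← hxa]
      rcases (hF y x).1 ((hmk y x).1 hy) with h' | ⟨-, h' | h'⟩
      · exact absurd hx h'.2.1
      · exact absurd (hxa ▸ hxb ▸ h'.2.1.symm) hne
      · exact h'.2.2
  obtain ⟨l, hl', -⟩ := hM.exists_isLabel_notMem Set.finite_empty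
  let z : Fin (N + 2) → M := Fin.append g fun _ => l
  have hz : ∀ i, IsLabel (z i) := by
    intro i
    refine Fin.addCases (fun i => ?_) (fun i => ?_) i
    · simp only [z, Fin.append_left]
      exact hg i
    · simp only [z, Fin.append_right]
      exact hl'
  have hzγ : γ z = g := funext fun k => by simp [γ, z]
  have hzab : z a = z b := by simp [z, a, b]
  have hreps : ∀ x : Fin (N + 2) → M, x ∈ reps s {Quotient.mk s.E z} ↔ (∀ i, IsLabel (x i)) ∧
      x a = x b ∧ ∀ v, v ∈ Θ ↔ Sum.elim v (γ x) ∈ Y := by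
    intro x
    have h : x ∈ reps s {Quotient.mk s.E z} ↔ F x = F z := hmk x z
    rw [h, hF]
    simp only [hz, hzγ, hzab, hΘY]
    simp
    refine fun _ _ => forall_congr' fun v => ?_
    exact ⟨fun h => h.symm, fun h => h.symm⟩
  refine ⟨⟨s, Quotient.mk s.E z⟩, ⟨?_, ?_⟩, ?_⟩
  · refine mem_St_of_labels hM hx₀ (Set.empty_subset _) s D (fun x hx => ?_) ?_ h3 ⟨z, hz, rfl⟩
    · rw [hD] at hx
      exact hx
    · rw [hD]
      exact hlabel _
  · change EqDefinable A (reps s {Quotient.mk s.E z})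
    rw [show reps s {Quotient.mk s.E z} = _ from Set.ext hreps]
    exact eqDefinable_and (EqDefinable.of_definable (hlabel _)) (eqDefinable_and
      (EqDefinable.of_definable (definable_eq _ _)) (eqDefinable_forall
        (P := fun (x : Fin (N + 2) → M) v => v ∈ Θ ↔ Sum.elim v (γ x) ∈ Y)
        (eqDefinable_iff (eqDefinable_comp Sum.inr hΘ) (EqDefinable.of_definable
          (hYdef Sum.inr fun k => .inl (Fin.castAdd 2 k))))))
  · have h := eqDefinable_exists (P := fun (v : α → M) (y : Fin s.n → M) =>
      y ∈ reps s {Quotient.mk s.E z} ∧ Sum.elim v (γ y) ∈ Y) (eqDefinable_and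
        (eqDefinable_comp Sum.inr
          (eqDefinable_reps (Set.mem_singleton (⟨s, Quotient.mk s.E z⟩ : Imag coneLang M))))
        (EqDefinable.of_definable (hYdef Sum.inl fun k => .inr (Fin.castAdd 2 k))))
    rw [show Θ = {v | ∃ y : Fin s.n → M, y ∈ reps s {Quotient.mk s.E z} ∧
      Sum.elim v (γ y) ∈ Y} from Set.ext fun v => ?_]
    · exact h
    constructor
    · intro hv
      exact ⟨z, rfl, by rwa [hzγ, ← hΘY]⟩
    · rintro ⟨y, hy, hv⟩
      exact (((hreps y).1 hy).2.2 v).2 hv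

end Codes

/-! ### Replacing parameters by their trace on St_∅ -/

section DefinableClosure

variable {M : Type u} [coneLang.Structure M]

/-- The tuple `u` satisfies the formulas which describe the configuration of `p`, apart from the
equalities between labels. -/
def SameShape {ι : Type} (p u : ι → M) : Prop :=
  (∀ i, IsPoint (p i) ↔ IsPoint (u i)) ∧ (∀ i j, Le (p i) (p j) ↔ Le (u i) (u j)) ∧
    (∀ i j k, IsMeet (p k) (p i) (p j) → IsMeet (u k) (u i) (u j)) ∧
      ∀ i j k, Lab (p i) (p j) (p k) → Lab (u i) (u j) (u k)

theorem sameShape_definable {ι : Type} [Finite ι] (p : ι → M) :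
    (∅ : Set M).Definable coneLang {u | SameShape p u} :=
  definable_and (definable_forall_finite fun i => definable_iff (definable_const _)
    (isPoint_definable i)) (definable_and (definable_forall_finite fun i =>
      definable_forall_finite fun j => definable_iff (definable_const _) (le_definable i j))
    (definable_and (definable_forall_finite fun i => definable_forall_finite fun j =>
      definable_forall_finite fun k => definable_imp (definable_const _) (isMeet_definable k i j))
    (definable_forall_finite fun i => definable_forall_finite fun j =>
      definable_forall_finite fun k => definable_imp (definable_const _) (lab_definable i j k))))

theorem SameShape.copy (hM : IsConeTree M) {ι : Type} [Finite ι] {p u v : ι → M} (hp : Copy p p) (hu : SameShape p u)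
    (hv : SameShape p v) (h : ∀ i, IsLabel (p i) → v i = u i) : Copy u v where
  finite := Set.finite_range _
  nonempty := by
    obtain ⟨_, ⟨i, rfl⟩, hi⟩ := hp.nonempty
    exact ⟨_, ⟨i, rfl⟩, (hu.1 i).1 hi⟩
  point := by
    rintro _ ⟨i, rfl⟩
    exact (hu.1 i).symm.trans (hv.1 i)
  label := by
    rintro _ ⟨i, rfl⟩ hi
    exact h i fun h' => hi ((hu.1 i).1 h')
  le := by
    rintro _ ⟨i, rfl⟩ _ ⟨j, rfl⟩
    exact (hu.2.1 i j).symm.trans (hv.2.1 i j)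
  meet := by
    rintro _ ⟨i, rfl⟩ _ ⟨j, rfl⟩ hi hj
    obtain ⟨_, ⟨k, rfl⟩, hk, -⟩ := hp.meet _ ⟨i, rfl⟩ _ ⟨j, rfl⟩ ((hu.1 i).2 hi) ((hu.1 j).2 hj)
    exact ⟨_, ⟨k, rfl⟩, hu.2.2.1 i j k hk, hv.2.2.1 i j k hk⟩
  lab := by
    rintro _ ⟨i, rfl⟩ _ ⟨j, rfl⟩ hij
    have hlt : Lt (p i) (p j) := by
      refine ⟨(hu.2.1 i j).2 hij.1, fun hpe => ?_⟩
      refine hij.2 (hM.antisymm _ _ hij.1 ((hu.2.1 j i).1 ?_))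
      have h1 := (hu.2.1 i j).2 hij.1
      rw [hpe] at h1 ⊢
      exact h1
    obtain ⟨_, ⟨k, rfl⟩, hk, -⟩ := hp.lab _ ⟨i, rfl⟩ _ ⟨j, rfl⟩ hlt
    exact ⟨_, ⟨k, rfl⟩, hu.2.2.2 i j k hk, hv.2.2.2 i j k hk⟩

/-- Elements of `St_∅` only see the labels in a configuration of representatives, so what `A` says
about them is a set of label tuples, and this set has a code in `St_∅ ∩ dcl(A)`. -/
theorem mem_dclEq_of_mem_St (hM : IsConeTree M) {A B : Set (Imag coneLang M)}
    (hB : B ⊆ St coneLang (∅ : Set M)) {e : Imag coneLang M} (he : e ∈ St coneLang (∅ : Set M))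
    (h : e ∈ dclEq (A ∪ B)) : e ∈ dclEq ((St coneLang (∅ : Set M) ∩ dclEq A) ∪ B) := by
  obtain ⟨n, b, hb, hX⟩ : ∃ (n : ℕ) (b : Fin n → Imag coneLang M), (∀ i, b i ∈ B) ∧
      EqDefinable (A ∪ Set.range b) (reps e.1 {e.2}) := by
    obtain ⟨k, e', he', R, hR⟩ := h
    obtain ⟨n, b, -, hb⟩ := ((Set.finite_range e').subset
      (Set.inter_subset_left (t := B))).fin_param
    refine ⟨n, b, fun i => ?_, k, e', fun i => ?_, R, hR⟩
    · have : b i ∈ Set.range b := ⟨i, rfl⟩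
      rw [hb] at this
      exact this.2
    · rw [hb]
      exact (he' i).imp_right fun h => ⟨⟨i, rfl⟩, h⟩
  obtain ⟨W, hW, hWe⟩ := hX.exists_family
  obtain ⟨x₀, hx₀⟩ := exists_isRep b
  obtain ⟨t₀, ht₀⟩ := Quotient.exists_rep e.2
  obtain ⟨P, hxP, hP, -⟩ := exists_closed hM ((Set.finite_range x₀).union (Set.finite_range t₀))
  obtain ⟨q, p, -, hp⟩ := hP.finite.fin_param
  have hmem : ∀ y ∈ P, ∃ k, p k = y := fun y hy => by
    rw [← hp] at hy
    exact hy
  choose f hf using fun i => hmem (x₀ i) (hxP (Or.inl ⟨i, rfl⟩))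
  choose g hg using fun i => hmem (t₀ i) (hxP (Or.inr ⟨i, rfl⟩))
  have hcopy : Copy p p := by
    have : (Set.range fun k => (p k, p k)) = (fun x => (x, x)) '' P := by
      rw [← hp, ← Set.range_comp]
      rfl
    rw [Copy, this]
    exact hP
  have hpp : SameShape p p := ⟨fun _ => Iff.rfl, fun _ _ => Iff.rfl, fun _ _ _ h => h,
    fun _ _ _ h => h⟩
  have hxf : (fun i => p (f i)) = x₀ := funext hf
  have htg : (fun i => p (g i)) = t₀ := funext hg
  -- The label tuples of those configurations, of the shape of `p`, in which `W` relates the part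
  -- for `b` to the part for `e`.
  let Θ : Set ({i // IsLabel (p i)} → M) := {l | (∀ i, IsLabel (l i)) ∧ ∃ u : Fin q → M,
    (SameShape p u ∧ ∀ i : {i // IsLabel (p i)}, u i = l i) ∧
      Sum.elim (fun i => u (f i)) (fun i => u (g i)) ∈ W}
  have hΘ : EqDefinable A Θ := by
    refine eqDefinable_and (EqDefinable.of_definable (definable_forall_finite fun i =>
      definable_not (isPoint_definable i))) (eqDefinable_exists
        (P := fun (l : {i // IsLabel (p i)} → M) (u : Fin q → M) =>
          (SameShape p u ∧ ∀ i : {i // IsLabel (p i)}, u i = l i) ∧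
            Sum.elim (fun i => u (f i)) (fun i => u (g i)) ∈ W) (eqDefinable_and
          (EqDefinable.of_definable (definable_and ?_ (definable_forall_finite fun i =>
            definable_eq _ _))) ?_))
    · exact (sameShape_definable p).preimage_comp Sum.inr
    · convert eqDefinable_comp (β := {i // IsLabel (p i)} ⊕ Fin q)
        (Sum.elim (fun i => Sum.inr (f i)) fun i => Sum.inr (g i)) hW using 2
      ext v
      refine iff_of_eq (congrArg (· ∈ W) (funext fun c => ?_))
      rcases c with c | c <;> rfl
  obtain ⟨d, hd, hdΘ⟩ := exists_code hM hΘ fun v hv => hv.1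
  have hdA : d ∈ (St coneLang (∅ : Set M) ∩ dclEq A) ∪ B := Or.inl hd
  have hset : reps e.1 {e.2} = {t | ∃ u : Fin q → M, (SameShape p u ∧
      (fun i : {i // IsLabel (p i)} => u i) ∈ Θ) ∧
      (∀ i, (fun j => u (f ⟨i, j⟩)) ∈ reps (b i).1 {(b i).2}) ∧
        e.1.E.r t fun i => u (g i)} := by
    ext t
    constructor
    · intro ht
      refine ⟨p, ⟨hpp, fun i => i.2, p, ⟨hpp, fun _ => rfl⟩, ?_⟩, fun i => ?_, ?_⟩
      · rw [hxf, htg]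
        exact (hWe x₀ hx₀ t₀).1 ht₀
      · change Quotient.mk _ (fun j => p (f ⟨i, j⟩)) = _
        rw [← hx₀ i]
        congr 1
        funext j
        exact hf ⟨i, j⟩
      · rw [htg]
        exact Quotient.exact ((show Quotient.mk e.1.E t = e.2 from ht).trans ht₀.symm)
    -- The configuration `u'` that witnesses membership in `Θ` is a copy of `u` with the same
    -- labels, so it represents the same elements of `St_∅`. The relation `W` can thus be used at
    -- `u'`, and its conclusion carried back to `u`.
    · rintro ⟨u, ⟨hu, -, u', ⟨hu', hl⟩, hW'⟩, hub, ht⟩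
      have hc : Copy u u' := hu.copy hM hcopy hu' fun i hi => hl ⟨i, hi⟩
      have h1 : IsRep b fun i => u' (f i) := fun i =>
        mk_eq_of_mem_St hM (hB (hb i)) hc (fun j => ⟨f ⟨i, j⟩, rfl⟩) (hub i)
      have h2 : (fun i => u' (g i)) ∈ reps e.1 {e.2} := (hWe _ h1 _).2 hW'
      have h3 := mk_eq_of_mem_St hM he (hc.symm hM) (fun j => ⟨g j, rfl⟩) h2
      exact (Quotient.sound ht).trans h3
  change EqDefinable _ (reps e.1 {e.2})
  rw [hset]
  refine eqDefinable_exists (P := fun (t : Fin e.1.n → M) (u : Fin q → M) => (SameShape p u ∧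
      (fun i : {i // IsLabel (p i)} => u i) ∈ Θ) ∧
      (∀ i, (fun j => u (f ⟨i, j⟩)) ∈ reps (b i).1 {(b i).2}) ∧
        e.1.E.r t fun i => u (g i)) (eqDefinable_and (eqDefinable_and ?_ ?_) (eqDefinable_and
      (eqDefinable_forall_fin fun i => ?_) (EqDefinable.of_definable (definable_setoid _ _ _))))
  · exact EqDefinable.of_definable ((sameShape_definable p).preimage_comp Sum.inr)
  · exact (eqDefinable_comp (fun i : {i // IsLabel (p i)} => (Sum.inr i : Fin e.1.n ⊕ Fin q))
      hdΘ).mono (Set.singleton_subset_iff.2 hdA)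
  · exact (eqDefinable_comp (fun j => (Sum.inr (f ⟨i, j⟩) : Fin e.1.n ⊕ Fin q))
      (eqDefinable_reps (Set.mem_singleton (b i)))).mono
        (Set.singleton_subset_iff.2 (Or.inr (hb i)))

end DefinableClosure

/-! ### Binary trees for a sequence of relations -/

section Trees

variable {X : Type*}

/-- `x` is a leaf of a binary tree of height `d`, whose branching at height `j` is at the level
`k + j` of the sequence `r` of relations; its leaves agree with `x` below the level `k`. -/
def treeSet (r : ℕ → X → X → Prop) : ℕ → ℕ → Set X
  | 0, k => {x | ∀ i < k, r i x x}
  | d + 1, k => {x | x ∈ treeSet r d (k + 1) ∧ ∃ x', x' ∈ treeSet r d (k + 1) ∧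
      (∀ i < k, r i x x') ∧ ¬ r k x x'}

/-- By recursion on the height: the first bit of `s` selects the subtree of `x` or that of `x'`, and
the remaining bits select a leaf in it. Leaves from different subtrees agree below level `k` and are
separated there, like `x` and `x'`. -/
theorem exists_leaves {r : ℕ → X → X → Prop} (hs : ∀ i x y, r i x y → r i y x)
    (ht : ∀ i x y z, r i x y → r i y z → r i x z) (d k : ℕ) {x : X} (hx : x ∈ treeSet r d k) :
    ∃ F : (ℕ → Bool) → X, (∀ s, ∀ i < k, r i x (F s)) ∧ ∀ s s' j, j < d → (∀ i < j, s i = s' i) →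
      s j ≠ s' j → (∀ i < k + j, r i (F s) (F s')) ∧ ¬ r (k + j) (F s) (F s') := by
  induction d generalizing k x with
  | zero => exact ⟨fun _ => x, fun s i hi => hx i hi, fun s s' j hj => (Nat.not_lt_zero j hj).elim⟩
  | succ d ih =>
    obtain ⟨h1, x', h2, h3, h4⟩ := hx
    obtain ⟨F, hF, hF'⟩ := ih (k + 1) h1
    obtain ⟨G, hG, hG'⟩ := ih (k + 1) h2
    let sh : (ℕ → Bool) → ℕ → Bool := fun s i => s (i + 1)
    have key : ∀ s s', (∀ i < k, r i (F s) (G s')) ∧ ¬ r k (F s) (G s') := by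
      intro s s'
      refine ⟨fun i hi => ht _ _ _ _ (hs _ _ _ (hF s i (by omega)))
        (ht _ _ _ _ (h3 i hi) (hG s' i (by omega))), fun h => h4 ?_⟩
      exact ht _ _ _ _ (ht _ _ _ _ (hF s k (by omega)) h) (hs _ _ _ (hG s' k (by omega)))
    refine ⟨fun s => if s 0 then G (sh s) else F (sh s), fun s i hi => ?_, ?_⟩
    · by_cases h : s 0
      · simp only [h, if_true]
        exact ht _ _ _ _ (h3 i hi) (hG _ i (by omega))
      · simp only [h]
        exact hF _ i (by omega)
    · rintro s s' (_ | j) hj hss hne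
      · simp only [add_zero]
        by_cases h : s 0 <;> by_cases h' : s' 0
        · exact absurd (h.trans h'.symm) hne
        · simp only [h, h', if_true]
          have := key (sh s') (sh s)
          exact ⟨fun i hi => hs _ _ _ (this.1 i hi), fun h => this.2 (hs _ _ _ h)⟩
        · simp only [h, h', if_true]
          exact key (sh s) (sh s')
        · simp only [Bool.not_eq_true] at h h'
          exact absurd (h.trans h'.symm) hne
      · have h0 := hss 0 (Nat.succ_pos j)
        have h5 : ∀ i < j, sh s i = sh s' i := fun i hi => hss (i + 1) (by omega)
        rw [show k + (j + 1) = k + 1 + j by omega]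
        by_cases h : s 0
        · rw [h0] at h
          simp only [h0, h, if_true]
          exact hG' _ _ j (by omega) h5 hne
        · rw [h0] at h
          simp only [h0, h]
          exact hF' _ _ j (by omega) h5 hne

end Trees

/-! ### Counting leaves -/

section Counting

/-- Bounded number of colours for the pairs in the fibres of a map on the leaves of a binary tree,
where the colour of a pair determines its first difference. -/
theorem two_pow_le_of_coloring {K Q : Type*} [Fintype K] [Fintype Q] (n : ℕ)
    (f : (Fin n → Bool) → K) (c : (Fin n → Bool) → (Fin n → Bool) → Q)
    (h : ∀ s s' t t' : Fin n → Bool, f s = f s' → f t = f s → f t' = f s → c s s' = c t t' →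
      ∀ i j : Fin n, (∀ l < i, s l = s' l) → s i ≠ s' i → (∀ l < j, t l = t' l) → t j ≠ t' j →
        i = j) : 2 ^ n ≤ Fintype.card K * 2 ^ Fintype.card Q := by
  classical
  by_contra! hcon
  have hcard : Fintype.card K * 2 ^ Fintype.card Q < Fintype.card (Fin n → Bool) := by
    simpa using hcon
  obtain ⟨k, hk⟩ := Fintype.exists_lt_card_fiber_of_mul_lt_card f hcard
  have hfirst : ∀ s s' : Fin n → Bool, s ≠ s' → ∃ i, (∀ l < i, s l = s' l) ∧ s i ≠ s' i := by
    intro s s' hne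
    obtain ⟨i, hi⟩ := Function.ne_iff.1 hne
    obtain ⟨m, hm, hmin⟩ := WellFounded.has_min (wellFounded_lt (α := Fin n))
      {i | s i ≠ s' i} ⟨i, hi⟩
    exact ⟨m, fun l hl => by_contra fun h' => hmin l h' hl, hm⟩
  -- Within the chosen fibre a colour determines the level of the first difference. Reading `s` at
  -- the levels of all colours therefore separates the elements of the fibre, which bounds its size
  -- by `2 ^ card Q`.
  let lev : Q → Option (Fin n) := fun q =>
    if hq : ∃ i : Fin n, ∃ s s', f s = k ∧ f s' = k ∧ c s s' = q ∧ (∀ l < i, s l = s' l) ∧ s i ≠ s' i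
    then some hq.choose else none
  let g : (Fin n → Bool) → Q → Bool := fun s q => match lev q with
    | some i => s i
    | none => false
  have hg : Set.InjOn g {s | f s = k} := by
    intro s hs s' hs' hgs
    by_contra hne
    obtain ⟨i, hi, hi'⟩ := hfirst s s' hne
    have hq : ∃ i : Fin n, ∃ t t', f t = k ∧ f t' = k ∧ c t t' = c s s' ∧ (∀ l < i, t l = t' l) ∧
        t i ≠ t' i := ⟨i, s, s', hs, hs', rfl, hi, hi'⟩
    obtain ⟨t, t', ht, ht', hc, hj, hj'⟩ := hq.choose_spec
    have hij := h s s' t t' (hs.trans hs'.symm) (ht.trans hs.symm) (ht'.trans hs.symm) hc.symm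
      i _ hi hi' hj hj'
    have hlev : lev (c s s') = some i := by
      simp only [lev, dif_pos hq, hij]
    have := congrFun hgs (c s s')
    simp only [g, hlev] at this
    exact hi' this
  have := Finset.card_le_card_of_injOn (s := Finset.univ.filter fun s => f s = k)
    (t := Finset.univ) g (fun _ _ => Finset.mem_univ _) (by simpa using hg)
  simp at this
  omega

/-- Polynomial against exponential growth, in the shape of the count of codes: `b * n + c` is the
number of possible references. -/
theorem exists_lt_two_pow (a b c d e : ℕ) : ∃ n : ℕ, (a * (b * n + c) ^ 2) ^ d * e < 2 ^ n := by
  have h := tendsto_pow_const_div_const_pow_of_one_lt (2 * d) (r := (2 : ℝ)) one_lt_two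
  have h' := h.const_mul (((a * (b + c) ^ 2) ^ d * e : ℕ) : ℝ)
  rw [mul_zero] at h'
  obtain ⟨n, hn, hn1⟩ := ((h'.eventually_lt_const one_pos).and
    (Filter.eventually_ge_atTop 1)).exists
  refine ⟨n, ?_⟩
  rw [mul_div_assoc', div_lt_one (by positivity)] at hn
  have h1 : ((a * (b + c) ^ 2) ^ d * e) * n ^ (2 * d) < 2 ^ n := by exact_mod_cast hn
  refine lt_of_le_of_lt ?_ h1
  have h2 : b * n + c ≤ (b + c) * n := by nlinarith
  calc (a * (b * n + c) ^ 2) ^ d * e ≤ (a * ((b + c) * n) ^ 2) ^ d * e := by gcongr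
    _ = _ := by
      rw [pow_mul n 2 d, show a * ((b + c) * n) ^ 2 = a * (b + c) ^ 2 * n ^ 2 by ring, mul_pow,
        mul_right_comm]

end Counting

/-! ### Coding tuples over a closed set -/

section Sequences

variable {M : Type u} [coneLang.Structure M]

/-- The first `J` elements of the sequence `y` are successive one-element extensions of `P`. -/
def IsSteps (P : Set M) (y : ℕ → M) (J : ℕ) : Prop :=
  ∀ j < J, Step (P ∪ y '' Set.Iio j) (y j)

theorem image_Iio_succ {X : Type*} (y : ℕ → X) (j : ℕ) :
    y '' Set.Iio (j + 1) = insert (y j) (y '' Set.Iio j) := by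
  rw [← Set.image_insert_eq]
  congr 1
  ext i
  simp only [Set.mem_Iio, Set.mem_insert_iff]
  omega

theorem IsSteps.closed (hM : IsConeTree M) {P : Set M} (hP : Closed P) {y : ℕ → M} {J : ℕ}
    (h : IsSteps P y J) : Closed (P ∪ y '' Set.Iio J) := by
  induction J with
  | zero => simpa using hP
  | succ J ih =>
    rw [image_Iio_succ, Set.union_insert]
    exact (ih fun j hj => h j (by omega)).insert_step hM (h J (by omega))

theorem IsSteps.snoc {P : Set M} {y : ℕ → M} {J : ℕ} (h : IsSteps P y J) {z : M}
    (hz : Step (P ∪ y '' Set.Iio J) z) : ∃ y' : ℕ → M, (∀ j < J, y' j = y j) ∧ y' J = z ∧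
      P ∪ y' '' Set.Iio (J + 1) = insert z (P ∪ y '' Set.Iio J) ∧ IsSteps P y' (J + 1) := by
  let y' : ℕ → M := fun j => if j < J then y j else z
  have h1 : ∀ j < J, y' j = y j := fun j hj => if_pos hj
  have h2 : y' J = z := if_neg (lt_irrefl J)
  have h3 : ∀ j ≤ J, y' '' Set.Iio j = y '' Set.Iio j := fun j hj =>
    Set.image_congr fun i hi => h1 i (lt_of_lt_of_le hi hj)
  refine ⟨y', h1, h2, ?_, fun j hj => ?_⟩
  · rw [image_Iio_succ, h2, h3 J le_rfl, Set.union_insert]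
  · rw [h3 j (by omega)]
    rcases (Nat.lt_succ_iff_lt_or_eq.1 hj) with hj | rfl
    · rw [h1 j hj]
      exact h j hj
    · rw [h2]
      exact hz

theorem exists_isSteps (hM : IsConeTree M) {P : Set M} (hP : Closed P) (x : ℕ → M) (r : ℕ) :
    ∃ y, IsSteps P y (4 * r) ∧ ∀ i < r, ∃ j < 4 * r, y j = x i := by
  induction r with
  | zero => exact ⟨x, fun j hj => (Nat.not_lt_zero j hj).elim, fun j hj =>
      (Nat.not_lt_zero j hj).elim⟩
  | succ r ih =>
    obtain ⟨y, hy, hy'⟩ := ih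
    obtain ⟨a, b, c, s1, s2, s3, s4⟩ := exists_steps hM (hy.closed hM hP) (x r)
    obtain ⟨y1, h1, -, e1, hy1⟩ := hy.snoc s1
    rw [← e1] at s2 s3 s4
    obtain ⟨y2, h2, -, e2, hy2⟩ := hy1.snoc s2
    rw [← e2] at s3 s4
    obtain ⟨y3, h3, -, e3, hy3⟩ := hy2.snoc s3
    rw [← e3] at s4
    obtain ⟨y4, h4, h4', e4, hy4⟩ := hy3.snoc s4
    refine ⟨y4, hy4, fun i hi => ?_⟩
    rcases (Nat.lt_succ_iff_lt_or_eq.1 hi) with hi | rfl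
    · obtain ⟨j, hj, h⟩ := hy' i hi
      refine ⟨j, by omega, ?_⟩
      rw [h4 j (by omega), h3 j (by omega), h2 j (by omega), h1 j hj, h]
    · exact ⟨_, by omega, h4'⟩

/-- The value of a reference to an element of `P` or to a term of the sequence `y`. -/
def refVal {P : Set M} {J : ℕ} (y : ℕ → M) : P ⊕ Fin J → M :=
  Sum.elim (fun p => p) fun i => y i

/-- The kinds and data of the first `J` one-element extensions in `y` are given by `κ`. -/
def Coded {P : Set M} {J : ℕ} (κ : Fin J → MoveKind × (P ⊕ Fin J) × (P ⊕ Fin J)) (y : ℕ → M) :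
    Prop :=
  ∀ j : Fin J, Move (P ∪ y '' Set.Iio (j : ℕ)) (κ j).1 (y j) (refVal y (κ j).2.1) (refVal y (κ j).2.2) ∧
    ∀ i, (κ j).2.1 = .inr i ∨ (κ j).2.2 = .inr i → i < j

theorem IsSteps.exists_coded {P : Set M} {y : ℕ → M} {J : ℕ} (h : IsSteps P y J) :
    ∃ κ : Fin J → MoveKind × (P ⊕ Fin J) × (P ⊕ Fin J), Coded κ y := by
  have href : ∀ (j : Fin J), ∀ c ∈ P ∪ y '' Set.Iio (j : ℕ), ∃ a : P ⊕ Fin J, refVal y a = c ∧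
      ∀ i, a = .inr i → i < j := by
    rintro j c (hc | ⟨i, hi, rfl⟩)
    · exact ⟨.inl ⟨c, hc⟩, rfl, fun i hi => by simp at hi⟩
    · exact ⟨.inr ⟨i, lt_trans hi j.2⟩, rfl, fun i' hi' => by
        obtain rfl := Sum.inr.inj hi'
        exact hi⟩
  have : ∀ j : Fin J, ∃ a : MoveKind × (P ⊕ Fin J) × (P ⊕ Fin J),
      Move (P ∪ y '' Set.Iio (j : ℕ)) a.1 (y j) (refVal y a.2.1) (refVal y a.2.2) ∧
      ∀ i, a.2.1 = .inr i ∨ a.2.2 = .inr i → i < j := by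
    intro j
    obtain ⟨k, c, g, hm⟩ := h j j.2
    obtain ⟨a, rfl, ha⟩ := href j c hm.1
    obtain ⟨b, rfl, hb⟩ := href j g hm.2.1
    exact ⟨(k, a, b), hm, fun i hi => hi.elim (ha i) (hb i)⟩
  choose κ hκ using this
  exact ⟨κ, hκ⟩

/-- The code prescribes the same sequence of moves for `y` and `y'`, so the identity on `P` extends
one move at a time, provided `σ` sends the new labels of `y` to those of `y'`. -/
theorem Coded.good (hM : IsConeTree M) {P : Set M} (hP : Closed P) {J : ℕ}
    {κ : Fin J → MoveKind × (P ⊕ Fin J) × (P ⊕ Fin J)} {y y' : ℕ → M} (h : Coded κ y)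
    (h' : Coded κ y') {σ : {x : M // IsLabel x} ≃ {x : M // IsLabel x}}
    (hσ : ∀ x (hx : IsLabel x), x ∈ P → (σ ⟨x, hx⟩ : M) = x)
    (hσ' : ∀ j, (κ j).1 = .label → ∀ hy : IsLabel (y j), y' j = σ ⟨y j, hy⟩) :
    Good σ (((fun x : M => (x, x)) '' P) ∪ (fun j => (y j, y' j)) '' Set.Iio J) := by
  have key : ∀ m ≤ J, Good σ (((fun x : M => (x, x)) '' P) ∪
      (fun j => (y j, y' j)) '' Set.Iio m) := by
    intro m hm
    induction m with
    | zero => simpa using hP.good σ hσ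
    | succ m ih =>
      have hg := ih (by omega)
      rw [image_Iio_succ, Set.union_insert]
      let j : Fin J := ⟨m, hm⟩
      have hmem : ∀ a : P ⊕ Fin J, (∀ i, a = .inr i → i < j) → (refVal y a, refVal y' a) ∈
          ((fun x : M => (x, x)) '' P) ∪ (fun j => (y j, y' j)) '' Set.Iio m := by
        rintro (a | i) hi
        · exact Or.inl ⟨a, a.2, rfl⟩
        · exact Or.inr ⟨i, hi i rfl, rfl⟩
      refine hg.insert_move hM hM (hmem _ fun i hi => (h j).2 i (Or.inl hi))
        (hmem _ fun i hi => (h j).2 i (Or.inr hi)) (k := (κ j).1) ?_ ?_ (hσ' j)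
      · rw [Set.image_union, fst_image_diag, Set.image_image]
        exact (h j).1
      · rw [Set.image_union, snd_image_diag, Set.image_image]
        exact (h' j).1
  exact key J le_rfl

theorem Coded.label {P : Set M} {J : ℕ}
    {κ : Fin J → MoveKind × (P ⊕ Fin J) × (P ⊕ Fin J)} {y : ℕ → M} (h : Coded κ y) {j : Fin J}
    (hj : (κ j).1 = .label) : IsLabel (y j) ∧ y j ∉ P ∧ ∀ i < j, y j ≠ y i := by
  obtain ⟨⟨-, -, h1⟩, -⟩ := h j
  rw [hj] at h1
  exact ⟨h1.1, fun h2 => h1.2 (Or.inl h2), fun i hi h2 => h1.2 (Or.inr ⟨i, hi, h2.symm⟩)⟩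

/-- Two pairs of coded sequences with the same codes and the same equalities are conjugate under
partial isomorphisms that agree on the labels. -/
theorem exists_good_pair (hM : IsConeTree M) {P : Set M} (hP : Closed P) {J : ℕ}
    {κ : Fin J → MoveKind × (P ⊕ Fin J) × (P ⊕ Fin J)} {y z y' z' : ℕ → M} (hy : Coded κ y)
    (hz : Coded κ z) (hy' : Coded κ y') (hz' : Coded κ z')
    (h : ∀ i j : Fin J, y i = z j ↔ y' i = z' j) :
    ∃ (σ : {x : M // IsLabel x} ≃ {x : M // IsLabel x}) (S T : Set (M × M)), Good σ S ∧ Good σ T ∧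
      (∀ p ∈ P, (p, p) ∈ S) ∧ (∀ p ∈ P, (p, p) ∈ T) ∧ (∀ j : Fin J, (y j, y' j) ∈ S) ∧
        ∀ j : Fin J, (z j, z' j) ∈ T := by
  -- The label map to be extended to `σ`. The new labels in one coded sequence are distinct from
  -- each other and from those of `P`, so `h` is needed only to compare `y` with `z`. `S` and `T`
  -- share `σ`, but need not combine to a map of pairs.
  let F : Set (M × M) := {q | (q.1 = q.2 ∧ q.1 ∈ P ∧ IsLabel q.1) ∨
    ∃ j, (κ j).1 = .label ∧ (q = (y j, y' j) ∨ q = (z j, z' j))}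
  have hF : F.Finite := by
    refine ((hP.finite.image fun x => (x, x)).union ((Set.finite_range fun j : Fin J =>
      (y j, y' j)).union (Set.finite_range fun j : Fin J => (z j, z' j)))).subset ?_
    rintro ⟨a, b⟩ (⟨h1, h2, -⟩ | ⟨j, -, h1 | h1⟩)
    · exact Or.inl ⟨a, h2, by simp only at h1; rw [h1]⟩
    · exact Or.inr (Or.inl ⟨j, h1.symm⟩)
    · exact Or.inr (Or.inr ⟨j, h1.symm⟩)
  have hself : ∀ {u u' : ℕ → M}, Coded κ u → Coded κ u' → ∀ i j : Fin J, (κ i).1 = .label →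
      (κ j).1 = .label → (u i = u j ↔ u' i = u' j) := by
    intro u u' hu hu' i j hi hj
    rcases lt_trichotomy i j with hij | rfl | hij
    · exact iff_of_false (fun h => (hu.label hj).2.2 i hij h.symm)
        fun h => (hu'.label hj).2.2 i hij h.symm
    · exact iff_of_true rfl rfl
    · exact iff_of_false (fun h => (hu.label hi).2.2 j hij h)
        fun h => (hu'.label hi).2.2 j hij h
  have hP' : ∀ {u u' : ℕ → M}, Coded κ u → Coded κ u' → ∀ (i : Fin J) (p : M), p ∈ P →
      (κ i).1 = .label → (p = u i ↔ p = u' i) := by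
    intro u u' hu hu' i p hp hi
    exact iff_of_false (fun h => (hu.label hi).2.1 (h ▸ hp)) fun h => (hu'.label hi).2.1 (h ▸ hp)
  obtain ⟨σ, hσ⟩ := exists_perm_extend hM hF (by
    rintro ⟨a, b⟩ (⟨h1, h2, h3⟩ | ⟨j, hj, h1 | h1⟩)
    · exact ⟨h3, by simp only at h1 h3; rwa [h1] at h3⟩
    · obtain ⟨rfl, rfl⟩ := Prod.mk.inj h1
      exact ⟨(hy.label hj).1, (hy'.label hj).1⟩
    · obtain ⟨rfl, rfl⟩ := Prod.mk.inj h1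
      exact ⟨(hz.label hj).1, (hz'.label hj).1⟩) (by
    rintro ⟨a, b⟩ (⟨h1, h2, h3⟩ | ⟨i, hi, h1 | h1⟩) ⟨c, d⟩ (⟨k1, k2, k3⟩ | ⟨j, hj, k1 | k1⟩)
    · simp only at h1 k1
      rw [h1, k1]
    · obtain ⟨rfl, rfl⟩ := Prod.mk.inj k1
      simp only at h1 h2
      subst h1
      exact hP' hy hy' j a h2 hj
    · obtain ⟨rfl, rfl⟩ := Prod.mk.inj k1
      simp only at h1 h2
      subst h1
      exact hP' hz hz' j a h2 hj
    · obtain ⟨rfl, rfl⟩ := Prod.mk.inj h1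
      simp only at k1 k2
      subst k1
      rw [eq_comm, hP' hy hy' i c k2 hi, eq_comm]
    · obtain ⟨rfl, rfl⟩ := Prod.mk.inj h1
      obtain ⟨rfl, rfl⟩ := Prod.mk.inj k1
      exact hself hy hy' i j hi hj
    · obtain ⟨rfl, rfl⟩ := Prod.mk.inj h1
      obtain ⟨rfl, rfl⟩ := Prod.mk.inj k1
      exact h i j
    · obtain ⟨rfl, rfl⟩ := Prod.mk.inj h1
      simp only at k1 k2
      subst k1
      rw [eq_comm, hP' hz hz' i c k2 hi, eq_comm]
    · obtain ⟨rfl, rfl⟩ := Prod.mk.inj h1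
      obtain ⟨rfl, rfl⟩ := Prod.mk.inj k1
      simp only
      rw [eq_comm, h j i, eq_comm]
    · obtain ⟨rfl, rfl⟩ := Prod.mk.inj h1
      obtain ⟨rfl, rfl⟩ := Prod.mk.inj k1
      exact hself hz hz' i j hi hj)
  have hσP : ∀ x (hx : IsLabel x), x ∈ P → (σ ⟨x, hx⟩ : M) = x := fun x hx hxP =>
    hσ (x, x) (Or.inl ⟨rfl, hxP, hx⟩) hx
  exact ⟨σ, _, _, hy.good hM hP hy' hσP fun j hj hl =>
      (hσ (y j, y' j) (Or.inr ⟨j, hj, Or.inl rfl⟩) hl).symm,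
    hz.good hM hP hz' hσP fun j hj hl =>
      (hσ (z j, z' j) (Or.inr ⟨j, hj, Or.inr rfl⟩) hl).symm,
    fun p hp => Or.inl ⟨p, hp, rfl⟩, fun p hp => Or.inl ⟨p, hp, rfl⟩,
    fun j => Or.inr ⟨j, j.2, rfl⟩, fun j => Or.inr ⟨j, j.2, rfl⟩⟩

end Sequences

/-! ### Families of elements of St_∅ have no high trees -/

section Families

variable {M : Type u} [coneLang.Structure M] {α : Type}

/-- The members of the family `W` at `x` and `x'` intersect. -/
def Agree {m : ℕ} (W : Set (α ⊕ Fin m → M)) (x x' : α → M) : Prop :=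
  ∃ t, Sum.elim x t ∈ W ∧ Sum.elim x' t ∈ W

/-- The non-empty members of the family `W` consist of the representatives of an element
of `St_∅`. -/
structure IsStFamily (s : ImagSort coneLang M) (W : Set (α ⊕ Fin s.n → M)) : Prop where
  rel : ∀ x t t', Sum.elim x t ∈ W → (s.E.r t t' ↔ Sum.elim x t' ∈ W)
  mem : ∀ x t, Sum.elim x t ∈ W → (⟨s, Quotient.mk s.E t⟩ : Imag coneLang M) ∈ St coneLang ∅

namespace IsStFamily

variable {s : ImagSort coneLang M} {W : Set (α ⊕ Fin s.n → M)}

theorem agree_trans (hW : IsStFamily s W) {x y z : α → M} (h : Agree W x y) (h' : Agree W y z) :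
    Agree W x z := by
  obtain ⟨t, h1, h2⟩ := h
  obtain ⟨t', h3, h4⟩ := h'
  exact ⟨t, h1, (hW.rel z t' t h4).1 (s.E.symm ((hW.rel y t t' h2).2 h3))⟩

/-- A common representative `t` of the two members is moved to `t'` by `S` and to `t''` by `T`. Both
maps follow `σ`, so going back along `S` and on along `T` fixes the labels; hence `t'` and `t''`
represent the same element of `St_∅`. This is why a common `σ` suffices, without a joint
isomorphism. -/
theorem agree_of_good (hM : IsConeTree M) (hW : IsStFamily s W) {C : Set M}
    (hC : SupportedBy C W) {σ : {x : M // IsLabel x} ≃ {x : M // IsLabel x}} {S T : Set (M × M)}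
    (hS : Good σ S) (hT : Good σ T) (hCS : ∀ c ∈ C, (c, c) ∈ S) (hCT : ∀ c ∈ C, (c, c) ∈ T)
    {x x' y y' : α → M} (hx : Matches S x x') (hy : Matches T y y') (h : Agree W x y) :
    Agree W x' y' := by
  obtain ⟨t, h1, h2⟩ := h
  obtain ⟨t', S', h3, h4, h5⟩ := hS.extend_tuple hM hM t
  obtain ⟨t'', T', h6, h7, h8⟩ := hT.extend_tuple hM hM t
  have h1' := (hC σ S' h4 (fun c hc => h3 (hCS c hc)) _ _ ((hx.mono h3).elim h5)).1 h1
  have h2' := (hC σ T' h7 (fun c hc => h6 (hCT c hc)) _ _ ((hy.mono h6).elim h8)).1 h2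
  refine ⟨t', h1', ?_⟩
  refine (hW.rel y' t'' t' h2').1 ?_
  -- A composition is a partial isomorphism in the present sense only if a point survives in it, so
  -- `T` is first extended to a point of the domain of `S`.
  obtain ⟨⟨a, b⟩, hab, pa⟩ := hS.nonempty
  obtain ⟨c, T'', h9, h10, h11⟩ := h7.extend hM hM a
  have hg := Good.comp hM (h4.symm hM hM) h10 ⟨b, a, c, (h4.point _ (h3 hab)).1 pa,
    ⟨_, h3 hab, rfl⟩, h11⟩
  rw [Equiv.symm_trans_self] at hg
  have := mk_eq_of_mem_St hM (hW.mem x' t' h1') hg (t := t') (t' := t'')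
    (fun i => ⟨t i, ⟨_, h5 i, rfl⟩, h9 (h8 i)⟩) rfl
  exact Quotient.exact this

end IsStFamily

/-- A sequence of families of uniformly bounded complexity has no binary trees of
arbitrary height. -/
theorem exists_notMem_treeSet [Finite α] (hM : IsConeTree M) (s : ℕ → ImagSort coneLang M)
    (W : ∀ k, Set (α ⊕ Fin (s k).n → M)) (hW : ∀ k, IsStFamily (s k) (W k)) (C : ℕ → Set M)
    (hC : ∀ k, (C k).Finite) (hCW : ∀ k, SupportedBy (C k) (W k)) (m : ℕ)
    (hm : ∀ k, (C k).ncard ≤ m) (x : α → M) :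
    ∃ d, x ∉ treeSet (fun k => Agree (W k)) d 0 := by
  classical
  by_contra! hcon
  obtain ⟨r, ⟨ρ⟩⟩ := Finite.exists_equiv_fin α
  let J := 4 * r
  have : Fintype MoveKind := Fintype.ofFinite _
  have : Fintype α := Fintype.ofFinite _
  -- The height `n` is taken so large that `2 ^ n` exceeds the number of codes times `2` to the
  -- number of equality patterns. The first is polynomial in `n`, because the closed set `P` below
  -- has at most `4 * m * n + 1` elements; the second is constant.
  obtain ⟨n, hn⟩ := exists_lt_two_pow (Fintype.card MoveKind) (4 * m) (1 + J) J
    (Fintype.card (α → Fin J) * 2 ^ Fintype.card (Fin J → Fin J → Prop))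
  obtain ⟨F, -, hF⟩ := exists_leaves
    (fun i x y (h : Agree (W i) x y) => by
      obtain ⟨t, h1, h2⟩ := h
      exact (⟨t, h2, h1⟩ : Agree (W i) y x))
    (fun i x y z => (hW i).agree_trans) n 0 (hcon n)
  have hCn : (⋃ k ∈ Finset.range n, C k).ncard ≤ n * m := by
    refine (Finset.set_ncard_biUnion_le _ _).trans ?_
    refine (Finset.sum_le_card_nsmul _ _ m fun k _ => hm k).trans ?_
    simp
  have hCf : (⋃ k ∈ Finset.range n, C k).Finite :=
    Set.Finite.biUnion (Finset.finite_toSet _) fun k _ => hC k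
  obtain ⟨P, hCP, hP, hPn⟩ := exists_closed hM hCf
  have hCP' : ∀ k < n, C k ⊆ P := fun k hk =>
    (Set.subset_biUnion_of_mem (u := C) (by simpa using hk)).trans hCP
  have : Fintype P := hP.finite.fintype
  -- The code of a leaf: the moves that build it over `P`, and the places of its coordinates in that
  -- construction.
  let K := (Fin J → MoveKind × (P ⊕ Fin J) × (P ⊕ Fin J)) × (α → Fin J)
  let ext : (Fin n → Bool) → ℕ → Bool := fun s i => if h : i < n then s ⟨i, h⟩ else false
  have hext : ∀ (s : Fin n → Bool) (i : Fin n), ext s i = s i := fun s i => dif_pos i.2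
  have hcode : ∀ s : Fin n → Bool, ∃ (y : ℕ → M) (κ : K), Coded κ.1 y ∧
      ∀ i, F (ext s) i = y (κ.2 i) := by
    intro s
    obtain ⟨x₀, -⟩ := hM.exists_point
    obtain ⟨y, hy, hy'⟩ := exists_isSteps hM hP
      (fun i => if h : i < r then F (ext s) (ρ.symm ⟨i, h⟩) else x₀) r
    obtain ⟨κ, hκ⟩ := hy.exists_coded
    choose f hf hf' using fun i : α => hy' (ρ i) (ρ i).2
    refine ⟨y, (κ, fun i => ⟨f i, hf i⟩), hκ, fun i => ?_⟩
    rw [hf']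
    simp
  choose y κ hκ hy using hcode
  have hfirst : ∀ (s s' : Fin n → Bool) (i : Fin n), (∀ l < i, s l = s' l) → s i ≠ s' i →
      (∀ k < (i : ℕ), Agree (W k) (F (ext s)) (F (ext s'))) ∧
        ¬ Agree (W i) (F (ext s)) (F (ext s')) := by
    intro s s' i h1 h2
    have := hF (ext s) (ext s') i i.2 (fun l hl => by
      have hl' : l < n := lt_trans hl i.2
      exact (hext s ⟨l, hl'⟩).trans ((h1 ⟨l, hl'⟩ hl).trans (hext s' ⟨l, hl'⟩).symm))
      (by rwa [hext, hext])
    rw [Nat.zero_add] at this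
    exact this
  -- For pairs of leaves with one common code, the equality pattern decides agreement at all levels
  -- below `n`, hence also the level at which the leaves first separate.
  have hinv : ∀ s s' t t' : Fin n → Bool, κ s = κ s' → κ t = κ s → κ t' = κ s →
      (∀ i j : Fin J, y s i = y s' j ↔ y t i = y t' j) → ∀ k < n,
      Agree (W k) (F (ext s)) (F (ext s')) → Agree (W k) (F (ext t)) (F (ext t')) := by
    intro s s' t t' h1 h2 h3 hc k hk h
    obtain ⟨σ, S, T, hS, hT, i1, i2, i3, i4⟩ := exists_good_pair hM hP (hκ s)
      (by rw [h1]; exact hκ s') (by rw [← h2]; exact hκ t) (by rw [← h3]; exact hκ t') hc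
    refine (hW k).agree_of_good hM (hCW k) hS hT (fun c hc => i1 c (hCP' k hk hc))
      (fun c hc => i2 c (hCP' k hk hc)) (fun i => ?_) (fun i => ?_) h
    · rw [hy s, hy t, h2]
      exact i3 _
    · rw [hy s', hy t', h3, ← h1]
      exact i4 _
  have hle := two_pow_le_of_coloring n κ (fun s s' (i j : Fin J) => y s i = y s' j) (by
    intro s s' t t' h1 h2 h3 hc i j hi hi' hj hj'
    have hc' : ∀ a b : Fin J, y s a = y s' b ↔ y t a = y t' b := fun a b =>
      iff_of_eq (congrFun (congrFun hc a) b)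
    obtain ⟨k1, k2⟩ := hfirst s s' i hi hi'
    obtain ⟨k3, k4⟩ := hfirst t t' j hj hj'
    rcases lt_trichotomy i j with hij | hij | hij
    · exact absurd (hinv t t' s s' (h2.trans h3.symm) h2.symm (h1.symm.trans h2.symm)
        (fun a b => (hc' a b).symm) i i.2 (k3 i hij)) k2
    · exact hij
    · exact absurd (hinv s s' t t' h1 h2 h3 hc' j j.2 (k1 j hij)) k4)
  have hK : Fintype.card K ≤ (Fintype.card MoveKind * (4 * m * n + (1 + J)) ^ 2) ^ J *
      Fintype.card (α → Fin J) := by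
    have hPc : Fintype.card P + J ≤ 4 * m * n + (1 + J) := by
      rw [← Nat.card_eq_fintype_card, Nat.card_coe_set_eq]
      nlinarith
    simp only [K, Fintype.card_prod, Fintype.card_pi, Fintype.card_sum, Fintype.card_fin,
      Finset.prod_const, Finset.card_univ]
    gcongr
    rw [sq]
    gcongr
  have : 2 ^ n < 2 ^ n := hle.trans_lt (lt_of_le_of_lt (Nat.mul_le_mul_right _ hK) (by
    rw [mul_assoc]
    exact hn))
  exact lt_irrefl _ this

end Families

/-! ### The bounded stabilizing property -/

section BoundedStabilizing

/-- A well-ordered uncountable set contains increasing sequences on which a given function to `ℕ`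
is constant. -/
theorem exists_strictMono_const {ι : Type*} [LinearOrder ι] [WellFoundedLT ι] [Uncountable ι]
    (f : ι → ℕ) : ∃ (φ : ℕ → ι) (m : ℕ), StrictMono φ ∧ ∀ k, f (φ k) = m := by
  obtain ⟨m, hm⟩ : ∃ m, (f ⁻¹' {m}).Infinite := by
    by_contra! h
    refine not_countable (α := ι) (Set.countable_univ_iff.1 ?_)
    rw [show (Set.univ : Set ι) = ⋃ m, f ⁻¹' {m} by ext i; simp]
    exact Set.countable_iUnion fun m => (h m).countable
  let g := hm.natEmbedding
  obtain ⟨φ, hφ | hφ⟩ := exists_increasing_or_nonincreasing_subseq (· < ·) fun k => (g k : ι)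
  · exact ⟨fun k => g (φ k), m, fun a b hab => hφ a b hab, fun k => (g (φ k)).2⟩
  · refine (not_strictAnti_of_wellFoundedLT (fun k => (g (φ k) : ι)) fun a b hab => ?_).elim
    refine lt_of_le_of_ne (not_lt.1 (hφ a b hab)) fun h => ?_
    exact hab.ne (φ.injective (g.injective (Subtype.ext h))).symm

variable {M : Type u} [coneLang.Structure M]

theorem EqDefinable.agree {A : Set (Imag coneLang M)} {α : Type} {m : ℕ}
    {W : Set (α ⊕ Fin m → M)} (hW : EqDefinable A W) {β : Type} (f g : α → β) :
    EqDefinable A {v : β → M | Agree W (fun i => v (f i)) fun i => v (g i)} := by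
  have key : ∀ f : α → β, EqDefinable A {v : β ⊕ Fin m → M |
      Sum.elim (fun i => v (.inl (f i))) (fun j => v (.inr j)) ∈ W} := by
    intro f
    convert eqDefinable_comp (Sum.map f id) hW using 2
    ext v
    refine iff_of_eq (congrArg (· ∈ W) (funext fun c => ?_))
    rcases c with c | c <;> rfl
  exact eqDefinable_exists (P := fun (v : β → M) t => Sum.elim (fun i => v (f i)) t ∈ W ∧
    Sum.elim (fun i => v (g i)) t ∈ W) (eqDefinable_and (key f) (key g))

theorem eqDefinable_treeSet {A : Set (Imag coneLang M)} {α : Type} [Finite α]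
    (s : ℕ → ImagSort coneLang M) (W : ∀ k, Set (α ⊕ Fin (s k).n → M))
    (hW : ∀ k, EqDefinable A (W k)) (d k : ℕ) :
    EqDefinable A (treeSet (fun k => Agree (W k)) d k) := by
  induction d generalizing k with
  | zero => exact eqDefinable_forall_lt k fun i _ => (hW i).agree (fun a => a) fun a => a
  | succ d ih =>
    exact eqDefinable_and (ih (k + 1)) (eqDefinable_exists
      (P := fun (x x' : α → M) => x' ∈ treeSet (fun k => Agree (W k)) d (k + 1) ∧
        (∀ i < k, Agree (W i) x x') ∧ ¬ Agree (W k) x x') (eqDefinable_and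
      (eqDefinable_comp Sum.inr (ih (k + 1))) (eqDefinable_and
        (eqDefinable_forall_lt k fun i _ => (hW i).agree Sum.inl Sum.inr)
        (eqDefinable_not ((hW k).agree Sum.inl Sum.inr)))))

/-- An element of `St_∅` which is definable over `A` and a finite tuple `a` is a member of a family
of elements of `St_∅`. -/
theorem exists_isStFamily {A : Set (Imag coneLang M)} {n : ℕ}
    {a : Fin n → Imag coneLang M} {e : Imag coneLang M} (he : e ∈ St coneLang (∅ : Set M))
    (h : e ∈ dclEq (A ∪ Set.range a)) : ∃ W : Set (RepIdx a ⊕ Fin e.1.n → M), EqDefinable A W ∧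
      IsStFamily e.1 W ∧ ∀ x, IsRep a x → ∀ t, t ∈ reps e.1 {e.2} ↔ Sum.elim x t ∈ W := by
  obtain ⟨W, hW, hWe⟩ := EqDefinable.exists_family h
  obtain ⟨D, heD, hD, hemb, hstab⟩ := he
  have hcl : ∀ x t t', (Sum.elim x t ∈ W ∧ ∀ t'', e.1.E.r t t'' ↔ Sum.elim x t'' ∈ W) →
      (e.1.E.r t t' ↔ Sum.elim x t' ∈ W) := fun x t t' h => h.2 t'
  -- Only those fibres of `W` are kept that are exactly one class of an element of `D`. At
  -- representatives of `a` the fibre is of this form already, so nothing changes there.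
  refine ⟨{v | (fun j => v (.inr j)) ∈ reps e.1 D ∧ ∀ t', e.1.E.r (fun j => v (.inr j)) t' ↔
    Sum.elim (fun i => v (.inl i)) t' ∈ W}, ?_, ⟨?_, ?_⟩, ?_⟩
  · refine eqDefinable_and (EqDefinable.of_definable (definable_reps hD _)) (eqDefinable_forall
      (P := fun (v : RepIdx a ⊕ Fin e.1.n → M) t' => e.1.E.r (fun j => v (.inr j)) t' ↔
        Sum.elim (fun i => v (.inl i)) t' ∈ W) (eqDefinable_iff
        (EqDefinable.of_definable (definable_setoid _ _ _)) ?_))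
    convert eqDefinable_comp (Sum.elim (fun i => Sum.inl (Sum.inl i)) Sum.inr :
      RepIdx a ⊕ Fin e.1.n → (RepIdx a ⊕ Fin e.1.n) ⊕ Fin e.1.n) hW using 2
    ext v
    refine iff_of_eq (congrArg (· ∈ W) (funext fun c => ?_))
    rcases c with c | c <;> rfl
  · rintro x t t' ⟨h1, h2⟩
    simp only [Sum.elim_inr, Sum.elim_inl] at h1 h2
    constructor
    · intro h3
      refine ⟨?_, fun t'' => ?_⟩
      · change Quotient.mk _ t' ∈ D
        rw [← Quotient.sound h3]
        exact h1
      · simp only [Sum.elim_inr, Sum.elim_inl]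
        rw [← h2 t'']
        exact ⟨fun h4 => e.1.E.trans h3 h4, fun h4 => e.1.E.trans (e.1.E.symm h3) h4⟩
    · rintro ⟨-, h4⟩
      simp only [Sum.elim_inr, Sum.elim_inl] at h4
      exact (h2 t').2 ((h4 t').1 (e.1.E.refl t'))
  · rintro x t ⟨h1, -⟩
    exact ⟨D, h1, hD, hemb, hstab⟩
  · intro x hx t
    constructor
    · intro (ht : Quotient.mk _ t = e.2)
      refine ⟨?_, fun t' => ?_⟩
      · change Quotient.mk _ t ∈ D
        rw [ht]
        exact heD
      · simp only [Sum.elim_inr, Sum.elim_inl]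
        rw [← hWe x hx t']
        change _ ↔ Quotient.mk _ t' = e.2
        rw [← ht, Quotient.eq]
        exact ⟨fun h => e.1.E.symm h, fun h => e.1.E.symm h⟩
    · rintro ⟨-, h2⟩
      simp only [Sum.elim_inr, Sum.elim_inl] at h2
      exact (hWe x hx t).2 ((h2 t).1 (e.1.E.refl t))

/-- If every `e k` were new over `A` and its predecessors, the representative `x` of `a` would be a
leaf of trees of every height, which `exists_notMem_treeSet` excludes. -/
theorem exists_mem_dclEq (hM : IsConeTree M) {A : Set (Imag coneLang M)} {n : ℕ}
    (a : Fin n → Imag coneLang M) (e : ℕ → Imag coneLang M)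
    (W : ∀ k, Set (RepIdx a ⊕ Fin (e k).1.n → M)) (hWA : ∀ k, EqDefinable A (W k))
    (hW : ∀ k, IsStFamily (e k).1 (W k))
    (hWe : ∀ k x, IsRep a x → ∀ t, t ∈ reps (e k).1 {(e k).2} ↔ Sum.elim x t ∈ W k)
    (C : ℕ → Set M) (hC : ∀ k, (C k).Finite) (hCW : ∀ k, SupportedBy (C k) (W k)) (m : ℕ)
    (hm : ∀ k, (C k).ncard ≤ m) : ∃ k, e k ∈ dclEq (A ∪ e '' Set.Iio k) := by
  by_contra! hcon
  obtain ⟨x, hx⟩ := exists_isRep a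
  have hagree : ∀ k y, Agree (W k) x y ↔ ∃ t, t ∈ reps (e k).1 {(e k).2} ∧ Sum.elim y t ∈ W k :=
    fun k y => exists_congr fun t => and_congr (hWe k x hx t).symm Iff.rfl
  have hxx : ∀ k, Agree (W k) x x := fun k => by
    obtain ⟨t, ht⟩ := Quotient.exists_rep (e k).2
    exact ⟨t, (hWe k x hx t).1 ht, (hWe k x hx t).1 ht⟩
  have key : ∀ d k, x ∈ treeSet (fun k => Agree (W k)) d k := by
    intro d
    induction d with
    | zero => exact fun k i _ => hxx i
    | succ d ih =>
      intro k
      refine ⟨ih (k + 1), ?_⟩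
      by_contra! hno
      refine hcon k ?_
      change EqDefinable _ (reps (e k).1 {(e k).2})
      -- If no `y` in the tree set agrees with `x` at the levels below `k` and disagrees at `k`,
      -- then all `y` in it that agree with `e i` for `i < k` give the same member of `W k`. This
      -- defines `e k` over `A` and its predecessors.
      have hset : reps (e k).1 {(e k).2} = {t | ∃ y : RepIdx a → M,
          (y ∈ treeSet (fun k => Agree (W k)) d (k + 1) ∧
          ∀ i < k, ∃ u, u ∈ reps (e i).1 {(e i).2} ∧ Sum.elim y u ∈ W i) ∧
            Sum.elim y t ∈ W k} := by
        ext t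
        constructor
        · intro ht
          exact ⟨x, ⟨ih (k + 1), fun i _ => (hagree i x).1 (hxx i)⟩, (hWe k x hx t).1 ht⟩
        · rintro ⟨y, ⟨h1, h2⟩, h3⟩
          obtain ⟨t', h4, h5⟩ := hno y h1 fun i hi => (hagree i y).2 (h2 i hi)
          exact (hWe k x hx t).2 (((hW k).rel x t' t h4).1 (((hW k).rel y t' t h5).2 h3))
      have hcomp : ∀ {β γ : Type} {k : ℕ} (f : RepIdx a → γ) (g : Fin (e k).1.n → γ),
          EqDefinable A {v : γ → M | Sum.elim (fun i => v (f i)) (fun j => v (g j)) ∈ W k} := by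
        intro β γ k f g
        convert eqDefinable_comp (Sum.elim f g) (hWA k) using 2
        ext v
        refine iff_of_eq (congrArg (· ∈ W k) (funext fun c => ?_))
        rcases c with c | c <;> rfl
      rw [hset]
      refine eqDefinable_exists (P := fun (t : Fin (e k).1.n → M) (y : RepIdx a → M) =>
          (y ∈ treeSet (fun k => Agree (W k)) d (k + 1) ∧
          ∀ i < k, ∃ u, u ∈ reps (e i).1 {(e i).2} ∧ Sum.elim y u ∈ W i) ∧
            Sum.elim y t ∈ W k) (eqDefinable_and (eqDefinable_and ?_
          (eqDefinable_forall_lt k fun i hi => eqDefinable_exists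
            (P := fun (v : Fin (e k).1.n ⊕ RepIdx a → M) u => u ∈ reps (e i).1 {(e i).2} ∧
              Sum.elim (fun j => v (.inr j)) u ∈ W i) (eqDefinable_and ?_ ?_))) ?_)
      · exact (eqDefinable_comp Sum.inr
          (eqDefinable_treeSet _ W hWA d (k + 1))).mono Set.subset_union_left
      · exact (eqDefinable_comp Sum.inr (eqDefinable_reps (Set.mem_singleton (e i)))).mono
          (Set.singleton_subset_iff.2 (Or.inr ⟨i, hi, rfl⟩))
      · exact (hcomp (β := Unit) (fun j => Sum.inl (Sum.inr j)) Sum.inr).mono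
          Set.subset_union_left
      · exact (hcomp (β := Unit) Sum.inr Sum.inl).mono Set.subset_union_left
  obtain ⟨d, hd⟩ := exists_notMem_treeSet hM (fun k => (e k).1) W hW C hC hCW m hm x
  exact hd (key d 0)

/-- Uncountability is used to pass to an increasing sequence along which the sizes of the supports
are constant. -/
theorem not_strictMono_St (hM : IsConeTree M) {ι : Type*} [LinearOrder ι] [WellFoundedLT ι]
    [NoMaxOrder ι] [Uncountable ι] {A : Set (Imag coneLang M)} {n : ℕ}
    (a : Fin n → Imag coneLang M) (S : ι → Set (Imag coneLang M))
    (hS : ∀ i, St coneLang (∅ : Set M) ∩ dclEq A ⊆ S i ∧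
      S i ⊆ St coneLang ∅ ∩ dclEq (A ∪ Set.range a) ∧ St coneLang ∅ ∩ dclEq (S i) ⊆ S i) :
    ¬ StrictMono S := by
  intro hmono
  -- For each `i`, an element of the member of the chain at the successor of `i` that is not in `S
  -- i`.
  have hnext : ∀ i : ι, ∃ e, e ∉ S i ∧ ∀ j, i < j → e ∈ S j := by
    intro i
    obtain ⟨j, hj, hmin⟩ := WellFounded.has_min (wellFounded_lt (α := ι)) {j | i < j}
      (exists_gt i)
    obtain ⟨e, he, hei⟩ := Set.exists_of_ssubset (hmono hj)
    exact ⟨e, hei, fun k hk => hmono.monotone (not_lt.1 (hmin k hk)) he⟩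
  choose e he he' using hnext
  have hmem : ∀ i, e i ∈ St coneLang (∅ : Set M) ∩ dclEq (A ∪ Set.range a) := fun i => by
    obtain ⟨j, hj⟩ := exists_gt i
    exact (hS j).2.1 (he' i j hj)
  choose W hWA hW hWe using fun i => exists_isStFamily (hmem i).1 (hmem i).2
  choose C hC hCW using fun i => (hWA i).exists_supportedBy hM
  obtain ⟨φ, m, hφ, hm⟩ := exists_strictMono_const fun i => (C i).ncard
  obtain ⟨k, hk⟩ := exists_mem_dclEq hM a (fun k => e (φ k)) (fun k => W (φ k))
    (fun k => hWA _) (fun k => hW _) (fun k => hWe _) (fun k => C (φ k)) (fun k => hC _)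
    (fun k => hCW _) m fun k => (hm k).le
  have hsub : (fun k => e (φ k)) '' Set.Iio k ⊆ S (φ k) := by
    rintro _ ⟨i, hi, rfl⟩
    exact he' _ _ (hφ hi)
  have h1 : e (φ k) ∈ dclEq (A ∪ S (φ k)) :=
    EqDefinable.mono hk (Set.union_subset_union_right A hsub)
  -- The parameters `A` are replaced by their trace on `St_∅`, which lies in `S (φ k)`; relative
  -- definable closedness of `S (φ k)` then contradicts the choice of `e`.
  have h2 := mem_dclEq_of_mem_St hM (fun x hx => ((hS _).2.1 hx).1) (hmem _).1 h1
  refine he (φ k) ((hS _).2.2 ⟨(hmem _).1, EqDefinable.mono h2 ?_⟩)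
  exact Set.union_subset (hS _).1 subset_rfl

theorem hasBS (hM : IsConeTree M) (κ : Cardinal.{u}) : HasBS coneLang (M := M) κ ∅ := by
  rintro A - - n a ⟨S, hmono, hS⟩
  have : NoMaxOrder (Order.succ (max Cardinal.aleph0 coneLang.card)).ord.ToType :=
    Cardinal.noMaxOrder ((le_max_left _ _).trans (Order.le_succ _))
  have : Uncountable (Order.succ (max Cardinal.aleph0 coneLang.card)).ord.ToType := by
    rw [← Cardinal.aleph0_lt_mk_iff, Cardinal.mk_ord_toType]
    exact (le_max_left _ _).trans_lt (Order.lt_succ _)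
  exact not_strictMono_St hM a S hS hmono

end BoundedStabilizing

/-! ### Global types and ultrafilters -/

section GlobalTypes

variable {L : FirstOrder.Language.{0, 0}} {M : Type u} [L.Structure M]

theorem definable_realize {α : Type*} (φ : L[[M]].Formula α) :
    (Set.univ : Set M).Definable L {v : α → M | φ.Realize v} := by
  rw [Set.definable_iff_exists_formula_sum]
  refine ⟨Formula.relabel (Sum.map (fun m => ⟨m, trivial⟩) id)
    (BoundedFormula.constantsVarsEquiv φ), ?_⟩
  ext v
  simp only [Set.mem_ofPred_eq, Formula.realize_relabel]
  refine (BoundedFormula.realize_constantsVarsEquiv (φ := φ)).symm.trans (iff_of_eq ?_)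
  rw [Formula.Realize]
  congr 1
  funext j
  rcases j with j | j <;> rfl

theorem exists_formula_of_definable {α : Type*} {X : Set (α → M)}
    (h : (Set.univ : Set M).Definable L X) :
    ∃ φ : L[[M]].Formula α, ∀ v, φ.Realize v ↔ v ∈ X := by
  obtain ⟨φ, rfl⟩ := Set.definable_iff_exists_formula_sum.1 h
  refine ⟨BoundedFormula.constantsVarsEquiv.symm
    (Formula.relabel (Sum.map (fun m : (Set.univ : Set M) => (m : M)) id) φ), fun v => ?_⟩
  rw [Formula.Realize, ← BoundedFormula.realize_constantsVarsEquiv, _root_.Equiv.apply_symm_apply]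
  change (Formula.relabel _ φ).Realize _ ↔ _
  rw [Formula.realize_relabel]
  refine iff_of_eq ?_
  congr 1
  funext j
  rcases j with j | j <;> rfl

/-- A formula without solutions in `M` is refuted by the elementary diagram, so no type over `M`
contains it. -/
theorem not_holds_empty (p : GlobalType L M) : ¬ Holds p ∅ := by
  rintro ⟨φ, hφ, h⟩
  refine (p.not_mem_iff _).1 (p.mem_of_models (φ := (Formula.equivSentence φ).not) ?_) hφ
  intro N v xs
  let _ := ((L[[M]]).lhomWithConstants (Fin 1)).reduct N
  have hN : N ⊨ L.elementaryDiagram M := (LHom.onTheory_model _ _).1 N.is_model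
  let θ : L[[M]].Sentence :=
    Formula.iAlls (Fin 1) (Formula.relabel Sum.inr (∼φ))
  have hθ : θ ∈ L.elementaryDiagram M := by
    rw [elementaryDiagram, mem_completeTheory]
    simp only [θ, Sentence.Realize, Formula.realize_iAlls, Formula.realize_relabel,
      Formula.realize_not]
    intro x hx
    refine h (x 0) ?_
    convert hx using 1
    funext i
    rw [Subsingleton.elim i 0]
    rfl
  have h1 := hN.realize_of_mem θ hθ
  simp only [θ, Sentence.Realize, Formula.realize_iAlls, Formula.realize_relabel,
      Formula.realize_not] at h1
  have h2 : ¬ (Formula.equivSentence φ).Realize N := by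
    rw [Formula.realize_equivSentence]
    exact h1 _
  have e1 : v = default := Subsingleton.elim _ _
  have e2 : xs = default := Subsingleton.elim _ _
  subst e1 e2
  exact h2

theorem Holds.exists_mem {p : GlobalType L M} {X : Set M} (h : Holds p X) : ∃ x, x ∈ X := by
  by_contra! hX
  exact not_holds_empty p (h.mono hX)

theorem holds_or_compl (p : GlobalType L M) {X : Set M} (hX : (Set.univ : Set M).Definable₁ L X) :
    Holds p X ∨ Holds p Xᶜ := by
  obtain ⟨φ, hφ⟩ := exists_formula_of_definable hX
  rcases p.mem_or_not_mem (Formula.equivSentence φ) with h | h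
  · exact Or.inl ⟨φ, h, fun x hx => (hφ _).1 hx⟩
  · exact Or.inr ⟨∼φ, h, fun x hx hxX => hx ((hφ fun _ => x).2 hxX)⟩

theorem eq_of_holds {p q : GlobalType L M}
    (h : ∀ X : Set M, (Set.univ : Set M).Definable₁ L X → Holds p X → Holds q X) : p = q := by
  have key : ∀ ψ, ψ ∈ p → ψ ∈ q := by
    intro ψ hψ
    obtain ⟨φ, rfl⟩ := Formula.equivSentence.surjective ψ
    by_contra hq
    have h1 : Holds p {x | φ.Realize fun _ => x} := ⟨φ, hψ, fun x hx => hx⟩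
    have hd : (Set.univ : Set M).Definable₁ L {x | φ.Realize fun _ => x} := by
      have := definable_realize φ
      refine (congrArg (Set.Definable _ L) (Set.ext fun v => ?_)).mp this
      change φ.Realize v ↔ φ.Realize fun _ => v 0
      rw [show v = fun _ => v 0 from funext fun i => by rw [Subsingleton.elim i 0] ]
    have h2 : Holds q {x | ¬ φ.Realize fun _ => x} :=
      ⟨∼φ, (q.mem_or_not_mem _).resolve_left hq, fun x hx => hx⟩
    obtain ⟨x, hx, hx'⟩ := ((h _ hd h1).inter h2).exists_mem
    exact hx' hx
  refine SetLike.ext fun ψ => ⟨key ψ, fun hq => ?_⟩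
  by_contra hp
  exact (q.not_mem_iff ψ).1 (key _ ((p.mem_or_not_mem ψ).resolve_left hp)) hq

theorem exists_globalType [Nonempty M] (u : Ultrafilter M) : ∃ p : GlobalType L M,
    ∀ X : Set M, (Set.univ : Set M).Definable₁ L X → (Holds p X ↔ X ∈ u) := by
  let S : ∀ x : M, (L[[M]][[Fin 1]]).Structure ((fun _ : M => M) x) := fun x =>
    @Language.withConstantsStructure L[[M]] M _ (Fin 1) (constantsOn.structure fun _ => x)
  let N := (u : Filter M).Product fun _ => M
  have hN : ∀ ψ : (L[[M]][[Fin 1]]).Sentence, N ⊨ ψ ↔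
      ∀ᶠ x in (u : Filter M), (Formula.equivSentence.symm ψ).Realize fun _ => x := by
    intro ψ
    refine (@Ultraproduct.sentence_realize M (fun _ => M) u _ S _ ψ).trans ?_
    simp only [Formula.realize_equivSentence_symm]
  -- The theory of the ultrapower of `M` in which the variable is interpreted by the class of the
  -- identity.
  let p : GlobalType L M :=
    { toTheory := (L[[M]][[Fin 1]]).completeTheory N
      subset' := by
        rintro _ ⟨θ, hθ, rfl⟩
        rw [mem_completeTheory, hN]
        refine Filter.Eventually.of_forall fun x => ?_
        rw [Formula.realize_equivSentence_symm]
        let _ := constantsOn.structure fun _ : Fin 1 => x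
        exact (LHom.realize_onSentence M _ θ).2 hθ
      isMaximal' := completeTheory.isMaximal _ _ }
  have hp : ∀ φ : L[[M]].Formula (Fin 1), Formula.equivSentence φ ∈ p ↔
      {x | φ.Realize fun _ => x} ∈ u := by
    intro φ
    refine (hN _).trans ?_
    rw [_root_.Equiv.symm_apply_apply]
    rfl
  refine ⟨p, fun X hX => ⟨?_, fun h => ?_⟩⟩
  · rintro ⟨φ, hφ, h⟩
    exact Filter.mem_of_superset ((hp φ).1 hφ) h
  · obtain ⟨φ, hφ⟩ := exists_formula_of_definable hX
    refine ⟨φ, (hp φ).2 (Filter.mem_of_superset h fun x hx => (hφ _).2 hx), fun x hx => (hφ _).1 hx⟩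

end GlobalTypes

/-! ### Generic points over a closed set -/

section Generic

variable {M : Type u} [coneLang.Structure M]

/-- The points `x` which are generic over `B`: the meets of `x` with the points `c` of `B` are below
all the points of `B`, and the labels of `x` and of `c` at `x ∧ c` are not in `B`. -/
def genericSet (B : Set M) : Set M :=
  {x | IsPoint x ∧ ∀ c ∈ B, IsPoint c → ¬ Le x c ∧
    (∀ d ∈ B, IsPoint d → ∃ e, IsMeet e x c ∧ Lt e d) ∧
      ∀ g ∈ B, ∀ e, IsMeet e x c → ¬ Lab e x g ∧ ¬ Lab e c g}

theorem genericSet_anti {B B' : Set M} (h : B ⊆ B') : genericSet B' ⊆ genericSet B :=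
  fun _ hx => ⟨hx.1, fun c hc pc => ⟨(hx.2 c (h hc) pc).1, fun d hd => (hx.2 c (h hc) pc).2.1 d (h hd),
    fun g hg => (hx.2 c (h hc) pc).2.2 g (h hg)⟩⟩

/-- The position of a generic point over a closed set. -/
theorem exists_of_mem_genericSet (hM : IsConeTree M) {P : Set M} {r : M}
    (hr : r ∈ P) (pr : IsPoint r) {x : M} (hx : x ∈ genericSet P) :
    ∃ e g g', IsLabel g ∧ g ∉ P ∧ IsLabel g' ∧ g' ∉ P ∧ g ≠ g' ∧ Lab e r g ∧ Lab e x g' := by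
  obtain ⟨h1, h2, h3⟩ := hx.2 r hr pr
  obtain ⟨e, he, her⟩ := h2 r hr pr
  have hex : Lt e x := by
    refine ⟨he.1, fun h => h1 ?_⟩
    rw [← h]
    exact her.1
  obtain ⟨g, hg⟩ := hM.lab_total _ _ her
  obtain ⟨g', hg'⟩ := hM.lab_total _ _ hex
  refine ⟨e, g, g', hM.lab_isLabel hg, fun h => (h3 g h e he).2 hg, hM.lab_isLabel hg',
    fun h => (h3 g' h e he).1 hg', ?_, hg, hg'⟩
  rintro rfl
  obtain ⟨z, hz1, hz2, hz3⟩ := (hM.lab_cone _ _ _ _ hg' her).1 hg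
  exact hM.not_le_of_lt hz1 (he.2.2 z hz2 hz3)

/-- A generic `x` branches off below the root of `P`, at a point where both `x` and the root have
new labels, which differ. So `P` together with `x` is determined up to the names of these two
labels, and a permutation adjusts them. -/
theorem exists_good_of_mem_genericSet (hM : IsConeTree M) {P : Set M} (hP : Closed P) {x x' : M}
    (hx : x ∈ genericSet P) (hx' : x' ∈ genericSet P) :
    ∃ (σ : {x : M // IsLabel x} ≃ {x : M // IsLabel x}) (S : Set (M × M)), Good σ S ∧
      (∀ p ∈ P, (p, p) ∈ S) ∧ (x, x') ∈ S := by
  obtain ⟨r, hr, pr, hroot⟩ := hP.exists_root hM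
  obtain ⟨e, g, k, hg, hgP, hk, hkP, hne, h1, h2⟩ := exists_of_mem_genericSet hM hr pr hx
  obtain ⟨e', g', k', hg', hgP', hk', hkP', hne', h1', h2'⟩ :=
    exists_of_mem_genericSet hM hr pr hx'
  let F : Set (M × M) := insert (g, g') (insert (k, k') ((fun x => (x, x)) '' {x | x ∈ P ∧ IsLabel x}))
  have hF : F.Finite := (((hP.finite.subset fun x hx => hx.1).image _).insert _).insert _
  have aux : ∀ {a b p : M}, a ∉ P → b ∉ P → p ∈ P → (a = p ↔ b = p) := fun ha hb hp =>
    iff_of_false (fun h => ha (h ▸ hp)) fun h => hb (h ▸ hp)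
  have aux' : ∀ {a b p : M}, a ∉ P → b ∉ P → p ∈ P → (p = a ↔ p = b) := fun ha hb hp =>
    iff_of_false (fun h => ha (h ▸ hp)) fun h => hb (h ▸ hp)
  obtain ⟨σ, hσ⟩ := exists_perm_extend hM hF (by
    rintro q (rfl | rfl | ⟨p, ⟨-, hp⟩, rfl⟩)
    exacts [⟨hg, hg'⟩, ⟨hk, hk'⟩, ⟨hp, hp⟩]) (by
    rintro q (rfl | rfl | ⟨p, ⟨hp, -⟩, rfl⟩) q' (rfl | rfl | ⟨p', ⟨hp', -⟩, rfl⟩)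
    · exact iff_of_true rfl rfl
    · exact iff_of_false hne hne'
    · exact aux hgP hgP' hp'
    · exact iff_of_false hne.symm hne'.symm
    · exact iff_of_true rfl rfl
    · exact aux hkP hkP' hp'
    · exact aux' hgP hgP' hp
    · exact aux' hkP hkP' hp
    · exact Iff.rfl)
  have G0 := hP.good σ fun p hp hpP => hσ (p, p) (Or.inr (Or.inr ⟨p, ⟨hpP, hp⟩, rfl⟩)) hp
  have G1 := G0.insert_label hM hM hg
  rw [hσ (g, g') (Or.inl rfl) hg] at G1
  have G2 := G1.insert_label hM hM hk
  rw [hσ (k, k') (Or.inr (Or.inl rfl)) hk] at G2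
  have f2 : Prod.fst '' insert (k, k') (insert (g, g') ((fun x : M => (x, x)) '' P)) =
      insert k (insert g P) := by
    rw [Set.image_insert_eq, Set.image_insert_eq, fst_image_diag]
  have s2 : Prod.snd '' insert (k, k') (insert (g, g') ((fun x : M => (x, x)) '' P)) =
      insert k' (insert g' P) := by
    rw [Set.image_insert_eq, Set.image_insert_eq, snd_image_diag]
  have down : ∀ {a b e : M}, IsLabel a → IsLabel b → Lab e r a → Move (insert b (insert a P))
      .down e r a := by
    intro a b e ha hb h
    refine ⟨Or.inr (Or.inr hr), Or.inr (Or.inl rfl), h, ?_⟩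
    rintro d (rfl | rfl | hd) hdr
    · exact absurd (hM.isPoint_left hdr.1) hb
    · exact absurd (hM.isPoint_left hdr.1) ha
    · exact absurd (hroot d hd (hM.isPoint_left hdr.1)) (hM.not_le_of_lt hdr)
  have up : ∀ {a b e x : M}, IsLabel a → IsLabel b → a ≠ b → Lab e r a → Lab e x b →
      Move (insert e (insert b (insert a P))) .up x e b := by
    intro a b e x ha hb hab h h'
    refine ⟨Or.inl rfl, Or.inr (Or.inl rfl), h', ?_⟩
    rintro d (rfl | rfl | rfl | hd) hl
    · exact (hM.lab_lt hl).irrefl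
    · exact hb (hM.isPoint_right (hM.lab_lt hl).1)
    · exact ha (hM.isPoint_right (hM.lab_lt hl).1)
    · exact hab (hM.lab_unique _ _ _ _
        (hM.lab_mono h (hroot d hd (hM.isPoint_right (hM.lab_lt hl).1))) hl)
  have G3 := G2.insert_move hM hM (k := .down) (c := r) (c' := r) (g := g) (g' := g') (y := e)
    (y' := e') (Or.inr (Or.inr ⟨r, hr, rfl⟩)) (Or.inr (Or.inl rfl))
    (by rw [f2]; exact down hg hk h1) (by rw [s2]; exact down hg' hk' h1') (by simp)
  have G4 := G3.insert_move hM hM (k := .up) (c := e) (c' := e') (g := k) (g' := k') (y := x)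
    (y' := x') (Or.inl rfl) (Or.inr (Or.inl rfl))
    (by rw [Set.image_insert_eq, f2]; exact up hg hk hne h1 h2)
    (by rw [Set.image_insert_eq, s2]; exact up hg' hk' hne' h1' h2') (by simp)
  exact ⟨σ, _, G4, fun p hp => Or.inr (Or.inr (Or.inr (Or.inr ⟨p, hp, rfl⟩))), Or.inl rfl⟩

theorem genericSet_nonempty (hM : IsConeTree M) {P : Set M} (hP : Closed P) :
    (genericSet P).Nonempty := by
  obtain ⟨r, hr, pr, hroot⟩ := hP.exists_root hM
  obtain ⟨e₀, he₀⟩ := hM.no_min r pr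
  obtain ⟨g, hg, hgP⟩ := hM.exists_isLabel_notMem hP.finite
  obtain ⟨k, hk, hkP⟩ := hM.exists_isLabel_notMem (hP.finite.insert g)
  obtain ⟨e, -, he, her⟩ := hM.generic e₀ r g he₀ hg
  obtain ⟨x, hx⟩ := hM.lab_surj e k (hM.isPoint_left he.1) hk
  have hgk : k ≠ g := fun h => hkP (Or.inl h)
  refine ⟨x, hM.isPoint_right (hM.lab_lt hx).1, fun c hc pc => ?_⟩
  have hec : Lab e c g := hM.lab_mono her (hroot c hc pc)
  have hmeet : IsMeet e x c := hM.meet_eq_of_lab_ne hx hec hgk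
  refine ⟨fun h => ?_, fun d hd pd => ⟨e, hmeet, hM.lt_of_lt_of_le he (hroot d hd pd)⟩,
    fun l hl e' he' => ?_⟩
  · exact hM.not_le_of_lt (hM.lab_lt hx) (hmeet.2.2 x (hM.refl _ (hM.isPoint_left h)) h)
  · obtain rfl := hM.isMeet_unique hmeet he'
    constructor
    · intro h
      exact hkP (Or.inr (hM.lab_unique _ _ _ _ hx h ▸ hl))
    · intro h
      exact hgP (hM.lab_unique _ _ _ _ hec h ▸ hl)

theorem genericSet_subset_or (hM : IsConeTree M) {P : Set M} (hP : Closed P) {X : Set M}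
    (hX : SupportedBy P {v : Fin 1 → M | v 0 ∈ X}) : genericSet P ⊆ X ∨ genericSet P ⊆ Xᶜ := by
  by_contra! h
  obtain ⟨⟨x, hx, hxX⟩, ⟨x', hx', hxX'⟩⟩ := And.intro (Set.not_subset.1 h.1) (Set.not_subset.1 h.2)
  obtain ⟨σ, S, hS, h1, h2⟩ := exists_good_of_mem_genericSet hM hP hx hx'
  have := hX σ S hS h1 (fun _ => x) (fun _ => x') fun _ => h2
  exact hxX (this.2 (not_not.1 hxX'))

/-- The filter generated by the sets of generic points over finite sets. -/
def genericFilter (M : Type u) [coneLang.Structure M] : Filter M where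
  sets := {X | ∃ B : Set M, B.Finite ∧ genericSet B ⊆ X}
  univ_sets := ⟨∅, Set.finite_empty, Set.subset_univ _⟩
  sets_of_superset := fun ⟨B, hB, h⟩ hXY => ⟨B, hB, h.trans hXY⟩
  inter_sets := fun ⟨B, hB, h⟩ ⟨B', hB', h'⟩ => ⟨B ∪ B', hB.union hB', Set.subset_inter
    ((genericSet_anti Set.subset_union_left).trans h)
    ((genericSet_anti Set.subset_union_right).trans h')⟩

theorem mem_genericFilter {X : Set M} :
    X ∈ genericFilter M ↔ ∃ B : Set M, B.Finite ∧ genericSet B ⊆ X := Iff.rfl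

theorem genericFilter_neBot (hM : IsConeTree M) : (genericFilter M).NeBot := by
  rw [← Filter.empty_mem_iff_bot.not.trans Filter.neBot_iff.symm, mem_genericFilter]
  rintro ⟨B, hB, h⟩
  obtain ⟨P, hBP, hP, -⟩ := exists_closed hM hB
  obtain ⟨x, hx⟩ := genericSet_nonempty hM hP
  exact h (genericSet_anti hBP hx)

/-- Generic points over `P` are conjugate over `P`, so a set supported by `P` contains all of them
or none; the type is therefore determined by its generic sets. -/
theorem holds_iff_genericSet_subset (hM : IsConeTree M) {p : GlobalType coneLang M}
    (hp : ∀ B : Set M, B.Finite → Holds p (genericSet B)) {P : Set M} (hP : Closed P) {X : Set M}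
    (hX : SupportedBy P {v : Fin 1 → M | v 0 ∈ X}) : Holds p X ↔ genericSet P ⊆ X := by
  refine ⟨fun h => ?_, fun h => (hp P hP.finite).mono h⟩
  refine (genericSet_subset_or hM hP hX).resolve_right fun h' => ?_
  obtain ⟨x, hx, hx'⟩ := (h.inter (hp P hP.finite)).exists_mem
  exact h' hx' hx

end Generic

/-! ### Existence, definability and uniqueness of the generic type -/

section GenericType

variable {M : Type u} [coneLang.Structure M]

theorem genericSet_definable {α β : Type} [Finite β] {A : Set M} (i : α) (c : β → α) :
    A.Definable coneLang {v : α → M | v i ∈ genericSet (Set.range fun b => v (c b))} := by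
  have key : ∀ v : α → M, v i ∈ genericSet (Set.range fun b => v (c b)) ↔ IsPoint (v i) ∧
      ∀ b, IsPoint (v (c b)) → ¬ Le (v i) (v (c b)) ∧
        (∀ b', IsPoint (v (c b')) → ∃ e, IsMeet e (v i) (v (c b)) ∧ Lt e (v (c b'))) ∧
          ∀ b', ∀ e, IsMeet e (v i) (v (c b)) → ¬ Lab e (v i) (v (c b')) ∧
            ¬ Lab e (v (c b)) (v (c b')) := by
    intro v
    simp only [genericSet, Set.mem_ofPred_eq, Set.forall_mem_range]
  simp only [key]
  exact definable_and (isPoint_definable _) (definable_forall_finite fun b =>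
    definable_imp (isPoint_definable _) (definable_and (definable_not (le_definable _ _))
      (definable_and (definable_forall_finite fun b' => definable_imp (isPoint_definable _)
        (definable_exists_one (P := fun (v : α → M) e => IsMeet e (v i) (v (c b)) ∧
          Lt e (v (c b'))) (definable_and (isMeet_definable _ _ _) (lt_definable _ _))))
      (definable_forall_finite fun b' => definable_forall_one
        (P := fun (v : α → M) e => IsMeet e (v i) (v (c b)) → ¬ Lab e (v i) (v (c b')) ∧
            ¬ Lab e (v (c b)) (v (c b'))) (definable_imp (isMeet_definable _ _ _)
          (definable_and (definable_not (lab_definable _ _ _))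
            (definable_not (lab_definable _ _ _))))))))

theorem definable_fiber {L : FirstOrder.Language.{0, 0}} {M : Type u} [L.Structure M] {n : ℕ}
    {Y : Set (Fin (n + 1) → M)} (hY : (∅ : Set M).Definable L Y) (b : Fin n → M) {C : Set M}
    (hb : ∀ i, b i ∈ C) : C.Definable₁ L {x | (Fin.cons x b : Fin (n + 1) → M) ∈ Y} := by
  have h := definable_subst (α := Fin 1) (β := Fin n) (hY.preimage_comp
    (Fin.cons (Sum.inl 0) fun i => Sum.inr i : Fin (n + 1) → Fin 1 ⊕ Fin n)) b hb
  refine (congrArg (Set.Definable _ L) (Set.ext fun v => ?_)).mp h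
  refine iff_of_eq (congrArg (· ∈ Y) (funext fun i => ?_))
  refine Fin.cases ?_ (fun i => ?_) i <;> rfl

theorem exists_generic (hM : IsConeTree M) : ∃ p : GlobalType coneLang M,
    ∀ B : Set M, B.Finite → Holds p (genericSet B) := by
  have := genericFilter_neBot hM
  have : Nonempty M := ⟨hM.exists_point.choose⟩
  obtain ⟨p, hp⟩ := exists_globalType (L := coneLang) (Ultrafilter.of (genericFilter M))
  refine ⟨p, fun B hB => (hp _ ?_).2 (Ultrafilter.of_le _ ⟨B, hB, subset_rfl⟩)⟩
  obtain ⟨n, b, -, rfl⟩ := hB.fin_param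
  exact definable_subst (α := Fin 1) (β := Fin n) (genericSet_definable (Sum.inl 0) Sum.inr) b
    fun _ => trivial

theorem exists_range_eq {X : Type*} {P : Set X} (hP : P.Finite) (hne : P.Nonempty) {m : ℕ}
    (h : P.ncard ≤ m) : ∃ f : Fin m → X, Set.range f = P := by
  have := hne.to_subtype
  have := hP.fintype
  obtain ⟨g⟩ : Nonempty (P ↪ Fin m) := Function.Embedding.nonempty_of_card_le (by
    rwa [← Nat.card_eq_fintype_card, Nat.card_coe_set_eq, Fintype.card_fin])
  let f : Fin m → P := Function.invFun g
  refine ⟨fun i => f i, ?_⟩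
  ext x
  constructor
  · rintro ⟨i, rfl⟩
    exact (f i).2
  · intro hx
    exact ⟨g ⟨x, hx⟩, congrArg Subtype.val (Function.leftInverse_invFun g.injective ⟨x, hx⟩)⟩

section

variable {p q : GlobalType coneLang M}

theorem isDefinableOver_of_generic (hM : IsConeTree M)
    (hp : ∀ B : Set M, B.Finite → Holds p (genericSet B)) : IsDefinableOver ∅ p := by
  intro n Y hY
  -- A formula with `n` parameters is in `p` exactly if it holds at all points generic over some set
  -- of size at most `4 * n + 1`: by `exists_closed`, a closed set of that size contains the
  -- parameters. The right-hand side is ∅-definable.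
  have hset : {b : Fin n → M | Holds p {x | (Fin.cons x b : Fin (n + 1) → M) ∈ Y}} =
      {b | ∃ b' : Fin (4 * n + 1) → M, ∀ x, x ∈ genericSet (Set.range b') →
        (Fin.cons x b : Fin (n + 1) → M) ∈ Y} := by
    ext b
    constructor
    · intro h
      obtain ⟨P, hbP, hP, hcard⟩ := exists_closed hM (Set.finite_range b)
      have hb : (Set.range b).ncard ≤ n := by
        rw [← Set.image_univ]
        refine (Set.ncard_image_le Set.finite_univ).trans ?_
        simp [Set.ncard_univ]
      obtain ⟨b', rfl⟩ := exists_range_eq hP.finite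
        (let ⟨x, hx, _⟩ := hP.isPoint; ⟨x, hx⟩) (hcard.trans (by omega) : _ ≤ 4 * n + 1)
      exact ⟨b', (holds_iff_genericSet_subset hM hp hP (supportedBy_of_definable hM
        (definable_fiber hY b fun i => hbP ⟨i, rfl⟩))).1 h⟩
    · rintro ⟨b', hb'⟩
      exact (hp _ (Set.finite_range b')).mono hb'
  rw [hset]
  refine definable_exists (P := fun (b : Fin n → M) (b' : Fin (4 * n + 1) → M) =>
    ∀ x, x ∈ genericSet (Set.range b') → (Fin.cons x b : Fin (n + 1) → M) ∈ Y)
    (definable_forall_one (P := fun (v : Fin n ⊕ Fin (4 * n + 1) → M) x =>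
      x ∈ genericSet (Set.range fun i => v (.inr i)) →
        (Fin.cons x fun i => v (.inl i) : Fin (n + 1) → M) ∈ Y)
      (definable_imp (genericSet_definable _ _) ?_))
  refine (congrArg (Set.Definable _ coneLang) (Set.ext fun v => ?_)).mp (hY.preimage_comp
    (Fin.cons (Sum.inr ()) fun i => Sum.inl (Sum.inl i) :
      Fin (n + 1) → (Fin n ⊕ Fin (4 * n + 1)) ⊕ Unit))
  refine iff_of_eq (congrArg (· ∈ Y) (funext fun i => ?_))
  refine Fin.cases ?_ (fun i => ?_) i <;> rfl

theorem isGenericType_of_generic (hp : ∀ B : Set M, B.Finite → Holds p (genericSet B)) :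
    IsGenericType p := by
  refine ⟨(hp ∅ Set.finite_empty).mono fun x hx => hx.1, fun c d pc pd =>
    (hp {c, d} (Set.toFinite _)).mono fun x hx => ?_⟩
  obtain ⟨h1, h2, -⟩ := hx.2 c (Or.inl rfl) pc
  exact ⟨h1, h2 d (Or.inr rfl) pd⟩

theorem holds_forall_mem {B : Set M} (hB : B.Finite) {P : M → M → Prop}
    (h : ∀ c ∈ B, Holds p {x | P c x}) : Holds p {x | ∀ c ∈ B, P c x} := by
  induction B, hB using Set.Finite.induction_on with
  | empty => exact (holds_univ p).mono fun x _ c hc => hc.elim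
  | @insert a B _ _ ih =>
    refine ((h a (Or.inl rfl)).inter (ih fun c hc => h c (Or.inr hc))).mono ?_
    rintro x ⟨h1, h2⟩ c (rfl | hc)
    exacts [h1, h2 c hc]

/-- An ∅-definable type is invariant under exchanging `g` with another label while fixing `c`. If it
contained `R x c g`, it would contain `R x c g'` too, against functionality. -/
theorem holds_not_of_functional (hM : IsConeTree M) (hq : IsDefinableOver ∅ q)
    {R : M → M → M → Prop}
    (hR : (∅ : Set M).Definable coneLang {w : Fin 3 → M | R (w 0) (w 1) (w 2)})
    (hf : ∀ x c g g', R x c g → R x c g' → g = g') {c g : M} (hc : IsPoint c) (hg : IsLabel g) :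
    Holds q {x | ¬ R x c g} := by
  classical
  refine (holds_or_compl q (X := {x | R x c g}) (definable_fiber hR ![c, g]
    fun _ => trivial)).resolve_left fun h => ?_
  obtain ⟨g', hg', hne⟩ := hM.exists_isLabel_notMem (Set.finite_singleton g)
  let σ : {x : M // IsLabel x} ≃ {x : M // IsLabel x} := Equiv.swap ⟨g, hg⟩ ⟨g', hg'⟩
  have hS := (Good.single hM hM σ hc hc).insert_label hM hM hg
  have h1 := supportedBy_of_definable hM (hq 2 _ hR) σ _ hS (fun c hc => hc.elim)
    ![c, g] ![c, g'] (by
      intro i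
      fin_cases i
      · exact Or.inr rfl
      · refine Or.inl (Prod.ext rfl ?_)
        simp [σ])
  obtain ⟨x, hx, hx'⟩ := (h.inter (h1.1 h)).exists_mem
  exact hne (hf x c g g' hx hx').symm

/-- The order conditions are given; that the labels at the meets avoid `B` is forced by
∅-definability. -/
theorem generic_of_isGenericType (hM : IsConeTree M) (hq : IsDefinableOver ∅ q)
    (hgen : IsGenericType q) (B : Set M) (hB : B.Finite) : Holds q (genericSet B) := by
  refine hgen.1.inter (holds_forall_mem hB (P := fun c x => IsPoint c → ¬ Le x c ∧
    (∀ d ∈ B, IsPoint d → ∃ e, IsMeet e x c ∧ Lt e d) ∧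
      ∀ g ∈ B, ∀ e, IsMeet e x c → ¬ Lab e x g ∧ ¬ Lab e c g) fun c _ => ?_)
  by_cases pc : IsPoint c
  swap
  · exact (holds_univ q).mono fun x _ h => absurd h pc
  have h1 : Holds q {x | ∀ d ∈ B, IsPoint d → ∃ e, IsMeet e x c ∧ Lt e d} := by
    refine holds_forall_mem hB (P := fun d x => IsPoint d → ∃ e, IsMeet e x c ∧ Lt e d)
      fun d _ => ?_
    by_cases pd : IsPoint d
    · exact (hgen.2 c d pc pd).mono fun x hx _ => hx.2
    · exact (holds_univ q).mono fun x _ h => absurd h pd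
  have h2 : Holds q {x | ∀ g ∈ B, ∀ e, IsMeet e x c → ¬ Lab e x g ∧ ¬ Lab e c g} := by
    refine holds_forall_mem hB (P := fun g x => ∀ e, IsMeet e x c → ¬ Lab e x g ∧ ¬ Lab e c g)
      fun g _ => ?_
    by_cases hg : IsLabel g
    swap
    · exact (holds_univ q).mono fun x _ e _ =>
        ⟨fun h => hg (hM.lab_isLabel h), fun h => hg (hM.lab_isLabel h)⟩
    have k1 := holds_not_of_functional hM hq (R := fun x c g => ∃ e, IsMeet e x c ∧ Lab e x g)
      (definable_exists_one (P := fun (w : Fin 3 → M) e => IsMeet e (w 0) (w 1) ∧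
        Lab e (w 0) (w 2)) (definable_and (isMeet_definable _ _ _) (lab_definable _ _ _)))
      (by
        rintro x c g g' ⟨e, he, h⟩ ⟨e', he', h'⟩
        obtain rfl := hM.isMeet_unique he he'
        exact hM.lab_unique _ _ _ _ h h') pc hg
    have k2 := holds_not_of_functional hM hq (R := fun x c g => ∃ e, IsMeet e x c ∧ Lab e c g)
      (definable_exists_one (P := fun (w : Fin 3 → M) e => IsMeet e (w 0) (w 1) ∧
        Lab e (w 1) (w 2)) (definable_and (isMeet_definable _ _ _) (lab_definable _ _ _)))
      (by
        rintro x c g g' ⟨e, he, h⟩ ⟨e', he', h'⟩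
        obtain rfl := hM.isMeet_unique he he'
        exact hM.lab_unique _ _ _ _ h h') pc hg
    exact (k1.inter k2).mono fun x hx e he => ⟨fun h => hx.1 ⟨e, he, h⟩, fun h => hx.2 ⟨e, he, h⟩⟩
  exact (((hgen.2 c c pc pc).inter h1).inter h2).mono fun x hx _ => ⟨hx.1.1.1, hx.1.2, hx.2⟩

theorem eq_of_generic (hM : IsConeTree M)
    (hp : ∀ B : Set M, B.Finite → Holds p (genericSet B))
    (hq : ∀ B : Set M, B.Finite → Holds q (genericSet B)) : p = q := by
  refine eq_of_holds fun X hX h => ?_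
  obtain ⟨C, -, hC, hs⟩ := exists_supportedBy hM hX
  obtain ⟨P, hCP, hP, -⟩ := exists_closed hM hC
  exact (hq P hP.finite).mono ((holds_iff_genericSet_subset hM hp hP (hs.mono hCP)).1 h)

theorem exists_realizes (hM : IsConeTree M)
    (hp : ∀ B : Set M, B.Finite → Holds p (genericSet B)) {c : M} (hc : IsPoint c) :
    ∃ a, IsPoint a ∧ ¬ Le a c ∧ Realizes p {c} a := by
  have hP := closed_singleton hM hc
  obtain ⟨a, ha⟩ := genericSet_nonempty hM hP
  exact ⟨a, ha.1, (ha.2 c rfl hc).1, fun X hX h =>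
    (holds_iff_genericSet_subset hM hp hP (supportedBy_of_definable hM hX)).1 h ha⟩

end

end GenericType

/-! ### The germ of the functions f_c -/

section Germs

variable {M : Type u} [coneLang.Structure M] {p : GlobalType coneLang M}

theorem exists_graph (hM : IsConeTree M) {c x : M} (h : ¬ Le x c) {e : M} (he : IsMeet e x c) :
    ∃ y, (coneMap hM).graph c x y := by
  obtain ⟨y, hy⟩ := hM.lab_total e x ⟨he.1, fun h' => h (by rw [← h']; exact he.2.1)⟩
  exact ⟨y, h, e, he, hy⟩

theorem holds_exists_graph (hM : IsConeTree M) (hp : IsGenericType p) {c : M} (hc : IsPoint c) :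
    Holds p {x | ∃ y, (coneMap hM).graph c x y} :=
  (hp.2 c c hc hc).mono fun _ ⟨h, _, he, _⟩ => exists_graph hM h he

theorem graph_mem_St (hM : IsConeTree M) {c a y : M} (h : (coneMap hM).graph c a y) :
    IsLabel y ∧ real coneLang y ∈ St coneLang {a} := by
  obtain ⟨-, e, -, hy⟩ := h
  exact ⟨hM.lab_isLabel hy, real_mem_St hM (hM.isPoint_right (hM.lab_lt hy).1)
    (hM.lab_isLabel hy)⟩

/-- For generic `x`, the meet with `c` lies below `c'` and the meet with `c'` lies below `c`, so
each is below the other. -/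
theorem sameGerm_coneMap (hM : IsConeTree M) (hp : IsGenericType p) {c c' : M} (hc : IsPoint c)
    (hc' : IsPoint c') : SameGerm p (coneMap hM) c c' := by
  refine ((hp.2 c c' hc hc').inter (hp.2 c' c hc' hc)).mono ?_
  rintro x ⟨⟨h1, e, he, hlt⟩, h1', e', he', hlt'⟩ y
  have hee : e = e' := hM.antisymm _ _ (he'.2.2 e he.1 hlt.1) (he.2.2 e' he'.1 hlt'.1)
  subst hee
  constructor
  · rintro ⟨-, f, hf, hy⟩
    exact ⟨h1', e, he', by rwa [hM.isMeet_unique he hf]⟩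
  · rintro ⟨-, f, hf, hy⟩
    exact ⟨h1, e, he, by rwa [hM.isMeet_unique he' hf]⟩

/-- For `c'` a label the function is nowhere defined, unlike `f_c`. Hence the representatives of the
germ are exactly the points, which makes the germ ∅-definable. -/
theorem isPoint_of_sameGerm (hM : IsConeTree M) (hp : IsGenericType p) {c c' : M}
    (hc : IsPoint c) (h : SameGerm p (coneMap hM) c' c) : IsPoint c' := by
  obtain ⟨x, hx, y, hy⟩ := (h.inter (holds_exists_graph hM hp hc)).exists_mem
  obtain ⟨-, e, he, -⟩ := (hx y).2 hy
  exact hM.isPoint_right he.2.1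

theorem germ_coneMap_eq (hM : IsConeTree M) (hd : IsDefinableOver ∅ p) (hp : IsGenericType p)
    {c c' : M} (hc : IsPoint c) (hc' : IsPoint c') :
    germ p hd (coneMap hM) c' = germ p hd (coneMap hM) c :=
  congrArg (Sigma.mk (germSort p hd (coneMap hM))) (Quotient.sound (sameGerm_coneMap hM hp hc' hc))

theorem germ_coneMap_mem_dclEq (hM : IsConeTree M) (hd : IsDefinableOver ∅ p)
    (hp : IsGenericType p) {c : M} (hc : IsPoint c) : germ p hd (coneMap hM) c ∈ dclEq ∅ := by
  refine EqDefinable.of_definable ?_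
  have h : reps (germ p hd (coneMap hM) c).1 {(germ p hd (coneMap hM) c).2} =
      {v : Fin 1 → M | IsPoint (v 0)} := by
    ext v
    constructor
    · intro h
      exact isPoint_of_sameGerm hM hp hc (Quotient.exact h)
    · intro h
      exact Quotient.sound (sameGerm_coneMap hM hp h hc)
  rw [h]
  exact isPoint_definable _

theorem dclEq_subset_aclEq {L : FirstOrder.Language.{0, 0}} {M : Type u} [L.Structure M]
    (A : Set (Imag L M)) : dclEq A ⊆ aclEq A :=
  fun e he => ⟨{e.2}, Set.finite_singleton _, rfl, he⟩

/-- No label is algebraic over a point and the germ of the functions `f_c`. -/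
theorem real_notMem_aclEq (hM : IsConeTree M) (hd : IsDefinableOver ∅ p)
    (hp : IsGenericType p) {c a y : M} (hc : IsPoint c) (ha : IsPoint a) (hy : IsLabel y) :
    real coneLang y ∉ aclEq {germ p hd (coneMap hM) c, real coneLang a} := by
  classical
  rintro ⟨D, hD, hyD, hdef⟩
  obtain ⟨k, e, Z, he, hZ, h⟩ := hdef.exists_normal
  -- The point `a` represents both parameters, itself and the germ, so the germ contributes nothing
  -- beyond `a`.
  have hrep : IsRep e fun _ => a := by
    intro i
    have key : ∀ f : Imag coneLang M, f ∈ ({germ p hd (coneMap hM) c, real coneLang a} :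
        Set (Imag coneLang M)) → Quotient.mk f.1.E (fun _ => a) = f.2 := by
      rintro f (rfl | rfl)
      · exact Quotient.sound (sameGerm_coneMap hM hp ha hc)
      · rfl
    exact key _ (he i)
  -- Exchanging `y` with any label `l` is compatible with fixing `a`, so the finite set `D` would
  -- contain all the labels.
  have hall : ∀ l : M, IsLabel l → Quotient.mk (realSort coneLang).E (fun _ => l) ∈ D := by
    intro l hl
    let σ : {x : M // IsLabel x} ≃ {x : M // IsLabel x} := Equiv.swap ⟨y, hy⟩ ⟨l, hl⟩
    have hS := (Good.single hM hM σ ha ha).insert_label hM hM hy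
    refine (h _ hrep fun _ => l).2 ((supportedBy_of_definable hM hZ σ _ hS (fun c hc => hc.elim)
      (Sum.elim (fun _ => y) fun _ => a) (Sum.elim (fun _ => l) fun _ => a) ?_).1
        ((h _ hrep fun _ => y).1 hyD))
    rintro (i | i)
    · refine Or.inl (Prod.ext rfl ?_)
      simp [σ]
    · exact Or.inr rfl
  let F : M → Quotient (realSort (L := coneLang) (M := M)).E := fun l => Quotient.mk _ fun _ => l
  have hF : F '' {l | IsLabel l} ⊆ D := by
    rintro _ ⟨l, hl, rfl⟩
    exact hall l hl
  exact hM.infinite (Set.Finite.of_finite_image (hD.subset hF) fun l _ l' _ hll =>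
    mk_realSort_eq.1 hll)

theorem not_isAlmostStrong (hM : IsConeTree M) (hd : IsDefinableOver ∅ p)
    (hp : ∀ B : Set M, B.Finite → Holds p (genericSet B)) {c : M} (hc : IsPoint c) :
    ¬ IsAlmostStrong p hd (coneMap hM) c := by
  intro h
  obtain ⟨a, ha, hac, hr⟩ := exists_realizes hM hp hc
  obtain ⟨e, he⟩ := hM.meet a c ha hc
  obtain ⟨y, hy⟩ := exists_graph hM hac he
  exact real_notMem_aclEq hM hd (isGenericType_of_generic hp) hc ha (graph_mem_St hM hy).1
    (h a y hr hy)

end Germs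
end GermStrength

open GermStrength
theorem mainTheorem6 :
    coneTheory.IsComplete ∧
    ∀ (M : Type u) [coneLang.Structure M] (hM : M ⊨ coneTheory) (κ : Cardinal.{u}),
      IsMonster coneLang M κ →
      HasBS coneLang (M := M) κ ∅ ∧
      ∃ (p : GlobalType coneLang M) (hp : IsDefinableOver ∅ p),
        IsGenericType p ∧
        (∀ q : GlobalType coneLang M, IsDefinableOver ∅ q → IsGenericType q → q = p) ∧
        ∀ c : M, IsPoint c →
          Holds p {x | ∃ y, (coneMap (model_coneTheory_iff.1 hM)).graph c x y} ∧
          (∀ a y, (coneMap (model_coneTheory_iff.1 hM)).graph c a y →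
            IsLabel y ∧ real coneLang y ∈ St coneLang {a}) ∧
          (∀ c' : M, IsPoint c' → germ p hp (coneMap (model_coneTheory_iff.1 hM)) c' =
            germ p hp (coneMap (model_coneTheory_iff.1 hM)) c) ∧
          germ p hp (coneMap (model_coneTheory_iff.1 hM)) c ∈ dclEq ∅ ∧
          ¬ IsStrong p hp (coneMap (model_coneTheory_iff.1 hM)) c ∧
          ¬ IsAlmostStrong p hp (coneMap (model_coneTheory_iff.1 hM)) c := by
  refine ⟨coneTheory_isComplete, fun M _ hM κ _ => ?_⟩
  have hT := model_coneTheory_iff.1 hM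
  obtain ⟨p, hp⟩ := exists_generic hT
  have hd := isDefinableOver_of_generic hT hp
  have hg := isGenericType_of_generic hp
  refine ⟨hasBS hT κ, p, hd, hg, fun q hq hq' =>
    eq_of_generic hT (generic_of_isGenericType hT hq hq') hp, fun c hc => ?_⟩
  have hns := not_isAlmostStrong hT hd hp hc
  exact ⟨holds_exists_graph hT hg hc, fun a y h => graph_mem_St hT h,
    fun c' hc' => germ_coneMap_eq hT hd hg hc hc', germ_coneMap_mem_dclEq hT hd hg hc,
    fun h => hns fun a y ha hy => dclEq_subset_aclEq _ (h a y ha hy), hns⟩
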